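/- Notation. For a partition $\lambda$ of $n$ let $\chi^\lambda$ be the (irreducible, rational-valued) character of the Specht module of $\lambda$ for the symmetric group $\mathfrak S_n$ in characteristic $0$ (it may equally be regarded as a character of the double cover $\hat{\mathfrak S}_n$ by inflation). The residue of the node $(r,c)$ is $c-r$ modulo $2$; the content of $\lambda$ is the multiset of residues of its nodes, and the content of a $2$-block of $\mathfrak S_n$ is the common content of the partitions $\lambda$ for which $\chi^\lambda$ lies in it. For $\varepsilon\in\{0,1\}$ write $\bar\varepsilon=1-\varepsilon$. If a character $\chi$ of $\mathfrak S_n$ lies in a single $2$-block with content $C$, then $e_\varepsilon\chi$ (for $n\geq1$) is the component of $\chi{\downarrow}_{\mathfrak S_{n-1}}$ lying in the $2$-block whose content is $C$ with one $\varepsilon$ removed, and $f_\varepsilon\chi$ is the component of $\chi{\uparrow}^{\mathfrak S_{n+1}}$ lying in the $2$-block whose content is $C$ with one $\varepsilon$ added (each being $0$ if there is no such block; $e_\varepsilon=0$ when $n=0$); both are extended linearly to generalised characters. Put $e_\varepsilon^{(k)}=e_\varepsilon^k/k!$, $f_\varepsilon^{(k)}=f_\varepsilon^k/k!$, and for $d\in\mathbb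 Z$ $$R_\varepsilon^{(d)}=\sum_{a\geq\max\{0,-d\}}(-1)^{a+d}f_\varepsilon^{(a+d)}f_{\bar\varepsilon}^{(a+d)}e_{\bar\varepsilon}^{(a)}e_\varepsilon^{(a)} .$$ Let $\kappa_r=(r,r-1,\dots,1)$ for $r\geq0$. For partitions $\sigma,\tau$ let $\langle\!\langle\kappa_a\mid\sigma,\tau\rangle\!\rangle$ be the partition with $2$-core $\kappa_a$ and $2$-quotient $(\sigma,\tau)$, where the $2$-quotient is read from a two-runner abacus display (runner $i$ carrying the positions congruent to $i$ modulo $2$, for $i\in\{0,1\}$) with the number of beads chosen so that runner $1$ has at least as many beads as runner $0$, the first component coming from runner $0$ and the second from runner $1$. Proposition. Let $s>r\geq0$ and $a\geq\frac12\bigl(r(r+1)+s(s+1)\bigr)-1$ be integers with $a\ge 0$, and let $\varepsilon\in\{0,1\}$ be the residue of $a+1$ modulo $2$. Then $$R_\varepsilon^{(-(s-r-1))}\,\chi^{\langle\!\langle\kappa_a\mid\kappa_r,\kappa_s\rangle\!\rangle}=\pm\,\chi^{\langle\!\langle\kappa_a\mid\kappa_{r+1},\kappa_{s-1}\rangle\!\rangle}.$$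 -/

import Mathlib

open scoped Nat DirectSum

noncomputable section

namespace SymChar

/-! ### Partitions, residues, contents -/

/-- The partitions of `n`, as Young diagrams with `n` nodes. -/
def Ptn (n : ℕ) : Type := {μ : YoungDiagram // μ.card = n}

theorem mem_lt_card (μ : YoungDiagram) {c : ℕ × ℕ} (hc : c ∈ μ.cells) :
    c.1 < μ.card ∧ c.2 < μ.card := by
  obtain ⟨i, j⟩ := c
  constructor
  · have h : (Finset.range (i + 1)).image (fun k => (k, j)) ⊆ μ.cells := by
      intro x hx
      obtain ⟨k, hk, rfl⟩ := Finset.mem_image.1 hx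
      exact μ.up_left_mem (Nat.lt_succ_iff.1 (Finset.mem_range.1 hk)) le_rfl hc
    have h2 := Finset.card_le_card h
    rw [Finset.card_image_of_injective _ (fun a b hab => (Prod.ext_iff.1 hab).1),
      Finset.card_range] at h2
    exact h2
  · have h : (Finset.range (j + 1)).image (fun k => (i, k)) ⊆ μ.cells := by
      intro x hx
      obtain ⟨k, hk, rfl⟩ := Finset.mem_image.1 hx
      exact μ.up_left_mem le_rfl (Nat.lt_succ_iff.1 (Finset.mem_range.1 hk)) hc
    have h2 := Finset.card_le_card h
    rw [Finset.card_image_of_injective _ (fun a b hab => (Prod.ext_iff.1 hab).2),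
      Finset.card_range] at h2
    exact h2

instance (n : ℕ) : Finite (Ptn n) := by
  refine Finite.of_injective
    (β := {s : Finset (ℕ × ℕ) // s ∈ (Finset.range n ×ˢ Finset.range n).powerset})
    (fun μ => ⟨μ.1.cells, ?_⟩) ?_
  · rw [Finset.mem_powerset]
    intro c hc
    obtain ⟨h1, h2⟩ := mem_lt_card μ.1 hc
    rw [μ.2] at h1 h2
    exact Finset.mem_product.2 ⟨Finset.mem_range.2 h1, Finset.mem_range.2 h2⟩
  · intro μ ν h
    exact Subtype.ext (YoungDiagram.ext (Subtype.ext_iff.1 h))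

instance (n : ℕ) : Fintype (Ptn n) := Fintype.ofFinite _

/-- The residue modulo `2` of a node: its column number minus its row number. -/
def residue (c : ℕ × ℕ) : ZMod 2 := (c.2 : ZMod 2) - (c.1 : ZMod 2)

/-- The content of a partition: the multiset of the residues of its nodes. -/
def content (μ : YoungDiagram) : Multiset (ZMod 2) := μ.cells.val.map residue

/-! ### Specht modules and their characters -/

/-- A tableau of shape `μ` with entries in `Fin n`; it sends an entry to the node containing it
(there is none unless `μ` is a partition of `n`). -/
abbrev Tableau (μ : YoungDiagram) (n : ℕ) : Type := Fin n ≃ μ.cells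

/-- The permutation module of `Perm (Fin n)` on functions `Fin n → ℕ`. The tabloid of a tableau is
encoded by the function sending each entry to its row. -/
def permRep (n : ℕ) : Representation ℚ (Equiv.Perm (Fin n)) ((Fin n → ℕ) →₀ ℚ) where
  toFun g := Finsupp.lmapDomain ℚ ℚ (fun f => f ∘ ⇑g⁻¹)
  map_one' := by
    ext f
    simp
  map_mul' g h := by
    ext f
    simp [Function.comp_def]

/-- The tableau `g t`, obtained from `t` by replacing each entry `i` with `g i`. -/
def Tableau.act {μ : YoungDiagram} {n : ℕ} (g : Equiv.Perm (Fin n)) (t : Tableau μ n) :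
    Tableau μ n := g⁻¹.trans t

/-- The tabloid `{t}`: it records the row in which each entry lies. -/
def tabloid {μ : YoungDiagram} {n : ℕ} (t : Tableau μ n) : Fin n → ℕ := fun i => (t i).1.1

/-- The column stabiliser of a tableau. -/
def colStab {μ : YoungDiagram} {n : ℕ} (t : Tableau μ n) : Finset (Equiv.Perm (Fin n)) :=
  Finset.univ.filter fun σ => ∀ i, (t (σ i)).1.2 = (t i).1.2

/-- The polytabloid `e_t`: the signed sum of `{σ t}` over the column stabiliser of `t`. -/
def polytabloid {μ : YoungDiagram} {n : ℕ} (t : Tableau μ n) : (Fin n → ℕ) →₀ ℚ :=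
  ∑ σ ∈ colStab t, Finsupp.single (tabloid (t.act σ)) ((Equiv.Perm.sign σ : ℤ) : ℚ)

theorem permRep_polytabloid {μ : YoungDiagram} {n : ℕ} (g : Equiv.Perm (Fin n))
    (t : Tableau μ n) : permRep n g (polytabloid t) = polytabloid (t.act g) := by
  unfold polytabloid
  rw [map_sum]
  refine Finset.sum_bij (fun σ _ => g * σ * g⁻¹) ?_ ?_ ?_ ?_
  · intro σ hσ
    simp only [colStab, Finset.mem_filter, Finset.mem_univ, true_and] at hσ ⊢
    intro i
    simpa [Tableau.act] using hσ (g⁻¹ i)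
  · intro σ _ τ _ h
    simpa using h
  · intro τ hτ
    refine ⟨g⁻¹ * τ * g, ?_, by group⟩
    simp only [colStab, Finset.mem_filter, Finset.mem_univ, true_and] at hτ ⊢
    intro i
    simpa [Tableau.act] using hτ (g i)
  · intro σ _
    have h : tabloid (t.act σ) ∘ ⇑g⁻¹ = tabloid ((t.act g).act (g * σ * g⁻¹)) := by
      funext i
      simp [tabloid, Tableau.act]
    have h2 : permRep n g (Finsupp.single (tabloid (t.act σ)) ((Equiv.Perm.sign σ : ℤ) : ℚ))
        = Finsupp.single (tabloid (t.act σ) ∘ ⇑g⁻¹) ((Equiv.Perm.sign σ : ℤ) : ℚ) :=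
      Finsupp.mapDomain_single
    have h3 : Equiv.Perm.sign (g * σ * g⁻¹) = Equiv.Perm.sign σ := by
      rw [map_mul, map_mul, map_inv, mul_comm, inv_mul_cancel_left]
    rw [h2, h, h3]

/-- The Specht module of `μ` over `ℚ`: the span of the polytabloids of shape `μ`, as a
subrepresentation of the permutation module. -/
def spechtModule (n : ℕ) (μ : YoungDiagram) : Subrepresentation (permRep n) where
  toSubmodule := Submodule.span ℚ (Set.range fun t : Tableau μ n => polytabloid t)
  apply_mem_toSubmodule g v hv := by
    induction hv using Submodule.span_induction with
    | mem x hx =>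
      obtain ⟨t, rfl⟩ := hx
      rw [permRep_polytabloid]
      exact Submodule.subset_span ⟨_, rfl⟩
    | zero => simp
    | add x y _ _ hx hy => rw [map_add]; exact add_mem hx hy
    | smul a x _ hx => rw [map_smul]; exact Submodule.smul_mem _ a hx

/-- The character of the Specht module of a partition `μ` of `n`. -/
def spechtChar (n : ℕ) (μ : YoungDiagram) : Equiv.Perm (Fin n) → ℚ :=
  (spechtModule n μ).toRepresentation.character

/-! ### Inner product, restriction, induction, blocks -/

/-- The inner product of rational-valued (generalised) characters. -/
def ip {n : ℕ} (χ ψ : Equiv.Perm (Fin n) → ℚ) : ℚ :=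
  (n ! : ℚ)⁻¹ * ∑ g, χ g * ψ g⁻¹

/-- The embedding of `𝔖_n` in `𝔖_{n+1}` as the stabiliser of the last point. -/
def incl (n : ℕ) : Equiv.Perm (Fin n) →* Equiv.Perm (Fin (n + 1)) :=
  Equiv.Perm.viaEmbeddingHom Fin.castSuccEmb

/-- Restriction of a generalised character from `𝔖_{n+1}` to `𝔖_n`. -/
def res {n : ℕ} (χ : Equiv.Perm (Fin (n + 1)) → ℚ) : Equiv.Perm (Fin n) → ℚ :=
  fun h => χ (incl n h)

/-- Induction of a generalised character from `𝔖_n` to `𝔖_{n+1}`: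
`(Ind χ)(g) = |𝔖_n|⁻¹ ∑_x χ°(x⁻¹ g x)`, where `χ°` is `χ` on `𝔖_n` and `0` outside. -/
def ind {n : ℕ} (χ : Equiv.Perm (Fin n) → ℚ) : Equiv.Perm (Fin (n + 1)) → ℚ :=
  fun g => (n ! : ℚ)⁻¹ *
    ∑ x : Equiv.Perm (Fin (n + 1)), ∑ h : Equiv.Perm (Fin n),
      if incl n h = x⁻¹ * g * x then χ h else 0

open Classical in
/-- The central character of an irreducible character `χ`, evaluated at the sum of the conjugacy
class of `g`. -/
def centralChar {n : ℕ} (χ : Equiv.Perm (Fin n) → ℚ) (g : Equiv.Perm (Fin n)) : ℚ :=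
  ((Finset.univ.filter fun h => IsConj g h).card : ℚ) * χ g / χ 1

/-- Two (rational-valued) irreducible characters lie in the same `2`-block: their central
characters, which take integer values on class sums, are congruent modulo `2`. -/
def SameBlock {n : ℕ} (χ ψ : Equiv.Perm (Fin n) → ℚ) : Prop :=
  ∀ g, ∃ k : ℤ, centralChar χ g - centralChar ψ g = 2 * k

/-- The irreducible character labelled by `μ` lies in the `2`-block with content `c`, that is, in
the block of some irreducible character labelled by a partition of content `c`. -/
def InBlock (n : ℕ) (c : Multiset (ZMod 2)) (μ : YoungDiagram) : Prop :=
  ∃ ν : Ptn n, content ν.1 = c ∧ SameBlock (spechtChar n μ) (spechtChar n ν.1)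

open Classical in
/-- The component of a generalised character in the `2`-block of `𝔖_n` with content `c`
(it is `0` if there is no such block). -/
def blockComponent {n : ℕ} (c : Multiset (ZMod 2)) (χ : Equiv.Perm (Fin n) → ℚ) :
    Equiv.Perm (Fin n) → ℚ :=
  ∑ μ : Ptn n, if InBlock n c μ.1 then ip χ (spechtChar n μ.1) • spechtChar n μ.1 else 0

/-! ### The functions `e_ε` and `f_ε` and the quotient-redistributing functions -/

/-- `ip · ψ` as a linear map. -/
def ipLin {n : ℕ} (ψ : Equiv.Perm (Fin n) → ℚ) : (Equiv.Perm (Fin n) → ℚ) →ₗ[ℚ] ℚ where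
  toFun χ := ip χ ψ
  map_add' χ χ' := by simp [ip, add_mul, Finset.sum_add_distrib, mul_add]
  map_smul' a χ := by
    simp only [ip, Pi.smul_apply, smul_eq_mul, mul_assoc, ← Finset.mul_sum, RingHom.id_apply]
    ring

/-- `e_ε χ` for `χ` the irreducible character of `𝔖_{n+1}` labelled by `μ`: the component of the
restriction in the block whose content is that of the block of `χ` with one `ε` removed. -/
def eIrr (ε : ZMod 2) {n : ℕ} (μ : Ptn (n + 1)) : Equiv.Perm (Fin n) → ℚ :=
  if ε ∈ content μ.1 then
    blockComponent ((content μ.1).erase ε) (res (spechtChar (n + 1) μ.1))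
  else 0

/-- `f_ε χ` for `χ` the irreducible character of `𝔖_n` labelled by `μ`: the component of the
induced character in the block whose content is that of the block of `χ` with one `ε` added. -/
def fIrr (ε : ZMod 2) {n : ℕ} (μ : Ptn n) : Equiv.Perm (Fin (n + 1)) → ℚ :=
  blockComponent (ε ::ₘ content μ.1) (ind (spechtChar n μ.1))

/-- The sum over all `n ≥ 0` of the spaces of rational-valued functions on `𝔖_n`; it contains all
generalised characters of all the symmetric groups. -/
abbrev Gr : Type := ⨁ n : ℕ, (Equiv.Perm (Fin n) → ℚ)

/-- `e_ε` in degree `n`, extended linearly from the irreducible characters. -/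
def eDeg (ε : ZMod 2) : (n : ℕ) → (Equiv.Perm (Fin n) → ℚ) →ₗ[ℚ] Gr
  | 0 => 0
  | n + 1 => DirectSum.lof ℚ ℕ (fun n => Equiv.Perm (Fin n) → ℚ) n ∘ₗ
      ∑ μ : Ptn (n + 1), (ipLin (spechtChar (n + 1) μ.1)).smulRight (eIrr ε μ)

/-- `f_ε` in degree `n`, extended linearly from the irreducible characters. -/
def fDeg (ε : ZMod 2) (n : ℕ) : (Equiv.Perm (Fin n) → ℚ) →ₗ[ℚ] Gr :=
  DirectSum.lof ℚ ℕ (fun n => Equiv.Perm (Fin n) → ℚ) (n + 1) ∘ₗ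
    ∑ μ : Ptn n, (ipLin (spechtChar n μ.1)).smulRight (fIrr ε μ)

/-- The function `e_ε`. -/
def e (ε : ZMod 2) : Module.End ℚ Gr := DirectSum.toModule ℚ ℕ Gr (eDeg ε)

/-- The function `f_ε`. -/
def f (ε : ZMod 2) : Module.End ℚ Gr := DirectSum.toModule ℚ ℕ Gr (fDeg ε)

/-- Divided powers `T^{(k)} = T^k / k!`. -/
def divPow (T : Module.End ℚ Gr) (k : ℕ) : Module.End ℚ Gr := (k ! : ℚ)⁻¹ • T ^ k

/-- The quotient-redistributing function
`R_ε^{(d)} = ∑_{a ≥ max(0,-d)} (-1)^{a+d} f_ε^{(a+d)} f_{1-ε}^{(a+d)} e_{1-ε}^{(a)} e_ε^{(a)}`.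
On each element only finitely many terms are non-zero. -/
def quotRed (ε : ZMod 2) (d : ℤ) (x : Gr) : Gr :=
  ∑ᶠ (a : ℕ) (_ : 0 ≤ (a : ℤ) + d),
    (-1 : ℚ) ^ ((a : ℤ) + d).toNat •
      divPow (f ε) ((a : ℤ) + d).toNat
        (divPow (f (1 - ε)) ((a : ℤ) + d).toNat
          (divPow (e (1 - ε)) a (divPow (e ε) a x)))

/-- The Specht character of a partition, as an element of `Gr`. -/
def specht (μ : YoungDiagram) : Gr :=
  DirectSum.lof ℚ ℕ (fun n => Equiv.Perm (Fin n) → ℚ) μ.card (spechtChar μ.card μ)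

/-! ### Cores and quotients -/

/-- The partition `(r, r-1, …, 1)`. -/
def staircase (r : ℕ) : YoungDiagram where
  cells := (Finset.range r ×ˢ Finset.range r).filter fun c => c.1 + c.2 < r
  isLowerSet := by
    rintro ⟨i, j⟩ ⟨k, l⟩ ⟨h1, h2⟩ h
    simp only [Finset.coe_filter, Finset.mem_product, Finset.mem_range, Set.mem_ofPred_eq] at h ⊢
    simp only at h1 h2
    omega

/-- `μ` is obtained from `ν` by removing a rim-hook of length `2`, that is, two nodes adjacent in
a row or in a column. -/
def RemovesDomino (ν μ : YoungDiagram) : Prop :=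
  ∃ i j : ℕ, ∃ c : ℕ × ℕ, (c = (i, j + 1) ∨ c = (i + 1, j)) ∧
    (i, j) ∉ μ.cells ∧ c ∉ μ.cells ∧ ν.cells = insert (i, j) (insert c μ.cells)

/-- `κ` is the `2`-core of `ν`. -/
def IsTwoCore (ν κ : YoungDiagram) : Prop :=
  Relation.ReflTransGen RemovesDomino ν κ ∧ ∀ κ', ¬ RemovesDomino κ κ'

/-- The positions of the beads in the `N`-bead abacus display of `ν` (for `N ≥ ℓ(ν)`). -/
def beads (ν : YoungDiagram) (N : ℕ) : Finset ℕ :=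
  (Finset.range N).image fun i => ν.rowLen i + (N - 1 - i)

/-- The occupied rows of runner `ε` (positions `ε, ε + 2, ε + 4, …`) in an abacus display. -/
def runner (B : Finset ℕ) (ε : ℕ) : Finset ℕ :=
  (B.filter fun b => b % 2 = ε).image fun b => b / 2

/-- The one-runner abacus with bead set `X` displays the partition `q`: for each bead, say with
`i` beads below it, the (0-indexed) `i`-th part of `q` is the number of empty spaces above that
bead, and `q` has no further non-zero parts. -/
def Displays (X : Finset ℕ) (q : YoungDiagram) : Prop :=
  (∀ b ∈ X, q.rowLen (X.filter fun b' => b < b').card =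
    ((Finset.range b).filter fun k => k ∉ X).card) ∧ q.rowLen X.card = 0

/-- `(q₀, q₁)` is the `2`-quotient of `ν`: it is read off the runners of an abacus display in
which runner `1` has at least as many beads as runner `0`. -/
def IsTwoQuotient (ν q₀ q₁ : YoungDiagram) : Prop :=
  ∃ N : ℕ, ν.colLen 0 ≤ N ∧ (runner (beads ν N) 0).card ≤ (runner (beads ν N) 1).card ∧
    Displays (runner (beads ν N) 0) q₀ ∧ Displays (runner (beads ν N) 1) q₁

/-- `ν` is the partition with `2`-core `κ` and `2`-quotient `(q₀, q₁)`. -/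
def HasCoreQuotient (ν κ q₀ q₁ : YoungDiagram) : Prop :=
  IsTwoCore ν κ ∧ IsTwoQuotient ν q₀ q₁

end SymChar

end

noncomputable section

namespace SymChar

/-! ### Adding and removing nodes -/

/-! On Specht characters `e` and `f` remove and add single nodes of the given residue (`e_specht`,
`f_specht`). The computation therefore takes place on formal sums of partitions, where the two kinds
of operators are adjoint for the form with the partitions as orthonormal basis (`dot_fF`). So the
coefficient of a partition `y` in the image of `lam` is an alternating sum over `n` of products of
coefficients at a common diagram `x`, reached from `lam` by `doubleE a n` and from `y` by `doubleE a
(n + d)` (`redist_apply`).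

The lower bound on `a` makes every partition involved a RoCK partition (`exists_rockAt`): in the
Maya diagram, every bead of the parity of `a` lies below every gap of the parity of `a + 1`. For
such a partition `doubleE a n` acts on the two runners independently. On `runnerP` some beads drop
by one place, on `runnerQ`, which records gaps, some gaps rise by one place, and `n` moves are made
in all (`doubleE_apply`). In the language of quotients a vertical strip is removed from one
component and from the conjugate of the other; the conjugation is harmless because staircases are
self-conjugate. Hence the coefficient of `y` is a sign times a product of two sums, one for each
runner (`redist_apply_eq_mul`).

The sum `runnerSum s Y` runs over the sets `C` of removable nodes of the staircase of size `s`, with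
sign `(-1) ^ C.card`, such that adding a vertical strip after removing `C` can give `Y`. If some row
`i < s` of `Y` has its original length, toggling `i` in `C` cancels everything
(`runnerSum_eq_zero`). Otherwise each of the first `s` rows has become longer or shorter by one, and
lower rows can be added only if none became shorter (`exists_of_runnerSum_ne_zero`). Comparing sizes
then leaves one possibility: the staircase `s` loses all its removable nodes and the staircase `r`
gains all its addable ones (`runners_eq_of_ne_zero`), with coefficient a sign.

On the side of representations, the branching rule `ip_res_specht` comes from explicit nonzero
homomorphisms, which bound multiplicities below, and from a count of degrees based on the relation
`DU - UD = 1` in the Young lattice, which leaves no room for more. Of the description of 2-blocks by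
contents only a weak part is needed: the central character at a transposition is the sum of the
contents, so a block determines this sum modulo 2 (`SameBlock.sum_content_eq`). The partitions
compared differ by one node, and the sum detects its residue. -/

theorem ext_rowLen {μ ν : YoungDiagram} (h : ∀ i, μ.rowLen i = ν.rowLen i) : μ = ν := by
  apply YoungDiagram.ext
  ext ⟨i, j⟩
  rw [YoungDiagram.mem_cells, YoungDiagram.mem_cells, YoungDiagram.mem_iff_lt_rowLen,
    YoungDiagram.mem_iff_lt_rowLen, h]

/-- The diagram with given weakly decreasing row lengths, at most `l` of them non-zero. -/
def ofRows (w : ℕ → ℕ) (hw : ∀ i, w (i + 1) ≤ w i) (l : ℕ) (_ : w l = 0) : YoungDiagram where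
  cells := (Finset.range l ×ˢ Finset.range (w 0)).filter fun c => c.2 < w c.1
  isLowerSet := by
    have ha : Antitone w := antitone_nat_of_succ_le hw
    rintro ⟨i, j⟩ ⟨k, m⟩ ⟨h1, h2⟩ h
    simp only [Finset.coe_filter, Finset.mem_product, Finset.mem_range, Set.mem_ofPred_eq] at h ⊢
    simp only at h1 h2
    have := ha h1
    omega

theorem rowLen_ofRows (w : ℕ → ℕ) (hw : ∀ i, w (i + 1) ≤ w i) (l : ℕ) (hl : w l = 0) (i : ℕ) :
    (ofRows w hw l hl).rowLen i = w i := by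
  have ha : Antitone w := antitone_nat_of_succ_le hw
  have key : ∀ j, (i, j) ∈ ofRows w hw l hl ↔ j < w i := by
    intro j
    change (i, j) ∈ (ofRows w hw l hl).cells ↔ _
    simp only [ofRows, Finset.mem_filter, Finset.mem_product, Finset.mem_range]
    constructor
    · exact fun h => h.2
    · intro h
      refine ⟨⟨?_, h.trans_le (ha (Nat.zero_le i))⟩, h⟩
      by_contra! hli
      have := ha hli
      omega
  apply le_antisymm
  · by_contra! h
    exact lt_irrefl _ ((key _).1 (YoungDiagram.mem_iff_lt_rowLen.2 h))
  · by_contra! h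
    exact lt_irrefl _ (YoungDiagram.mem_iff_lt_rowLen.1 ((key _).2 h))

theorem rowLen_card_eq_zero (μ : YoungDiagram) {i : ℕ} (hi : μ.card ≤ i) : μ.rowLen i = 0 := by
  by_contra h
  have h1 : (i, 0) ∈ μ.cells := YoungDiagram.mem_iff_lt_rowLen.2 (Nat.pos_of_ne_zero h)
  have := (mem_lt_card μ h1).1
  simp only at this
  omega

theorem card_eq_sum_rowLen (μ : YoungDiagram) {N : ℕ} (hN : μ.rowLen N = 0) :
    μ.card = ∑ i ∈ Finset.range N, μ.rowLen i := by
  have h : μ.cells = ((Finset.range N).sigma (fun i => Finset.range (μ.rowLen i))).map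
      (Equiv.sigmaEquivProd ℕ ℕ).toEmbedding := by
    ext ⟨i, j⟩
    simp only [Finset.mem_map_equiv, Finset.mem_sigma, Finset.mem_range,
      Equiv.sigmaEquivProd_symm_apply, YoungDiagram.mem_cells, YoungDiagram.mem_iff_lt_rowLen]
    constructor
    · intro hj
      refine ⟨?_, hj⟩
      by_contra! h
      have := μ.rowLen_anti _ _ h
      omega
    · exact fun h => h.2
  rw [YoungDiagram.card, h, Finset.card_map, Finset.card_sigma]
  simp

/-- `y` is obtained from `x` by adding the node `(i, j)`. -/
def AddsNode (x y : YoungDiagram) (c : ℕ × ℕ) : Prop :=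
  c ∉ x.cells ∧ y.cells = insert c x.cells

theorem AddsNode.le {x y : YoungDiagram} {c : ℕ × ℕ} (h : AddsNode x y c) : x ≤ y := by
  rw [← YoungDiagram.cells_subset_iff, h.2]
  exact Finset.subset_insert _ _

theorem AddsNode.card {x y : YoungDiagram} {c : ℕ × ℕ} (h : AddsNode x y c) :
    y.card = x.card + 1 := by
  rw [YoungDiagram.card, h.2, Finset.card_insert_of_notMem h.1]

theorem exists_addsNode {x y : YoungDiagram} (h : x ≤ y) (hc : y.card = x.card + 1) :
    ∃ c, AddsNode x y c := by
  have h1 : x.cells ⊆ y.cells := YoungDiagram.cells_subset_iff.2 h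
  have h2 : (y.cells \ x.cells).card = 1 := by
    rw [Finset.card_sdiff_of_subset h1]
    change y.card - x.card = 1
    omega
  obtain ⟨c, hc⟩ := Finset.card_eq_one.1 h2
  have hc' : c ∈ y.cells \ x.cells := by rw [hc]; exact Finset.mem_singleton_self c
  refine ⟨c, (Finset.mem_sdiff.1 hc').2, ?_⟩
  rw [Finset.insert_eq, ← hc, Finset.sdiff_union_of_subset h1]

theorem AddsNode.rowLen {x y : YoungDiagram} {i j : ℕ} (h : AddsNode x y (i, j)) :
    x.rowLen i = j ∧ y.rowLen i = j + 1 ∧ ∀ k, k ≠ i → y.rowLen k = x.rowLen k := by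
  have hm : ∀ k l, l < y.rowLen k ↔ (k = i ∧ l = j) ∨ l < x.rowLen k := by
    intro k l
    rw [← YoungDiagram.mem_iff_lt_rowLen, ← YoungDiagram.mem_iff_lt_rowLen,
      ← YoungDiagram.mem_cells, h.2, Finset.mem_insert, Prod.mk.injEq, YoungDiagram.mem_cells]
  have hn : ¬ j < x.rowLen i := by
    rw [← YoungDiagram.mem_iff_lt_rowLen]; exact h.1
  have h1 := (hm i j).2 (Or.inl ⟨rfl, rfl⟩)
  have h2 : y.rowLen i ≤ j + 1 := by
    by_contra! hlt
    have := (hm i (j + 1)).1 hlt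
    omega
  have h3 : j ≤ x.rowLen i := by
    rcases Nat.eq_zero_or_pos j with h0 | h0
    · omega
    · have := (hm i (j - 1)).1 (by omega)
      omega
  refine ⟨by omega, by omega, ?_⟩
  intro k hk
  apply le_antisymm
  · by_contra! hlt
    have := (hm k _).1 hlt
    omega
  · by_contra! hlt
    have := (hm k _).2 (Or.inr hlt)
    omega

theorem addsNode_iff {x y : YoungDiagram} {i : ℕ} :
    AddsNode x y (i, x.rowLen i) ↔
      y.rowLen i = x.rowLen i + 1 ∧ ∀ k, k ≠ i → y.rowLen k = x.rowLen k := by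
  constructor
  · exact fun h => h.rowLen.2
  · rintro ⟨h1, h2⟩
    constructor
    · rw [YoungDiagram.mem_cells, YoungDiagram.mem_iff_lt_rowLen]; exact lt_irrefl _
    · ext ⟨k, l⟩
      rw [Finset.mem_insert, YoungDiagram.mem_cells, YoungDiagram.mem_cells,
        YoungDiagram.mem_iff_lt_rowLen, YoungDiagram.mem_iff_lt_rowLen, Prod.mk.injEq]
      by_cases hk : k = i
      · subst hk; rw [h1]; omega
      · rw [h2 k hk]; omega

theorem exists_add_row (x : YoungDiagram) (i : ℕ) (h : i = 0 ∨ x.rowLen i < x.rowLen (i - 1)) :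
    ∃ y, AddsNode x y (i, x.rowLen i) := by
  have hx := fun k => x.rowLen_anti k (k + 1) (by omega)
  refine ⟨ofRows (Function.update x.rowLen i (x.rowLen i + 1)) ?_ (x.card + i + 1) ?_, ?_⟩
  · intro k
    have := hx k
    simp only [Function.update_apply]
    split_ifs with h1 h2 h2
    · omega
    · subst h1; simp at h; omega
    · subst h2; omega
    · omega
  · rw [Function.update_of_ne (by omega)]
    exact rowLen_card_eq_zero x (by omega)
  · rw [addsNode_iff]
    simp only [rowLen_ofRows, Function.update_self, true_and]
    intro k hk
    exact Function.update_of_ne hk _ _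

theorem exists_remove_row (y : YoungDiagram) (i : ℕ) (h : y.rowLen (i + 1) < y.rowLen i) :
    ∃ x, AddsNode x y (i, y.rowLen i - 1) := by
  have hy := fun k => y.rowLen_anti k (k + 1) (by omega)
  have h1 : ∀ k, Function.update y.rowLen i (y.rowLen i - 1) (k + 1) ≤
      Function.update y.rowLen i (y.rowLen i - 1) k := by
    intro k
    have := hy k
    simp only [Function.update_apply]
    split_ifs with h1 h2 h2
    · omega
    · subst h1; omega
    · subst h2; omega
    · omega
  have h2 : Function.update y.rowLen i (y.rowLen i - 1) (y.card + i + 1) = 0 := by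
    rw [Function.update_of_ne (by omega)]
    exact rowLen_card_eq_zero y (by omega)
  have h3 : (ofRows _ h1 _ h2).rowLen i = y.rowLen i - 1 := by
    rw [rowLen_ofRows, Function.update_self]
  refine ⟨ofRows _ h1 _ h2, ?_⟩
  have h4 := addsNode_iff (x := ofRows _ h1 _ h2) (y := y) (i := i)
  rw [h3] at h4
  rw [h4]
  simp only [rowLen_ofRows]
  exact ⟨by omega, fun k hk => (Function.update_of_ne hk _ _).symm⟩

theorem AddsNode.lt_card {x y : YoungDiagram} {i j : ℕ} (h : AddsNode x y (i, j)) :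
    i < y.card :=
  (mem_lt_card y (c := (i, j)) (by rw [h.2]; exact Finset.mem_insert_self _ _)).1

theorem AddsNode.addable {x y : YoungDiagram} {i j : ℕ} (h : AddsNode x y (i, j)) :
    i = 0 ∨ x.rowLen i < x.rowLen (i - 1) := by
  obtain ⟨h1, h2, h3⟩ := h.rowLen
  rcases Nat.eq_zero_or_pos i with h0 | h0
  · exact Or.inl h0
  · right
    have := y.rowLen_anti (i - 1) i (by omega)
    have := h3 (i - 1) (by omega)
    omega

theorem AddsNode.removable {x y : YoungDiagram} {i j : ℕ} (h : AddsNode x y (i, j)) :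
    y.rowLen (i + 1) < y.rowLen i := by
  obtain ⟨h1, h2, h3⟩ := h.rowLen
  have := x.rowLen_anti i (i + 1) (by omega)
  have := h3 (i + 1) (by omega)
  omega

theorem AddsNode.unique_top {x y z : YoungDiagram} {c : ℕ × ℕ} (h : AddsNode x y c)
    (h' : AddsNode x z c) : y = z := YoungDiagram.ext (by rw [h.2, h'.2])

theorem AddsNode.unique_bot {x y z : YoungDiagram} {c : ℕ × ℕ} (h : AddsNode x y c)
    (h' : AddsNode z y c) : x = z := by
  apply YoungDiagram.ext
  rw [← Finset.erase_insert h.1, ← Finset.erase_insert h'.1, ← h.2, ← h'.2]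

theorem Ptn.ext {n : ℕ} {μ ν : Ptn n} (h : μ.1 = ν.1) : μ = ν := Subtype.ext h

/-! ### The Young lattice is a differential poset -/

/-- The partitions of `n + 1` containing a given one of `n`. -/
def ups {n : ℕ} (ρ : Ptn n) : Finset (Ptn (n + 1)) := by
  classical exact Finset.univ.filter fun μ => ρ.1 ≤ μ.1

/-- The partitions of `n` contained in a given one of `n + 1`. -/
def downs {n : ℕ} (μ : Ptn (n + 1)) : Finset (Ptn n) := by
  classical exact Finset.univ.filter fun ρ => ρ.1 ≤ μ.1

@[simp] theorem mem_ups {n : ℕ} {ρ : Ptn n} {μ : Ptn (n + 1)} : μ ∈ ups ρ ↔ ρ.1 ≤ μ.1 := by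
  simp [ups]

@[simp] theorem mem_downs {n : ℕ} {ρ : Ptn n} {μ : Ptn (n + 1)} : ρ ∈ downs μ ↔ ρ.1 ≤ μ.1 := by
  simp [downs]

theorem exists_addsNode_ptn {n : ℕ} {ρ : Ptn n} {μ : Ptn (n + 1)} (h : ρ.1 ≤ μ.1) :
    ∃ i j, AddsNode ρ.1 μ.1 (i, j) := by
  obtain ⟨⟨i, j⟩, hc⟩ := exists_addsNode h (by rw [μ.2, ρ.2])
  exact ⟨i, j, hc⟩

theorem card_ups {n : ℕ} (ρ : Ptn n) :
    (ups ρ).card = ((Finset.range (n + 1)).filter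
      fun i => i = 0 ∨ ρ.1.rowLen i < ρ.1.rowLen (i - 1)).card := by
  symm
  refine Finset.card_bij'
    (fun i hi => ⟨(exists_add_row ρ.1 i (Finset.mem_filter.1 hi).2).choose, ?_⟩)
    (fun μ hμ => (exists_addsNode_ptn (mem_ups.1 hμ)).choose) ?_ ?_ ?_ ?_
  · rw [(exists_add_row ρ.1 i (Finset.mem_filter.1 hi).2).choose_spec.card, ρ.2]
  · intro i hi
    exact mem_ups.2 (exists_add_row ρ.1 i (Finset.mem_filter.1 hi).2).choose_spec.le
  · intro μ hμ
    obtain ⟨j, hj⟩ := (exists_addsNode_ptn (mem_ups.1 hμ)).choose_spec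
    refine Finset.mem_filter.2 ⟨?_, hj.addable⟩
    have := hj.lt_card
    rw [μ.2] at this
    exact Finset.mem_range.2 this
  · intro i hi
    generalize_proofs h1 h2 h3
    obtain ⟨j, hj⟩ := h3.choose_spec
    have h4 := h1.choose_spec.rowLen
    have h5 := hj.rowLen
    by_contra hne
    have := h5.2.2 i (fun h => hne h.symm)
    simp only at this h4
    omega
  · intro μ hμ
    generalize_proofs h1 h2 h3
    obtain ⟨j, hj⟩ := h1.choose_spec
    apply Subtype.ext
    refine h2.choose_spec.unique_top ?_
    have := hj.rowLen.1
    rw [this]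
    exact hj

theorem card_downs {n : ℕ} (μ : Ptn (n + 1)) :
    (downs μ).card = ((Finset.range (n + 1)).filter
      fun i => μ.1.rowLen (i + 1) < μ.1.rowLen i).card := by
  symm
  refine Finset.card_bij'
    (fun i hi => ⟨(exists_remove_row μ.1 i (Finset.mem_filter.1 hi).2).choose, ?_⟩)
    (fun ρ hρ => (exists_addsNode_ptn (mem_downs.1 hρ)).choose) ?_ ?_ ?_ ?_
  · have := (exists_remove_row μ.1 i (Finset.mem_filter.1 hi).2).choose_spec.card
    rw [μ.2] at this
    omega
  · intro i hi
    exact mem_downs.2 (exists_remove_row μ.1 i (Finset.mem_filter.1 hi).2).choose_spec.le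
  · intro ρ hρ
    obtain ⟨j, hj⟩ := (exists_addsNode_ptn (mem_downs.1 hρ)).choose_spec
    refine Finset.mem_filter.2 ⟨?_, hj.removable⟩
    have := hj.lt_card
    rw [μ.2] at this
    exact Finset.mem_range.2 this
  · intro i hi
    generalize_proofs h1 h2 h3
    obtain ⟨j, hj⟩ := h3.choose_spec
    have h4 := h1.choose_spec.rowLen
    have h5 := hj.rowLen
    by_contra hne
    have := h5.2.2 i (fun h => hne h.symm)
    simp only at this h4
    omega
  · intro ρ hρ
    generalize_proofs h1 h2 h3
    obtain ⟨j, hj⟩ := h1.choose_spec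
    apply Subtype.ext
    refine h2.choose_spec.unique_bot ?_
    have : μ.1.rowLen h1.choose - 1 = j := by rw [hj.rowLen.2.1]; rfl
    rw [this]
    exact hj

/-- Row `0` is always addable, and row `i + 1` is addable exactly when row `i` is strictly longer
than it, that is, when row `i` is removable. -/
theorem card_ups_eq {n : ℕ} (ρ : Ptn (n + 1)) : (ups ρ).card = (downs ρ).card + 1 := by
  rw [card_ups, card_downs]
  have h : (Finset.range (n + 1 + 1)).filter
      (fun i => i = 0 ∨ ρ.1.rowLen i < ρ.1.rowLen (i - 1)) =
      insert 0 (((Finset.range (n + 1)).filter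
        fun i => ρ.1.rowLen (i + 1) < ρ.1.rowLen i).map ⟨Nat.succ, Nat.succ_injective⟩) := by
    ext i
    cases i <;> simp
  rw [h, Finset.card_insert_of_notMem (by simp), Finset.card_map]

theorem card_sup_add_card_inf (x y : YoungDiagram) :
    (x ⊔ y).card + (x ⊓ y).card = x.card + y.card := by
  simp only [YoungDiagram.card, YoungDiagram.cells_sup, YoungDiagram.cells_inf]
  exact Finset.card_union_add_card_inter _ _

theorem eq_of_le_of_card_le {x y : YoungDiagram} (h : x ≤ y) (hc : y.card ≤ x.card) : x = y :=
  YoungDiagram.ext (Finset.eq_of_subset_of_card_le (YoungDiagram.cells_subset_iff.2 h) hc)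

theorem card_mono {x y : YoungDiagram} (h : x ≤ y) : x.card ≤ y.card :=
  Finset.card_le_card (YoungDiagram.cells_subset_iff.2 h)

open Classical in
-- For distinct partitions of equal size the only candidate for a common upper cover is the join,
-- and for a common lower cover the meet. The sizes of join and meet add up to `2 * (n + 1)`, so
-- either both have the right size or neither has.
theorem card_common_ups {n : ℕ} (ρ ρ' : Ptn (n + 1)) :
    (ups ρ ∩ ups ρ').card = (downs ρ ∩ downs ρ').card + if ρ = ρ' then 1 else 0 := by
  by_cases h : ρ = ρ'
  · subst h
    simpa using card_ups_eq ρ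
  rw [if_neg h, add_zero]
  have hc := card_sup_add_card_inf ρ.1 ρ'.1
  rw [ρ.2, ρ'.2] at hc
  have hlt : n + 1 < (ρ.1 ⊔ ρ'.1).card := by
    by_contra! hle
    apply h
    apply Subtype.ext
    rw [eq_of_le_of_card_le (le_sup_left : ρ.1 ≤ ρ.1 ⊔ ρ'.1) (by rw [ρ.2]; exact hle)]
    exact (eq_of_le_of_card_le (le_sup_right : ρ'.1 ≤ ρ.1 ⊔ ρ'.1)
      (by rw [ρ'.2]; exact hle)).symm
  by_cases h2 : (ρ.1 ⊔ ρ'.1).card = n + 2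
  · obtain ⟨τ, hτ⟩ : ∃ τ : Ptn (n + 1 + 1), τ.1 = ρ.1 ⊔ ρ'.1 := ⟨⟨_, h2⟩, rfl⟩
    obtain ⟨σ, hσ⟩ : ∃ σ : Ptn n, σ.1 = ρ.1 ⊓ ρ'.1 := ⟨⟨_, by omega⟩, rfl⟩
    have e1 : ups ρ ∩ ups ρ' = {τ} := by
      ext μ
      rw [Finset.mem_inter, mem_ups, mem_ups, Finset.mem_singleton, ← sup_le_iff, ← hτ]
      constructor
      · intro hle
        exact (Ptn.ext (eq_of_le_of_card_le hle (by rw [τ.2, μ.2]))).symm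
      · intro he; rw [he]
    have e2 : downs ρ ∩ downs ρ' = {σ} := by
      ext μ
      rw [Finset.mem_inter, mem_downs, mem_downs, Finset.mem_singleton, ← le_inf_iff, ← hσ]
      constructor
      · intro hle
        exact Ptn.ext (eq_of_le_of_card_le hle (by rw [σ.2, μ.2]))
      · intro he; rw [he]
    rw [e1, e2, Finset.card_singleton, Finset.card_singleton]
  · have e1 : ups ρ ∩ ups ρ' = ∅ := by
      ext μ
      simp only [Finset.mem_inter, mem_ups, Finset.notMem_empty, iff_false, ← sup_le_iff]
      intro hle
      have := card_mono hle
      rw [μ.2] at this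
      omega
    have e2 : downs ρ ∩ downs ρ' = ∅ := by
      ext μ
      simp only [Finset.mem_inter, mem_downs, Finset.notMem_empty, iff_false, ← le_inf_iff]
      intro hle
      have := card_mono hle
      rw [μ.2] at this
      omega
    rw [e1, e2, Finset.card_empty, Finset.card_empty]

open Classical in
/-- The relation `DU - UD = 1` in the Young lattice. -/
theorem sum_ups_downs {n : ℕ} (g : Ptn (n + 1) → ℚ) (ρ : Ptn (n + 1)) :
    ∑ μ ∈ ups ρ, ∑ ρ' ∈ downs μ, g ρ' = g ρ + ∑ σ ∈ downs ρ, ∑ ρ' ∈ ups σ, g ρ' := by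
  -- Each double sum weights `g ρ'` by the number of common covers of `ρ` and `ρ'`, which reduces
  -- the relation to `card_common_ups`.
  have h1 : ∑ μ ∈ ups ρ, ∑ ρ' ∈ downs μ, g ρ' =
      ∑ ρ' : Ptn (n + 1), ((ups ρ ∩ ups ρ').card : ℚ) * g ρ' := by
    have : ∀ μ, ∑ ρ' ∈ downs μ, g ρ' = ∑ ρ' : Ptn (n + 1), if μ ∈ ups ρ' then g ρ' else 0 := by
      intro μ
      rw [← Finset.sum_filter]
      exact Finset.sum_congr (by ext; simp) (fun _ _ => rfl)
    simp_rw [this]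
    rw [Finset.sum_comm]
    refine Finset.sum_congr rfl fun ρ' _ => ?_
    rw [← Finset.sum_filter, Finset.filter_mem_eq_inter, Finset.sum_const, nsmul_eq_mul]
  have h2 : ∑ σ ∈ downs ρ, ∑ ρ' ∈ ups σ, g ρ' =
      ∑ ρ' : Ptn (n + 1), ((downs ρ ∩ downs ρ').card : ℚ) * g ρ' := by
    have : ∀ σ, ∑ ρ' ∈ ups σ, g ρ' = ∑ ρ' : Ptn (n + 1), if σ ∈ downs ρ' then g ρ' else 0 := by
      intro μ
      rw [← Finset.sum_filter]
      exact Finset.sum_congr (by ext; simp) (fun _ _ => rfl)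
    simp_rw [this]
    rw [Finset.sum_comm]
    refine Finset.sum_congr rfl fun ρ' _ => ?_
    rw [← Finset.sum_filter, Finset.filter_mem_eq_inter, Finset.sum_const, nsmul_eq_mul]
  rw [h1, h2]
  simp_rw [card_common_ups]
  push_cast
  simp_rw [add_mul, Finset.sum_add_distrib]
  rw [add_comm]
  congr 1
  simp

/-! ### Column antisymmetrisers -/

theorem permRep_single {n : ℕ} (g : Equiv.Perm (Fin n)) (F : Fin n → ℕ) (a : ℚ) :
    permRep n g (Finsupp.single F a) = Finsupp.single (F ∘ ⇑g⁻¹) a :=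
  Finsupp.mapDomain_single

theorem mem_colStab {μ : YoungDiagram} {n : ℕ} {t : Tableau μ n} {σ : Equiv.Perm (Fin n)} :
    σ ∈ colStab t ↔ ∀ i, (t (σ i)).1.2 = (t i).1.2 := by
  simp [colStab]

theorem mul_mem_colStab {μ : YoungDiagram} {n : ℕ} {t : Tableau μ n} {σ τ : Equiv.Perm (Fin n)}
    (hσ : σ ∈ colStab t) (hτ : τ ∈ colStab t) : σ * τ ∈ colStab t := by
  rw [mem_colStab] at *
  intro i
  rw [Equiv.Perm.mul_apply, hσ, hτ]

theorem inv_mem_colStab {μ : YoungDiagram} {n : ℕ} {t : Tableau μ n} {σ : Equiv.Perm (Fin n)}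
    (hσ : σ ∈ colStab t) : σ⁻¹ ∈ colStab t := by
  rw [mem_colStab] at *
  intro i
  have := hσ (σ⁻¹ i)
  simpa using this.symm

theorem swap_mem_colStab {μ : YoungDiagram} {n : ℕ} {t : Tableau μ n} {i j : Fin n}
    (h : (t i).1.2 = (t j).1.2) : Equiv.swap i j ∈ colStab t := by
  rw [mem_colStab]
  intro k
  by_cases h1 : k = i
  · subst h1; rw [Equiv.swap_apply_left, h]
  · by_cases h2 : k = j
    · subst h2; rw [Equiv.swap_apply_right, h]
    · rw [Equiv.swap_apply_of_ne_of_ne h1 h2]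

/-- The signed sum of the column stabiliser of a tableau, as an operator. -/
def antisymm {μ : YoungDiagram} {n : ℕ} (t : Tableau μ n) :
    ((Fin n → ℕ) →₀ ℚ) →ₗ[ℚ] ((Fin n → ℕ) →₀ ℚ) :=
  ∑ σ ∈ colStab t, ((Equiv.Perm.sign σ : ℤ) : ℚ) • permRep n σ

theorem antisymm_apply {μ : YoungDiagram} {n : ℕ} (t : Tableau μ n) (x : (Fin n → ℕ) →₀ ℚ) :
    antisymm t x = ∑ σ ∈ colStab t, ((Equiv.Perm.sign σ : ℤ) : ℚ) • permRep n σ x := by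
  simp [antisymm, LinearMap.sum_apply]

theorem antisymm_tabloid {μ : YoungDiagram} {n : ℕ} (t : Tableau μ n) :
    antisymm t (Finsupp.single (tabloid t) 1) = polytabloid t := by
  rw [antisymm_apply, polytabloid]
  refine Finset.sum_congr rfl fun σ _ => ?_
  rw [permRep_single, Finsupp.smul_single, smul_eq_mul, mul_one]
  rfl

theorem sign_mul_self {n : ℕ} (σ : Equiv.Perm (Fin n)) :
    ((Equiv.Perm.sign σ : ℤ) : ℚ) * ((Equiv.Perm.sign σ : ℤ) : ℚ) = 1 := by
  rcases Int.units_eq_one_or (Equiv.Perm.sign σ) with h | h <;> simp [h]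

theorem antisymm_permRep {μ : YoungDiagram} {n : ℕ} (t : Tableau μ n) {τ : Equiv.Perm (Fin n)}
    (hτ : τ ∈ colStab t) (x : (Fin n → ℕ) →₀ ℚ) :
    antisymm t (permRep n τ x) = ((Equiv.Perm.sign τ : ℤ) : ℚ) • antisymm t x := by
  rw [antisymm_apply, antisymm_apply, Finset.smul_sum]
  refine Finset.sum_bij' (fun σ _ => σ * τ) (fun σ _ => σ * τ⁻¹)
    (fun σ hσ => mul_mem_colStab hσ hτ) (fun σ hσ => mul_mem_colStab hσ (inv_mem_colStab hτ))
    (fun σ _ => by simp) (fun σ _ => by simp) ?_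
  intro σ _
  rw [map_mul (permRep n), Module.End.mul_apply, smul_smul, map_mul]
  congr 1
  push_cast
  rw [mul_comm, mul_assoc, sign_mul_self, mul_one]

theorem permRep_antisymm {μ : YoungDiagram} {n : ℕ} (t : Tableau μ n) {τ : Equiv.Perm (Fin n)}
    (hτ : τ ∈ colStab t) (x : (Fin n → ℕ) →₀ ℚ) :
    permRep n τ (antisymm t x) = ((Equiv.Perm.sign τ : ℤ) : ℚ) • antisymm t x := by
  rw [antisymm_apply, Finset.smul_sum, map_sum]
  refine Finset.sum_bij' (fun σ _ => τ * σ) (fun σ _ => τ⁻¹ * σ)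
    (fun σ hσ => mul_mem_colStab hτ hσ) (fun σ hσ => mul_mem_colStab (inv_mem_colStab hτ) hσ)
    (fun σ _ => by simp) (fun σ _ => by simp) ?_
  intro σ _
  rw [map_mul (permRep n), Module.End.mul_apply, smul_smul, map_mul, map_smul]
  congr 1
  push_cast
  rw [← mul_assoc, sign_mul_self, one_mul]

theorem antisymm_polytabloid {μ : YoungDiagram} {n : ℕ} (t : Tableau μ n) :
    antisymm t (polytabloid t) = ((colStab t).card : ℚ) • polytabloid t := by
  rw [antisymm_apply, ← antisymm_tabloid]
  have : ∀ σ ∈ colStab t, ((Equiv.Perm.sign σ : ℤ) : ℚ) •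
      permRep n σ (antisymm t (Finsupp.single (tabloid t) 1)) =
      antisymm t (Finsupp.single (tabloid t) 1) := by
    intro σ hσ
    rw [permRep_antisymm t hσ, smul_smul, sign_mul_self, one_smul]
  rw [Finset.sum_congr rfl this, Finset.sum_const, Nat.cast_smul_eq_nsmul]

/-- The transposition of `i` and `j` lies in the column stabiliser and fixes `F`, so the
antisymmetrised vector equals its own negative. -/
theorem antisymm_single_eq_zero {μ : YoungDiagram} {n : ℕ} (t : Tableau μ n) {F : Fin n → ℕ}
    {i j : Fin n} (hij : i ≠ j) (hc : (t i).1.2 = (t j).1.2) (hF : F i = F j) (a : ℚ) :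
    antisymm t (Finsupp.single F a) = 0 := by
  have h := antisymm_permRep t (swap_mem_colStab hc) (Finsupp.single F a)
  have h1 : F ∘ ⇑(Equiv.swap i j)⁻¹ = F := by
    funext k
    rw [Equiv.swap_inv, Function.comp_apply]
    by_cases h1 : k = i
    · subst h1; rw [Equiv.swap_apply_left, hF]
    · by_cases h2 : k = j
      · subst h2; rw [Equiv.swap_apply_right, hF]
      · rw [Equiv.swap_apply_of_ne_of_ne h1 h2]
  rw [permRep_single, h1, Equiv.Perm.sign_swap hij] at h
  simp only [Units.val_neg, Units.val_one, Int.cast_neg, Int.cast_one, neg_smul, one_smul] at h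
  exact self_eq_neg.1 h

/-! ### Row counts and dominance -/

/-- `F` takes each value `i` exactly `μ.rowLen i` times. -/
def HasShape {n : ℕ} (F : Fin n → ℕ) (μ : YoungDiagram) : Prop :=
  ∀ i, (Finset.univ.filter fun x => F x = i).card = μ.rowLen i

theorem card_filter_cells {n : ℕ} {μ : YoungDiagram} (t : Tableau μ n) (p : ℕ × ℕ → Prop)
    [DecidablePred p] :
    (Finset.univ.filter fun x => p (t x).1).card = (μ.cells.filter p).card := by
  refine Finset.card_bij (fun x _ => (t x).1) ?_ ?_ ?_
  · intro x hx
    exact Finset.mem_filter.2 ⟨(t x).2, (Finset.mem_filter.1 hx).2⟩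
  · intro x _ y _ h
    exact t.injective (Subtype.ext h)
  · intro c hc
    obtain ⟨h1, h2⟩ := Finset.mem_filter.1 hc
    refine ⟨t.symm ⟨c, h1⟩, ?_, by simp⟩
    simpa using h2

theorem hasShape_tabloid {n : ℕ} {μ : YoungDiagram} (t : Tableau μ n) :
    HasShape (tabloid t) μ := by
  intro i
  rw [YoungDiagram.rowLen_eq_card]
  exact card_filter_cells t (fun c => c.1 = i)

theorem HasShape.comp {n : ℕ} {F : Fin n → ℕ} {μ : YoungDiagram} (h : HasShape F μ)
    (g : Equiv.Perm (Fin n)) : HasShape (F ∘ ⇑g) μ := by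
  intro i
  rw [← h i]
  refine Finset.card_bij (fun x _ => g x) ?_ ?_ ?_
  · intro x hx; simpa using hx
  · intro x _ y _ h; exact g.injective h
  · intro y hy; exact ⟨g⁻¹ y, by simpa using hy, by simp⟩

theorem HasShape.card_lt {n : ℕ} {F : Fin n → ℕ} {μ : YoungDiagram} (h : HasShape F μ) (k : ℕ) :
    (Finset.univ.filter fun x => F x < k).card = ∑ i ∈ Finset.range k, μ.rowLen i := by
  rw [Finset.card_eq_sum_card_fiberwise (f := F) (t := Finset.range k)]
  · refine Finset.sum_congr rfl fun i hi => ?_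
    rw [← h i, Finset.filter_filter]
    congr 1
    ext x
    have := Finset.mem_range.1 hi
    simp only [Finset.mem_filter, Finset.mem_univ, true_and]
    omega
  · intro x hx
    simpa using hx

/-- The part of a column `j` of a tableau on which `F` is less than `k`. -/
theorem card_col_lt_le {n : ℕ} {μ : YoungDiagram} (t : Tableau μ n) {F : Fin n → ℕ}
    (hF : ∀ x y, x ≠ y → (t x).1.2 = (t y).1.2 → F x ≠ F y) (k j : ℕ) :
    (Finset.univ.filter fun x => F x < k ∧ (t x).1.2 = j).card ≤
      (Finset.univ.filter fun x => tabloid t x < k ∧ (t x).1.2 = j).card := by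
  -- As `F` is injective on column `j`, the left side is at most `min k (μ.colLen j)`; for the
  -- tabloid of `t` itself this value is attained.
  have h1 : (Finset.univ.filter fun x => F x < k ∧ (t x).1.2 = j).card ≤ k := by
    rw [← Finset.card_range k]
    refine Finset.card_le_card_of_injOn F ?_ ?_
    · intro x hx
      have := (Finset.mem_filter.1 hx).2.1
      simpa using this
    · intro x hx y hy hxy
      by_contra hne
      refine hF x y hne ?_ hxy
      rw [(Finset.mem_filter.1 hx).2.2, (Finset.mem_filter.1 hy).2.2]
  have h2 : (Finset.univ.filter fun x => F x < k ∧ (t x).1.2 = j).card ≤ μ.colLen j := by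
    rw [YoungDiagram.colLen_eq_card, YoungDiagram.col, ← card_filter_cells t (fun c => c.2 = j)]
    refine Finset.card_le_card fun x hx => ?_
    rw [Finset.mem_filter] at hx ⊢
    exact ⟨hx.1, hx.2.2⟩
  have h3 : (Finset.univ.filter fun x => tabloid t x < k ∧ (t x).1.2 = j).card
      = min k (μ.colLen j) := by
    rw [← Finset.card_range (min k (μ.colLen j))]
    refine (card_filter_cells t (fun c => c.1 < k ∧ c.2 = j)).trans ?_
    refine Finset.card_bij (fun c _ => c.1) ?_ ?_ ?_
    · rintro ⟨i, l⟩ hc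
      obtain ⟨hm, h1, h2⟩ := Finset.mem_filter.1 hc
      simp only at h1 h2
      subst h2
      have := YoungDiagram.mem_iff_lt_colLen.1 (YoungDiagram.mem_cells _ |>.1 hm)
      simp only [Finset.mem_range]
      omega
    · rintro ⟨i, l⟩ hc ⟨i', l'⟩ hc' h
      obtain ⟨hm, h1, h2⟩ := Finset.mem_filter.1 hc
      obtain ⟨hm', h1', h2'⟩ := Finset.mem_filter.1 hc'
      simp only at h h2 h2'
      rw [h, h2, h2']
    · intro i hi
      rw [Finset.mem_range] at hi
      refine ⟨(i, j), Finset.mem_filter.2 ⟨?_, ?_, rfl⟩, rfl⟩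
      · exact YoungDiagram.mem_iff_lt_colLen.2 (by omega)
      · simp only; omega
  omega

theorem sum_card_col {n : ℕ} {μ : YoungDiagram} (t : Tableau μ n) (F : Fin n → ℕ) (k : ℕ) :
    (Finset.univ.filter fun x => F x < k).card =
      ∑ j ∈ Finset.range (μ.card),
        (Finset.univ.filter fun x => F x < k ∧ (t x).1.2 = j).card := by
  rw [Finset.card_eq_sum_card_fiberwise (f := fun x => (t x).1.2) (t := Finset.range μ.card)]
  · simp_rw [Finset.filter_filter]
  · intro x _
    exact Finset.mem_coe.2 (Finset.mem_range.2 (mem_lt_card μ (t x).2).2)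

/-- This is the basic combinatorial lemma on tabloids: the bound for a single column, summed over
all columns. -/
theorem dominance {n : ℕ} {μ ν : YoungDiagram} (t : Tableau μ n) {F : Fin n → ℕ}
    (hF : ∀ x y, x ≠ y → (t x).1.2 = (t y).1.2 → F x ≠ F y) (hν : HasShape F ν) (k : ℕ) :
    ∑ i ∈ Finset.range k, ν.rowLen i ≤ ∑ i ∈ Finset.range k, μ.rowLen i := by
  rw [← hν.card_lt, ← (hasShape_tabloid t).card_lt, sum_card_col t, sum_card_col t]
  exact Finset.sum_le_sum fun j _ => card_col_lt_le t hF k j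

/-- For equal shapes the dominance bound is an equality, hence an equality in each column, and `F`
takes on a column of length `l` only values below `l`. Putting each entry `x` into row `F x` of its
own column then gives a tableau, which differs from `t` by a column permutation. -/
theorem exists_colStab {n : ℕ} {μ : YoungDiagram} (t : Tableau μ n) {F : Fin n → ℕ}
    (hF : ∀ x y, x ≠ y → (t x).1.2 = (t y).1.2 → F x ≠ F y) (hμ : HasShape F μ) :
    ∃ σ ∈ colStab t, F = tabloid (t.act σ) := by
  have heq : ∀ k, ∀ j ∈ Finset.range μ.card,
      (Finset.univ.filter fun x => F x < k ∧ (t x).1.2 = j).card =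
      (Finset.univ.filter fun x => tabloid t x < k ∧ (t x).1.2 = j).card := by
    intro k
    refine (Finset.sum_eq_sum_iff_of_le fun j _ => card_col_lt_le t hF k j).1 ?_
    rw [← sum_card_col, ← sum_card_col, hμ.card_lt, (hasShape_tabloid t).card_lt]
  have hlt : ∀ x, F x < μ.colLen (t x).1.2 := by
    intro x
    have h1 := heq (μ.colLen (t x).1.2) (t x).1.2
      (Finset.mem_range.2 (mem_lt_card μ (t x).2).2)
    have h2 : (Finset.univ.filter fun y => tabloid t y < μ.colLen (t x).1.2 ∧
        (t y).1.2 = (t x).1.2) = Finset.univ.filter fun y => (t y).1.2 = (t x).1.2 := by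
      ext y
      simp only [Finset.mem_filter, Finset.mem_univ, true_and, and_iff_right_iff_imp]
      intro hy
      rw [← hy]
      exact YoungDiagram.mem_iff_lt_colLen.1 ((YoungDiagram.mem_cells _).1 (t y).2)
    rw [h2] at h1
    have h3 := Finset.eq_of_subset_of_card_le (s := Finset.univ.filter fun y =>
      F y < μ.colLen (t x).1.2 ∧ (t y).1.2 = (t x).1.2)
      (t := Finset.univ.filter fun y => (t y).1.2 = (t x).1.2)
      (fun y hy => by
        rw [Finset.mem_filter] at hy ⊢
        exact ⟨hy.1, hy.2.2⟩) h1.ge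
    have h4 : x ∈ Finset.univ.filter fun y => (t y).1.2 = (t x).1.2 := by simp
    rw [← h3] at h4
    exact (Finset.mem_filter.1 h4).2.1
  let u : Fin n → μ.cells := fun x =>
    ⟨(F x, (t x).1.2), YoungDiagram.mem_iff_lt_colLen.2 (hlt x)⟩
  have hu : Function.Injective u := by
    intro x y hxy
    have h1 := congrArg (fun c => c.1.1) hxy
    have h2 := congrArg (fun c => c.1.2) hxy
    by_contra hne
    exact hF x y hne h2 h1
  have hb : Function.Bijective u :=
    (Fintype.bijective_iff_injective_and_card u).2 ⟨hu, Fintype.card_congr t⟩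
  let t' : Tableau μ n := Equiv.ofBijective u hb
  have h1 : t.act (t.trans t'.symm) = t' := by
    ext x : 1
    change t (t.symm (t' x)) = t' x
    simp
  refine ⟨t.trans t'.symm, ?_, ?_⟩
  · rw [mem_colStab]
    intro i
    have h2 : (t' (t'.symm (t i))).1.2 = (t (t'.symm (t i))).1.2 := rfl
    rw [Equiv.apply_symm_apply] at h2
    exact h2.symm
  · rw [h1]
    rfl

theorem tabloid_act {μ : YoungDiagram} {n : ℕ} (g : Equiv.Perm (Fin n)) (t : Tableau μ n) :
    tabloid (t.act g) = tabloid t ∘ ⇑g⁻¹ := rfl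

theorem antisymm_single_mem {n : ℕ} {μ : YoungDiagram} (t : Tableau μ n) {F : Fin n → ℕ}
    (hμ : HasShape F μ) :
    antisymm t (Finsupp.single F 1) ∈ Submodule.span ℚ {polytabloid t} := by
  by_cases hF : ∀ x y, x ≠ y → (t x).1.2 = (t y).1.2 → F x ≠ F y
  · obtain ⟨σ, hσ, rfl⟩ := exists_colStab t hF hμ
    rw [tabloid_act, ← permRep_single, antisymm_permRep t hσ, antisymm_tabloid]
    exact Submodule.smul_mem _ _ (Submodule.mem_span_singleton_self _)
  · push Not at hF
    obtain ⟨x, y, hxy, hc, hF⟩ := hF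
    rw [antisymm_single_eq_zero t hxy hc hF]
    exact Submodule.zero_mem _

/-- The permutation module on the tabloids of shape `μ`. -/
def tabloidModule (n : ℕ) (μ : YoungDiagram) : Submodule ℚ ((Fin n → ℕ) →₀ ℚ) :=
  Submodule.span ℚ {x | ∃ F, HasShape F μ ∧ x = Finsupp.single F 1}

theorem polytabloid_mem {n : ℕ} {μ : YoungDiagram} (t : Tableau μ n) :
    polytabloid t ∈ tabloidModule n μ := by
  refine Submodule.sum_mem _ fun σ _ => ?_
  rw [← mul_one ((Equiv.Perm.sign σ : ℤ) : ℚ), ← smul_eq_mul, ← Finsupp.smul_single]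
  exact Submodule.smul_mem _ _ (Submodule.subset_span ⟨_, hasShape_tabloid _, rfl⟩)

theorem spechtModule_le {n : ℕ} {μ : YoungDiagram} :
    (spechtModule n μ).toSubmodule ≤ tabloidModule n μ := by
  refine Submodule.span_le.2 ?_
  rintro _ ⟨t, rfl⟩
  exact polytabloid_mem t

theorem antisymm_mem {n : ℕ} {μ : YoungDiagram} (t : Tableau μ n) {x : (Fin n → ℕ) →₀ ℚ}
    (hx : x ∈ tabloidModule n μ) : antisymm t x ∈ Submodule.span ℚ {polytabloid t} := by
  induction hx using Submodule.span_induction with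
  | mem x hx => obtain ⟨F, hF, rfl⟩ := hx; exact antisymm_single_mem t hF
  | zero => simp
  | add x y _ _ hx hy => rw [map_add]; exact add_mem hx hy
  | smul a x _ hx => rw [map_smul]; exact Submodule.smul_mem _ a hx

theorem antisymm_eq_zero {n : ℕ} {μ ν : YoungDiagram} (t : Tableau μ n) {k : ℕ}
    (hk : ∑ i ∈ Finset.range k, μ.rowLen i < ∑ i ∈ Finset.range k, ν.rowLen i)
    {x : (Fin n → ℕ) →₀ ℚ} (hx : x ∈ tabloidModule n ν) : antisymm t x = 0 := by
  induction hx using Submodule.span_induction with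
  | mem x hx =>
    obtain ⟨F, hF, rfl⟩ := hx
    by_cases h : ∀ x y, x ≠ y → (t x).1.2 = (t y).1.2 → F x ≠ F y
    · exact absurd (dominance t h hF k) (not_le.2 hk)
    · push Not at h
      obtain ⟨x, y, hxy, hc, h⟩ := h
      exact antisymm_single_eq_zero t hxy hc h 1
  | zero => simp
  | add x y _ _ hx hy => rw [map_add, hx, hy, add_zero]
  | smul a x _ hx => rw [map_smul, hx, smul_zero]

/-! ### Orthonormality of the Specht characters -/

/-- The representation afforded by a Specht module. -/
abbrev spechtRep (n : ℕ) (μ : YoungDiagram) :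
    Representation ℚ (Equiv.Perm (Fin n)) (spechtModule n μ).toSubmodule :=
  (spechtModule n μ).toRepresentation

instance (n : ℕ) (μ : YoungDiagram) : FiniteDimensional ℚ (spechtModule n μ).toSubmodule :=
  FiniteDimensional.span_of_finite ℚ (Set.finite_range _)

/-- The polytabloid as an element of the Specht module. -/
def polyt {μ : YoungDiagram} {n : ℕ} (t : Tableau μ n) : (spechtModule n μ).toSubmodule :=
  ⟨polytabloid t, Submodule.subset_span ⟨t, rfl⟩⟩

theorem spechtRep_polyt {μ : YoungDiagram} {n : ℕ} (g : Equiv.Perm (Fin n)) (t : Tableau μ n) :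
    spechtRep n μ g (polyt t) = polyt (t.act g) :=
  Subtype.ext (permRep_polytabloid g t)

theorem span_polyt (μ : YoungDiagram) (n : ℕ) :
    Submodule.span ℚ (Set.range fun t : Tableau μ n => polyt t) = ⊤ := by
  have h := Submodule.span_span_coe_preimage (R := ℚ)
    (s := Set.range fun t : Tableau μ n => polytabloid t)
  refine Eq.trans ?_ h
  congr 1
  ext x
  constructor
  · rintro ⟨t, rfl⟩; exact ⟨t, rfl⟩
  · rintro ⟨t, ht⟩; exact ⟨t, Subtype.ext ht⟩

theorem exists_act {μ : YoungDiagram} {n : ℕ} (t t' : Tableau μ n) :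
    ∃ g : Equiv.Perm (Fin n), t' = t.act g := by
  refine ⟨t.trans t'.symm, ?_⟩
  apply Equiv.ext
  intro x
  change t' x = t (t.symm (t' x))
  simp

theorem nonempty_tableau {μ : YoungDiagram} {n : ℕ} (h : μ.card = n) : Nonempty (Tableau μ n) :=
  ⟨(μ.cells.equivFinOfCardEq h).symm⟩

theorem eq_one_of_tabloid {μ : YoungDiagram} {n : ℕ} {t : Tableau μ n} {σ : Equiv.Perm (Fin n)}
    (hσ : σ ∈ colStab t) (h : tabloid (t.act σ) = tabloid t) : σ = 1 := by
  have h2 := mem_colStab.1 (inv_mem_colStab hσ)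
  have : σ⁻¹ = 1 := by
    ext i : 1
    apply t.injective
    apply Subtype.ext
    exact Prod.ext (congrFun h i) (h2 i)
  exact inv_eq_one.1 this

theorem polytabloid_apply_tabloid {μ : YoungDiagram} {n : ℕ} (t : Tableau μ n) :
    polytabloid t (tabloid t) = 1 := by
  rw [polytabloid, Finsupp.finsetSum_apply, Finset.sum_eq_single 1]
  · have : tabloid (t.act 1) = tabloid t := rfl
    rw [this]
    simp
  · intro σ hσ hne
    rw [Finsupp.single_apply, if_neg]
    exact fun h => hne (eq_one_of_tabloid hσ h)
  · intro h
    exact absurd (mem_colStab.2 fun i => rfl) h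

theorem polytabloid_ne_zero {μ : YoungDiagram} {n : ℕ} (t : Tableau μ n) : polytabloid t ≠ 0 := by
  intro h
  have := polytabloid_apply_tabloid t
  rw [h] at this
  simp at this

theorem colStab_card_ne_zero {μ : YoungDiagram} {n : ℕ} (t : Tableau μ n) :
    ((colStab t).card : ℚ) ≠ 0 := by
  rw [Nat.cast_ne_zero, Finset.card_ne_zero]
  exact ⟨1, mem_colStab.2 fun i => rfl⟩

/-- A polytabloid is an eigenvector of its own antisymmetriser, with the order of the column
stabiliser as eigenvalue, and `θ` commutes with the group. So `θ (polyt t)` is confined to the image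
of `antisymm t`, which is zero or a line by the dominance results; Schur-type statements follow. -/
theorem intertwining_antisymm {n : ℕ} {μ ν : YoungDiagram}
    (θ : Representation.IntertwiningMap (spechtRep n μ) (spechtRep n ν)) (t : Tableau μ n) :
    ((colStab t).card : ℚ) • (θ (polyt t) : (Fin n → ℕ) →₀ ℚ) =
      antisymm t (θ (polyt t) : (Fin n → ℕ) →₀ ℚ) := by
  have h : ((colStab t).card : ℚ) • polyt t =
      ∑ σ ∈ colStab t, ((Equiv.Perm.sign σ : ℤ) : ℚ) • spechtRep n μ σ (polyt t) := by
    apply Subtype.ext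
    have h1 := antisymm_polytabloid t
    rw [antisymm_apply] at h1
    rw [Submodule.coe_smul, Submodule.coe_sum]
    exact h1.symm
  have h2 := congrArg (fun v => ((θ v : (spechtModule n ν).toSubmodule) : (Fin n → ℕ) →₀ ℚ)) h
  simp only [map_smul, map_sum, θ.isIntertwining] at h2
  rw [antisymm_apply, ← Submodule.coe_smul, h2, Submodule.coe_sum]
  rfl

theorem intertwining_ext {n : ℕ} {μ ν : YoungDiagram}
    {θ ψ : Representation.IntertwiningMap (spechtRep n μ) (spechtRep n ν)} (t : Tableau μ n)
    (h : θ (polyt t) = ψ (polyt t)) : θ = ψ := by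
  apply Representation.IntertwiningMap.ext
  apply LinearMap.ext_on_range (span_polyt μ n)
  intro t'
  obtain ⟨g, rfl⟩ := exists_act t t'
  rw [← spechtRep_polyt]
  change θ _ = ψ _
  rw [θ.isIntertwining, ψ.isIntertwining, h]

theorem intertwining_eq_zero {n : ℕ} {μ ν : YoungDiagram} (hμ : μ.card = n) {k : ℕ}
    (hk : ∑ i ∈ Finset.range k, μ.rowLen i < ∑ i ∈ Finset.range k, ν.rowLen i)
    (θ : Representation.IntertwiningMap (spechtRep n μ) (spechtRep n ν)) : θ = 0 := by
  obtain ⟨t⟩ := nonempty_tableau hμ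
  apply intertwining_ext t
  have h := intertwining_antisymm θ t
  rw [antisymm_eq_zero t hk (spechtModule_le (θ (polyt t)).2)] at h
  apply Subtype.ext
  exact (smul_eq_zero.1 h).resolve_left (colStab_card_ne_zero t)

/-- The antisymmetriser of `t` maps the tabloid module into the line of `polytabloid t`, so an
endomorphism multiplies the generator `polyt t` by a scalar. -/
theorem finrank_intertwining_self {n : ℕ} {μ : YoungDiagram} (hμ : μ.card = n) :
    Module.finrank ℚ (Representation.IntertwiningMap (spechtRep n μ) (spechtRep n μ)) = 1 := by
  obtain ⟨t⟩ := nonempty_tableau hμ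
  refine finrank_eq_one (Representation.IntertwiningMap.id (spechtRep n μ)) ?_ ?_
  · intro h
    have h1 := congrArg (fun θ => ((θ (polyt t) : (spechtModule n μ).toSubmodule) :
      (Fin n → ℕ) →₀ ℚ)) h
    exact polytabloid_ne_zero t h1
  · intro θ
    have h := intertwining_antisymm θ t
    obtain ⟨c, hc⟩ := Submodule.mem_span_singleton.1
      (antisymm_mem t (spechtModule_le (θ (polyt t)).2))
    rw [← hc] at h
    refine ⟨((colStab t).card : ℚ)⁻¹ * c, ?_⟩
    apply intertwining_ext t
    apply Subtype.ext
    change (((colStab t).card : ℚ)⁻¹ * c) • polytabloid t = _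
    rw [mul_smul, ← h, smul_smul, inv_mul_cancel₀ (colStab_card_ne_zero t), one_smul]

instance (n : ℕ) : Invertible (Nat.card (Equiv.Perm (Fin n)) : ℚ) :=
  invertibleOfNonzero (Nat.cast_ne_zero.2 Nat.card_pos.ne')

theorem ip_character {n : ℕ} {V W : Type} [AddCommGroup V] [Module ℚ V] [FiniteDimensional ℚ V]
    [AddCommGroup W] [Module ℚ W] [FiniteDimensional ℚ W]
    (ρ : Representation ℚ (Equiv.Perm (Fin n)) V) (σ : Representation ℚ (Equiv.Perm (Fin n)) W) :
    ip σ.character ρ.character = Module.finrank ℚ (Representation.IntertwiningMap ρ σ) := by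
  rw [← Representation.card_inv_mul_sum_char_mul_char_eq_finrank, ip, Nat.card_eq_fintype_card,
    Fintype.card_perm, Fintype.card_fin]

theorem ip_comm {n : ℕ} (χ ψ : Equiv.Perm (Fin n) → ℚ) : ip χ ψ = ip ψ χ := by
  unfold ip
  congr 1
  rw [← Equiv.sum_comp (Equiv.inv _)]
  refine Finset.sum_congr rfl fun g _ => ?_
  simp [mul_comm]

theorem ip_specht_self {n : ℕ} {μ : YoungDiagram} (hμ : μ.card = n) :
    ip (spechtChar n μ) (spechtChar n μ) = 1 := by
  unfold spechtChar
  rw [ip_character, finrank_intertwining_self hμ, Nat.cast_one]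

theorem ip_eq_zero_of_lt {n : ℕ} {μ ν : YoungDiagram} (hμ : μ.card = n) {k : ℕ}
    (hk : ∑ i ∈ Finset.range k, μ.rowLen i < ∑ i ∈ Finset.range k, ν.rowLen i) :
    ip (spechtChar n ν) (spechtChar n μ) = 0 := by
  unfold spechtChar
  rw [ip_character]
  have : Subsingleton (Representation.IntertwiningMap (spechtRep n μ) (spechtRep n ν)) :=
    ⟨fun θ ψ => by rw [intertwining_eq_zero hμ hk θ, intertwining_eq_zero hμ hk ψ]⟩
  rw [Module.finrank_zero_of_subsingleton, Nat.cast_zero]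

/-- A nonzero inner product gives dominance in both directions, so all partial sums of row lengths
agree. -/
theorem ip_specht_of_ne {n : ℕ} {μ ν : YoungDiagram} (hμ : μ.card = n) (hν : ν.card = n)
    (hne : μ ≠ ν) : ip (spechtChar n μ) (spechtChar n ν) = 0 := by
  by_contra h
  apply hne
  have h1 : ∀ k, ∑ i ∈ Finset.range k, ν.rowLen i = ∑ i ∈ Finset.range k, μ.rowLen i := by
    intro k
    apply le_antisymm
    · by_contra! hk
      rw [ip_comm] at h
      exact h (ip_eq_zero_of_lt hμ hk)
    · by_contra! hk
      exact h (ip_eq_zero_of_lt hν hk)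
  apply ext_rowLen
  intro i
  have h2 := h1 (i + 1)
  rw [Finset.sum_range_succ, Finset.sum_range_succ, h1 i] at h2
  omega

open Classical in
theorem ip_specht {n : ℕ} (μ ν : Ptn n) :
    ip (spechtChar n μ.1) (spechtChar n ν.1) = if μ = ν then 1 else 0 := by
  split_ifs with h
  · rw [h, ip_specht_self ν.2]
  · exact ip_specht_of_ne μ.2 ν.2 fun h2 => h (Ptn.ext h2)

/-- The degree of the Specht character. -/
def deg {n : ℕ} (μ : Ptn n) : ℚ := spechtChar n μ.1 1

theorem deg_pos {n : ℕ} (μ : Ptn n) : 0 < deg μ := by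
  unfold deg spechtChar
  rw [Representation.char_one]
  obtain ⟨t⟩ := nonempty_tableau μ.2
  have : Nontrivial (spechtModule n μ.1).toSubmodule :=
    ⟨polyt t, 0, fun h => polytabloid_ne_zero t (congrArg Subtype.val h)⟩
  exact_mod_cast Module.finrank_pos

/-! ### Class functions -/

theorem ip_smul_left {n : ℕ} (a : ℚ) (χ ψ : Equiv.Perm (Fin n) → ℚ) :
    ip (a • χ) ψ = a * ip χ ψ := (ipLin ψ).map_smul a χ

theorem ip_sum_left {n : ℕ} {ι : Type*} (s : Finset ι) (χ : ι → Equiv.Perm (Fin n) → ℚ)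
    (ψ : Equiv.Perm (Fin n) → ℚ) : ip (∑ i ∈ s, χ i) ψ = ∑ i ∈ s, ip (χ i) ψ :=
  map_sum (ipLin ψ) χ s

/-- The space of class functions on the symmetric group. -/
def classFun (n : ℕ) : Submodule ℚ (Equiv.Perm (Fin n) → ℚ) where
  carrier := {χ | ∀ g h, IsConj g h → χ g = χ h}
  add_mem' := by
    intro a b ha hb g h hgh
    simp [ha g h hgh, hb g h hgh]
  zero_mem' := by intro g h _; rfl
  smul_mem' := by
    intro c a ha g h hgh
    simp [ha g h hgh]

theorem character_mem_classFun {n : ℕ} {V : Type} [AddCommGroup V] [Module ℚ V]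
    (ρ : Representation ℚ (Equiv.Perm (Fin n)) V) : ρ.character ∈ classFun n := by
  intro g h hgh
  obtain ⟨c, rfl⟩ := isConj_iff.1 hgh
  exact (ρ.char_conj g c).symm

/-- The Young diagram of an unordered partition. -/
def diagramOf {n : ℕ} (p : n.Partition) : YoungDiagram :=
  YoungDiagram.ofRowLens (p.parts.sort (· ≥ ·)) (Multiset.pairwise_sort p.parts (· ≥ ·)).sortedGE

theorem diagramOf_injective {n : ℕ} : Function.Injective (diagramOf (n := n)) := by
  intro p q h
  have hp : ∀ p : n.Partition, (diagramOf p).rowLens = p.parts.sort (· ≥ ·) := fun p =>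
    YoungDiagram.rowLens_ofRowLens_eq_self fun x hx => p.parts_pos (Multiset.mem_sort _ |>.1 hx)
  have h1 := hp p
  rw [h, hp q] at h1
  apply Nat.Partition.ext
  rw [← Multiset.sort_eq p.parts (· ≥ ·), ← Multiset.sort_eq q.parts (· ≥ ·), h1]

theorem card_diagramOf {n : ℕ} (p : n.Partition) : (diagramOf p).card = n := by
  set w := p.parts.sort (· ≥ ·) with hw
  have h0 : (diagramOf p).rowLen w.length = 0 := by
    by_contra h
    have h1 : (w.length, 0) ∈ diagramOf p :=
      YoungDiagram.mem_iff_lt_rowLen.2 (Nat.pos_of_ne_zero h)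
    obtain ⟨h2, -⟩ := YoungDiagram.mem_ofRowLens.1 h1
    exact lt_irrefl _ h2
  rw [card_eq_sum_rowLen _ h0, Finset.sum_range]
  have h1 : ∀ i : Fin w.length, (diagramOf p).rowLen i = w[i] := fun i =>
    YoungDiagram.rowLen_ofRowLens i
  rw [Finset.sum_congr rfl fun i _ => h1 i]
  have h2 : w.sum = n := by
    rw [← Multiset.sum_coe, hw, Multiset.sort_eq, p.parts_sum]
  exact (Fin.sum_univ_getElem w).trans h2

/-- A complete invariant of conjugacy, valued in the partitions of `n`. -/
theorem exists_conj_invariant (n : ℕ) :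
    ∃ D : Equiv.Perm (Fin n) → Ptn n, ∀ g h, D g = D h → IsConj g h := by
  refine ⟨fun g => ⟨diagramOf g.partition, by rw [card_diagramOf, Fintype.card_fin]⟩, ?_⟩
  intro g h hgh
  exact Equiv.Perm.partition_eq_of_isConj.2 (diagramOf_injective (congrArg Subtype.val hgh))

/-- Class functions factor through an invariant with values in `Ptn n`. Only this upper bound is
needed, since the orthonormal Specht characters supply as many independent class functions. -/
theorem finrank_classFun_le (n : ℕ) :
    Module.finrank ℚ (classFun n) ≤ Fintype.card (Ptn n) := by
  obtain ⟨D, hD⟩ := exists_conj_invariant n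
  rw [← Module.finrank_fintype_fun_eq_card ℚ]
  have h : classFun n ≤ LinearMap.range (LinearMap.funLeft ℚ ℚ D) := by
    intro χ hχ
    refine ⟨Function.extend D χ 0, ?_⟩
    funext g
    exact Function.FactorsThrough.extend_apply (fun a b hab => hχ a b (hD a b hab)) _ g
  exact (Submodule.finrank_mono h).trans (LinearMap.finrank_range_le _)

/-- Every class function is a combination of Specht characters. -/
theorem classFun_expand {n : ℕ} {χ : Equiv.Perm (Fin n) → ℚ} (hχ : χ ∈ classFun n) :
    χ = ∑ μ : Ptn n, ip χ (spechtChar n μ.1) • spechtChar n μ.1 := by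
  classical
  let b : Ptn n → classFun n := fun μ => ⟨spechtChar n μ.1, character_mem_classFun _⟩
  have hip : ∀ (c : Ptn n → ℚ) (ν : Ptn n),
      ip (∑ μ, c μ • spechtChar n μ.1) (spechtChar n ν.1) = c ν := by
    intro c ν
    rw [ip_sum_left]
    simp_rw [ip_smul_left, ip_specht]
    simp
  have hli : LinearIndependent ℚ b := by
    rw [Fintype.linearIndependent_iff]
    intro c hc ν
    have h1 := congrArg (fun v : classFun n => ip v.1 (spechtChar n ν.1)) hc
    simp only [Submodule.coe_sum, Submodule.coe_smul, Submodule.coe_zero] at h1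
    rw [show ip (0 : Equiv.Perm (Fin n) → ℚ) (spechtChar n ν.1) = 0 from
      (ipLin (spechtChar n ν.1)).map_zero] at h1
    rw [← hip c ν]
    exact h1
  have hspan := hli.span_eq_top_of_card_eq_finrank'
    (le_antisymm hli.fintype_card_le_finrank (finrank_classFun_le n))
  have hmem : (⟨χ, hχ⟩ : classFun n) ∈ Submodule.span ℚ (Set.range b) := by
    rw [hspan]; trivial
  obtain ⟨c, hc⟩ := (Submodule.mem_span_range_iff_exists_fun ℚ).1 hmem
  have hc' : χ = ∑ μ, c μ • spechtChar n μ.1 := by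
    have := congrArg Subtype.val hc
    simp only [Submodule.coe_sum, Submodule.coe_smul] at this
    exact this.symm
  conv_lhs => rw [hc']
  refine Finset.sum_congr rfl fun μ _ => ?_
  rw [hc', hip]

/-! ### Restriction to the stabiliser of the last point -/

theorem incl_castSucc {n : ℕ} (h : Equiv.Perm (Fin n)) (i : Fin n) :
    incl n h i.castSucc = (h i).castSucc :=
  Equiv.Perm.viaEmbedding_apply h Fin.castSuccEmb i

theorem incl_last {n : ℕ} (h : Equiv.Perm (Fin n)) : incl n h (Fin.last n) = Fin.last n := by
  refine Equiv.Perm.viaEmbedding_apply_of_notMem h Fin.castSuccEmb (Fin.last n) ?_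
  rintro ⟨i, hi⟩
  exact (Fin.castSucc_lt_last i).ne hi

theorem incl_injective (n : ℕ) : Function.Injective (incl n) :=
  Equiv.Perm.viaEmbeddingHom_injective _

theorem sign_incl {n : ℕ} (h : Equiv.Perm (Fin n)) :
    Equiv.Perm.sign (incl n h) = Equiv.Perm.sign h := by
  change Equiv.Perm.sign (Equiv.Perm.viaEmbedding h Fin.castSuccEmb) = _
  unfold Equiv.Perm.viaEmbedding
  convert Equiv.Perm.sign_extendDomain h (Equiv.ofInjective Fin.castSuccEmb.1
    Fin.castSuccEmb.2)

theorem exists_incl {n : ℕ} {σ : Equiv.Perm (Fin (n + 1))} (hσ : σ (Fin.last n) = Fin.last n) :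
    ∃ h, incl n h = σ := by
  have h1 : ∀ i : Fin n, σ i.castSucc ≠ Fin.last n := by
    intro i hi
    rw [← hσ] at hi
    exact (Fin.castSucc_lt_last i).ne (σ.injective hi)
  let u : Fin n → Fin n := fun i => (σ i.castSucc).castPred (h1 i)
  have hu : ∀ i, (u i).castSucc = σ i.castSucc := fun i => Fin.castSucc_castPred _ _
  have hinj : Function.Injective u := by
    intro i j hij
    have := congrArg Fin.castSucc hij
    rw [hu, hu] at this
    exact Fin.castSucc_injective _ (σ.injective this)
  refine ⟨Equiv.ofBijective u (Finite.injective_iff_bijective.1 hinj), ?_⟩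
  ext x : 1
  refine Fin.lastCases ?_ (fun i => ?_) x
  · rw [incl_last, hσ]
  · rw [incl_castSucc]; exact hu i

/-- The restriction to `𝔖_n` of the Specht module of a partition of `n + 1`. -/
abbrev resRep (n : ℕ) (μ : YoungDiagram) :
    Representation ℚ (Equiv.Perm (Fin n)) (spechtModule (n + 1) μ).toSubmodule :=
  (spechtRep (n + 1) μ).comp (incl n)

theorem character_resRep (n : ℕ) (μ : YoungDiagram) :
    (resRep n μ).character = res (spechtChar (n + 1) μ) := rfl

theorem specht_mem_classFun (n : ℕ) (μ : YoungDiagram) : spechtChar n μ ∈ classFun n :=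
  character_mem_classFun _

theorem res_mem_classFun (n : ℕ) (μ : YoungDiagram) :
    res (spechtChar (n + 1) μ) ∈ classFun n := by
  rw [← character_resRep]
  exact character_mem_classFun _

/-- The map of permutation modules which keeps the tabloids with the last entry in row `r`, with
this entry deleted. -/
def dropLast (n r : ℕ) : ((Fin (n + 1) → ℕ) →₀ ℚ) →ₗ[ℚ] ((Fin n → ℕ) →₀ ℚ) :=
  Finsupp.linearCombination ℚ fun F =>
    if F (Fin.last n) = r then Finsupp.single (F ∘ Fin.castSucc) 1 else 0

theorem dropLast_single {n r : ℕ} (F : Fin (n + 1) → ℕ) (a : ℚ) :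
    dropLast n r (Finsupp.single F a) =
      if F (Fin.last n) = r then Finsupp.single (F ∘ Fin.castSucc) a else 0 := by
  rw [dropLast, Finsupp.linearCombination_single]
  split_ifs <;> simp

theorem dropLast_permRep {n r : ℕ} (h : Equiv.Perm (Fin n)) (x : (Fin (n + 1) → ℕ) →₀ ℚ) :
    dropLast n r (permRep (n + 1) (incl n h) x) = permRep n h (dropLast n r x) := by
  induction x using Finsupp.induction_linear with
  | zero => simp
  | add x y hx hy => simp only [map_add, hx, hy]
  | single F a =>
    have h1 : (F ∘ ⇑(incl n h)⁻¹) (Fin.last n) = F (Fin.last n) := by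
      rw [Function.comp_apply, ← map_inv, incl_last]
    have h2 : (F ∘ ⇑(incl n h)⁻¹) ∘ Fin.castSucc = (F ∘ Fin.castSucc) ∘ ⇑h⁻¹ := by
      funext i
      simp only [Function.comp_apply]
      rw [← map_inv, incl_castSucc]
    rw [permRep_single, dropLast_single, dropLast_single, h1, h2]
    split_ifs
    · rw [permRep_single]
    · rw [map_zero]

/-- The tableau `t` extends the tableau `t'` by a last entry in the node `c`. -/
def Extends {n : ℕ} {μ ρ : YoungDiagram} (t : Tableau μ (n + 1)) (t' : Tableau ρ n)
    (c : ℕ × ℕ) : Prop :=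
  (t (Fin.last n)).1 = c ∧ ∀ i, (t i.castSucc).1 = (t' i).1

theorem exists_extends {n : ℕ} {μ ρ : YoungDiagram} {c : ℕ × ℕ} (h : AddsNode ρ μ c)
    (t' : Tableau ρ n) : ∃ t : Tableau μ (n + 1), Extends t t' c := by
  have hc : c ∈ μ.cells := by rw [h.2]; exact Finset.mem_insert_self _ _
  have hs : ρ.cells ⊆ μ.cells := by rw [h.2]; exact Finset.subset_insert _ _
  let u : Fin (n + 1) → μ.cells :=
    Fin.lastCases ⟨c, hc⟩ (fun i => ⟨(t' i).1, hs (t' i).2⟩)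
  have hu1 : u (Fin.last n) = ⟨c, hc⟩ := Fin.lastCases_last
  have hu2 : ∀ i : Fin n, u i.castSucc = ⟨(t' i).1, hs (t' i).2⟩ := fun i =>
    Fin.lastCases_castSucc i
  have hinj : Function.Injective u := by
    intro x y
    refine Fin.lastCases ?_ (fun i => ?_) x <;> refine Fin.lastCases ?_ (fun j => ?_) y
    · exact fun _ => rfl
    · rw [hu1, hu2]
      intro hh
      have h3 : c = (t' j).1 := congrArg Subtype.val hh
      exact absurd (h3 ▸ (t' j).2) h.1
    · rw [hu1, hu2]
      intro hh
      have h3 : (t' i).1 = c := congrArg Subtype.val hh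
      exact absurd (h3 ▸ (t' i).2) h.1
    · rw [hu2, hu2]
      intro hh
      have h3 : (t' i).1 = (t' j).1 := congrArg (fun c : μ.cells => c.1) hh
      rw [t'.injective (Subtype.ext h3)]
  have hcard : Fintype.card (Fin (n + 1)) = Fintype.card μ.cells := by
    have h1 := Fintype.card_congr t'
    rw [Fintype.card_fin, Fintype.card_coe] at h1
    rw [Fintype.card_fin, Fintype.card_coe, h.2, Finset.card_insert_of_notMem h.1, ← h1]
  refine ⟨Equiv.ofBijective u ((Fintype.bijective_iff_injective_and_card u).2 ⟨hinj, hcard⟩),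
    ?_, ?_⟩
  · exact congrArg Subtype.val hu1
  · exact fun i => congrArg Subtype.val (hu2 i)

theorem Extends.incl_mem_colStab {n : ℕ} {μ ρ : YoungDiagram} {t : Tableau μ (n + 1)}
    {t' : Tableau ρ n} {c : ℕ × ℕ} (h : Extends t t' c) {σ : Equiv.Perm (Fin n)} :
    incl n σ ∈ colStab t ↔ σ ∈ colStab t' := by
  rw [mem_colStab, mem_colStab]
  constructor
  · intro hi i
    have := hi i.castSucc
    rwa [incl_castSucc, h.2, h.2] at this
  · intro hi x
    refine Fin.lastCases ?_ (fun i => ?_) x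
    · rw [incl_last]
    · rw [incl_castSucc, h.2, h.2, hi]

/-- A term of the polytabloid survives only if the last entry stays in its row. It also stays in its
column, so the permutation fixes it and comes from the smaller group. -/
theorem dropLast_polytabloid {n : ℕ} {μ ρ : YoungDiagram} {t : Tableau μ (n + 1)}
    {t' : Tableau ρ n} {c : ℕ × ℕ} (h : Extends t t' c) :
    dropLast n c.1 (polytabloid t) = polytabloid t' := by
  rw [polytabloid, polytabloid, map_sum]
  symm
  refine Finset.sum_of_injOn (incl n) (incl_injective n).injOn ?_ ?_ ?_
  · intro σ hσ
    exact h.incl_mem_colStab.2 hσ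
  · intro σ hσ hn
    rw [dropLast_single, if_neg]
    intro hc
    apply hn
    have h1 : t (σ⁻¹ (Fin.last n)) = t (Fin.last n) := by
      apply Subtype.ext
      refine Prod.ext ?_ (mem_colStab.1 (inv_mem_colStab hσ) _)
      rw [h.1]
      exact hc
    have h2 : σ (Fin.last n) = Fin.last n := by
      have := congrArg σ (t.injective h1)
      simpa using this.symm
    obtain ⟨σ', rfl⟩ := exists_incl h2
    exact ⟨σ', h.incl_mem_colStab.1 hσ, rfl⟩
  · intro σ _
    have h1 : tabloid (t.act (incl n σ)) (Fin.last n) = c.1 := by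
      rw [tabloid_act, Function.comp_apply, ← map_inv, incl_last, tabloid, h.1]
    have h2 : tabloid (t.act (incl n σ)) ∘ Fin.castSucc = tabloid (t'.act σ) := by
      funext i
      rw [tabloid_act, tabloid_act, Function.comp_apply, Function.comp_apply, Function.comp_apply,
        ← map_inv, incl_castSucc, tabloid, h.2, tabloid]
    rw [dropLast_single, if_pos h1, h2, sign_incl]

/-! ### The invariant bilinear form -/

/-- The bilinear form for which the standard basis is orthonormal. -/
def dot {α : Type*} (y : α →₀ ℚ) : (α →₀ ℚ) →ₗ[ℚ] ℚ :=
  Finsupp.linearCombination ℚ fun F => y F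

theorem dot_single {α : Type*} (y : α →₀ ℚ) (F : α) (a : ℚ) :
    dot y (Finsupp.single F a) = a * y F := by
  rw [dot, Finsupp.linearCombination_single, smul_eq_mul]

theorem dot_comm {α : Type*} (x y : α →₀ ℚ) : dot x y = dot y x := by
  classical
  induction y using Finsupp.induction_linear with
  | zero => rw [map_zero, dot, Finsupp.linearCombination_apply]; simp
  | add y z hy hz =>
    rw [map_add, hy, hz]
    simp only [dot, Finsupp.linearCombination_apply, Finsupp.sum, Finsupp.add_apply, smul_add,
      Finset.sum_add_distrib]
  | single F a =>
    rw [dot_single, dot, Finsupp.linearCombination_apply, Finsupp.sum]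
    simp only [Finsupp.single_apply, smul_eq_mul, mul_ite, mul_zero, Finset.sum_ite_eq,
      Finsupp.mem_support_iff]
    by_cases h : x F = 0
    · simp [h]
    · rw [if_pos h, mul_comm]

theorem dot_permRep {n : ℕ} (g : Equiv.Perm (Fin n)) (x y : (Fin n → ℕ) →₀ ℚ) :
    dot (permRep n g y) (permRep n g x) = dot y x := by
  induction x using Finsupp.induction_linear with
  | zero => simp
  | add x y hx hy => simp only [map_add, hx, hy]
  | single F a =>
    rw [permRep_single, dot_single, dot_single]
    congr 1
    refine Finsupp.mapDomain_apply (f := fun f : Fin n → ℕ => f ∘ ⇑g⁻¹) ?_ y F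
    exact (g⁻¹).surjective.injective_comp_right

theorem dot_self_pos {α : Type*} {x : α →₀ ℚ} (hx : x ≠ 0) : 0 < dot x x := by
  rw [dot, Finsupp.linearCombination_apply, Finsupp.sum]
  refine Finset.sum_pos (fun F hF => ?_) (Finsupp.support_nonempty_iff.2 hx)
  exact mul_self_pos.2 (Finsupp.mem_support_iff.1 hF)

/-- The equivariant map `v ↦ ∑ ⟨θ v, g e_t⟩ g e_t` from a restricted Specht module to a Specht
module. -/
def branchMap {n : ℕ} (μ : YoungDiagram) {ρ : YoungDiagram} (r : ℕ) (t' : Tableau ρ n) :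
    (spechtModule (n + 1) μ).toSubmodule →ₗ[ℚ] (spechtModule n ρ).toSubmodule :=
  ∑ g : Equiv.Perm (Fin n),
    (dot (polytabloid (t'.act g)) ∘ₗ dropLast n r ∘ₗ Submodule.subtype _).smulRight
      (polyt (t'.act g))

theorem branchMap_apply {n : ℕ} (μ : YoungDiagram) {ρ : YoungDiagram} (r : ℕ) (t' : Tableau ρ n)
    (v : (spechtModule (n + 1) μ).toSubmodule) :
    branchMap μ r t' v = ∑ g : Equiv.Perm (Fin n),
      dot (polytabloid (t'.act g)) (dropLast n r v.1) • polyt (t'.act g) := by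
  simp [branchMap, LinearMap.sum_apply]

theorem act_mul {μ : YoungDiagram} {n : ℕ} (g h : Equiv.Perm (Fin n)) (t : Tableau μ n) :
    t.act (g * h) = (t.act h).act g := by
  apply Equiv.ext
  intro i
  simp [Tableau.act]

theorem branchMap_equivariant {n : ℕ} (μ : YoungDiagram) {ρ : YoungDiagram} (r : ℕ)
    (t' : Tableau ρ n) (h : Equiv.Perm (Fin n)) (v : (spechtModule (n + 1) μ).toSubmodule) :
    branchMap μ r t' (resRep n μ h v) = spechtRep n ρ h (branchMap μ r t' v) := by
  rw [branchMap_apply, branchMap_apply, map_sum, ← Equiv.sum_comp (Equiv.mulLeft h)]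
  refine Finset.sum_congr rfl fun g _ => ?_
  rw [map_smul, spechtRep_polyt, Equiv.coe_mulLeft, act_mul, ← permRep_polytabloid h]
  congr 1
  have h1 : ((resRep n μ h v : (spechtModule (n + 1) μ).toSubmodule) : (Fin (n + 1) → ℕ) →₀ ℚ)
      = permRep (n + 1) (incl n h) v.1 := rfl
  rw [h1, dropLast_permRep, dot_permRep]

/-- Pairing the image of `polyt t` with `polytabloid t'` gives a sum of squares in which the term of
the identity is positive. -/
theorem branchMap_ne_zero {n : ℕ} {μ ρ : YoungDiagram} {t : Tableau μ (n + 1)}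
    {t' : Tableau ρ n} {c : ℕ × ℕ} (h : Extends t t' c) :
    branchMap μ c.1 t' (polyt t) ≠ 0 := by
  intro h0
  have h1 := congrArg (fun v : (spechtModule n ρ).toSubmodule => dot (polytabloid t') v.1) h0
  rw [branchMap_apply] at h1
  have h2 : dropLast n c.1 (polyt t).1 = polytabloid t' := dropLast_polytabloid h
  simp only [h2, Submodule.coe_sum, Submodule.coe_smul, map_sum, map_smul, Submodule.coe_zero,
    map_zero, smul_eq_mul] at h1
  refine absurd h1 (ne_of_gt ?_)
  refine Finset.sum_pos' (fun g _ => ?_) ⟨1, Finset.mem_univ _, ?_⟩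
  · rw [dot_comm]
    exact mul_self_nonneg _
  · exact mul_pos (dot_self_pos (polytabloid_ne_zero t')) (dot_self_pos (polytabloid_ne_zero t'))

/-! ### Induction -/

theorem ind_mem_classFun {n : ℕ} (χ : Equiv.Perm (Fin n) → ℚ) : ind χ ∈ classFun (n + 1) := by
  intro g h hgh
  obtain ⟨c, rfl⟩ := isConj_iff.1 hgh
  unfold ind
  congr 1
  rw [← Equiv.sum_comp (Equiv.mulLeft c⁻¹)]
  refine Finset.sum_congr rfl fun x _ => Finset.sum_congr rfl fun k _ => ?_
  congr 2

theorem ind_one {n : ℕ} (χ : Equiv.Perm (Fin n) → ℚ) : ind χ 1 = (n + 1) * χ 1 := by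
  unfold ind
  have h1 : ∀ (x : Equiv.Perm (Fin (n + 1))) (h : Equiv.Perm (Fin n)),
      (incl n h = x⁻¹ * 1 * x) ↔ h = 1 := by
    intro x h
    rw [mul_one, inv_mul_cancel, ← map_one (incl n)]
    exact (incl_injective n).eq_iff
  simp only [h1, Finset.sum_ite_eq', Finset.mem_univ, if_true, Finset.sum_const, Finset.card_univ,
    Fintype.card_perm, Fintype.card_fin, nsmul_eq_mul, Nat.factorial_succ]
  have : (n ! : ℚ) ≠ 0 := Nat.cast_ne_zero.2 (Nat.factorial_ne_zero n)
  push_cast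
  field_simp

/-- Frobenius reciprocity. -/
theorem ip_ind {n : ℕ} (χ : Equiv.Perm (Fin n) → ℚ) {ψ : Equiv.Perm (Fin (n + 1)) → ℚ}
    (hψ : ψ ∈ classFun (n + 1)) : ip (ind χ) ψ = ip χ (res ψ) := by
  have h1 : ∑ g : Equiv.Perm (Fin (n + 1)),
      (∑ x : Equiv.Perm (Fin (n + 1)), ∑ h : Equiv.Perm (Fin n),
        if incl n h = x⁻¹ * g * x then χ h else 0) * ψ g⁻¹ =
      ((n + 1) ! : ℚ) * ∑ h : Equiv.Perm (Fin n), χ h * ψ (incl n h⁻¹) := by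
    simp_rw [Finset.sum_mul]
    rw [Finset.sum_comm]
    have h2 : ∀ x : Equiv.Perm (Fin (n + 1)), ∑ g : Equiv.Perm (Fin (n + 1)),
        ∑ h : Equiv.Perm (Fin n), (if incl n h = x⁻¹ * g * x then χ h else 0) * ψ g⁻¹ =
        ∑ h : Equiv.Perm (Fin n), χ h * ψ (incl n h⁻¹) := by
      intro x
      rw [Finset.sum_comm]
      refine Finset.sum_congr rfl fun h _ => ?_
      have h3 : ∀ g, (incl n h = x⁻¹ * g * x) ↔ g = x * incl n h * x⁻¹ := by
        intro g
        constructor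
        · intro hh; rw [hh]; group
        · rintro rfl; group
      simp only [h3, ite_mul, zero_mul, Finset.sum_ite_eq', Finset.mem_univ, if_true]
      congr 1
      refine hψ _ _ (isConj_iff.2 ⟨x⁻¹, ?_⟩)
      rw [map_inv]
      group
    rw [Finset.sum_congr rfl fun x _ => h2 x, Finset.sum_const, Finset.card_univ,
      Fintype.card_perm, Fintype.card_fin, nsmul_eq_mul]
  unfold ip ind res
  simp_rw [mul_assoc ((n ! : ℚ)⁻¹), ← Finset.mul_sum]
  rw [h1]
  have : ((n + 1) ! : ℚ) ≠ 0 := Nat.cast_ne_zero.2 (Nat.factorial_ne_zero _)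
  field_simp

/-! ### The branching rule -/

/-- The multiplicity of a Specht character in the restriction of another. -/
def mult {n : ℕ} (μ : Ptn (n + 1)) (ρ : Ptn n) : ℚ :=
  ip (res (spechtChar (n + 1) μ.1)) (spechtChar n ρ.1)

theorem mult_eq_finrank {n : ℕ} (μ : Ptn (n + 1)) (ρ : Ptn n) :
    mult μ ρ = Module.finrank ℚ
      (Representation.IntertwiningMap (resRep n μ.1) (spechtRep n ρ.1)) := by
  rw [mult, ip_comm, ← character_resRep]
  exact ip_character _ _

theorem mult_nonneg {n : ℕ} (μ : Ptn (n + 1)) (ρ : Ptn n) : 0 ≤ mult μ ρ := by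
  rw [mult_eq_finrank]
  exact Nat.cast_nonneg _

theorem finrank_intertwining_pos {k G V W : Type*} [Field k] [Group G] [AddCommGroup V]
    [Module k V] [FiniteDimensional k V] [AddCommGroup W] [Module k W] [FiniteDimensional k W]
    (ρ : Representation k G V) (σ : Representation k G W) (f : Representation.IntertwiningMap ρ σ) (hf : f ≠ 0) :
    0 < Module.finrank k (Representation.IntertwiningMap ρ σ) := by
  have E := Representation.invariantsEquivIntertwiningMap ρ σ
  have : Nontrivial (Representation.IntertwiningMap ρ σ) := ⟨f, 0, hf⟩
  have := E.toEquiv.nontrivial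
  rw [← E.finrank_eq]
  exact Module.finrank_pos

theorem one_le_mult {n : ℕ} {μ : Ptn (n + 1)} {ρ : Ptn n} (h : ρ.1 ≤ μ.1) : 1 ≤ mult μ ρ := by
  obtain ⟨i, j, hc⟩ := exists_addsNode_ptn h
  obtain ⟨t'⟩ := nonempty_tableau ρ.2
  obtain ⟨t, ht⟩ := exists_extends hc t'
  rw [mult_eq_finrank]
  exact_mod_cast finrank_intertwining_pos _ _
    ((branchMap μ.1 i t').intertwiningMap_of_isIntertwiningMap (resRep n μ.1) (spechtRep n ρ.1)
      (branchMap_equivariant μ.1 i t'))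
    fun h0 => branchMap_ne_zero ht (congrArg (fun F => F (polyt t)) h0)

theorem deg_eq_sum_mult {n : ℕ} (μ : Ptn (n + 1)) : deg μ = ∑ ρ, mult μ ρ * deg ρ := by
  have h := congrFun (classFun_expand (res_mem_classFun n μ.1)) 1
  rw [Finset.sum_apply] at h
  have h1 : res (spechtChar (n + 1) μ.1) 1 = deg μ := by
    unfold res deg
    rw [map_one]
  rw [h1] at h
  exact h

theorem sum_mult_deg {n : ℕ} (ρ : Ptn n) : ∑ μ, mult μ ρ * deg μ = (n + 1) * deg ρ := by
  have h := congrFun (classFun_expand (ind_mem_classFun (spechtChar n ρ.1))) 1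
  rw [ind_one, Finset.sum_apply] at h
  rw [deg, h]
  refine Finset.sum_congr rfl fun μ _ => ?_
  rw [ip_ind _ (specht_mem_classFun _ _), ip_comm]
  rfl

open Classical in
theorem indicator_le_mult {n : ℕ} (μ : Ptn (n + 1)) (ρ : Ptn n) :
    (if ρ.1 ≤ μ.1 then 1 else 0) ≤ mult μ ρ := by
  split_ifs with h
  · exact one_le_mult h
  · exact mult_nonneg μ ρ

open Classical in
theorem sum_downs_deg_le {n : ℕ} (μ : Ptn (n + 1)) : ∑ ρ ∈ downs μ, deg ρ ≤ deg μ := by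
  rw [deg_eq_sum_mult μ]
  have : ∑ ρ ∈ downs μ, deg ρ = ∑ ρ : Ptn n, (if ρ.1 ≤ μ.1 then 1 else 0) * deg ρ := by
    simp_rw [ite_mul, one_mul, zero_mul]
    rw [← Finset.sum_filter]
    exact Finset.sum_congr (by ext; simp) fun _ _ => rfl
  rw [this]
  exact Finset.sum_le_sum fun ρ _ =>
    mul_le_mul_of_nonneg_right (indicator_le_mult μ ρ) (deg_pos ρ).le

open Classical in
theorem sum_ups_deg {n : ℕ} (ρ : Ptn n) :
    ∑ μ ∈ ups ρ, deg μ = ∑ μ : Ptn (n + 1), (if ρ.1 ≤ μ.1 then 1 else 0) * deg μ := by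
  simp_rw [ite_mul, one_mul, zero_mul]
  rw [← Finset.sum_filter]
  exact Finset.sum_congr (by ext; simp) fun _ _ => rfl

open Classical in
-- The degree of the induced character is the sum of all `mult μ ρ * deg μ`, and each multiplicity
-- is at least the indicator of containment. The reverse inequality between the sums forces equality
-- term by term, because degrees are positive.
theorem mult_of_le_sum {n : ℕ} {ρ : Ptn n} (h : (n + 1) * deg ρ ≤ ∑ μ ∈ ups ρ, deg μ)
    (μ : Ptn (n + 1)) : mult μ ρ = if ρ.1 ≤ μ.1 then 1 else 0 := by
  rw [← sum_mult_deg, sum_ups_deg] at h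
  have h1 := (Finset.sum_eq_sum_iff_of_le fun μ _ =>
    mul_le_mul_of_nonneg_right (indicator_le_mult μ ρ) (deg_pos μ).le).1
    (le_antisymm (Finset.sum_le_sum fun μ _ =>
      mul_le_mul_of_nonneg_right (indicator_le_mult μ ρ) (deg_pos μ).le) h) μ (Finset.mem_univ μ)
  exact (mul_right_cancel₀ (deg_pos μ).ne' h1).symm

/-- The induction hypothesis already yields the branching rule one level down, so `deg ρ` is the sum
of the degrees of the partitions below `ρ`. The relation `sum_ups_downs` carries the estimate one
level up; the last inequality is the lower bound for multiplicities. -/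
theorem le_sum_ups_deg (n : ℕ) (ρ : Ptn n) : (n + 1) * deg ρ ≤ ∑ μ ∈ ups ρ, deg μ := by
  classical
  induction n with
  | zero =>
    obtain ⟨y, hy⟩ := exists_add_row ρ.1 0 (Or.inl rfl)
    obtain ⟨μ, hμ⟩ : ∃ μ : Ptn 1, μ.1 = y := ⟨⟨y, by rw [hy.card, ρ.2]⟩, rfl⟩
    have hle : ρ.1 ≤ μ.1 := by rw [hμ]; exact hy.le
    rw [Nat.cast_zero, zero_add, one_mul]
    calc deg ρ ≤ ∑ ρ' ∈ downs μ, deg ρ' :=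
          Finset.single_le_sum (f := deg) (fun ρ' _ => (deg_pos ρ').le) (mem_downs.2 hle)
      _ ≤ deg μ := sum_downs_deg_le μ
      _ ≤ _ := Finset.single_le_sum (f := deg) (fun ρ' _ => (deg_pos ρ').le) (mem_ups.2 hle)
  | succ n ih =>
    have h1 : deg ρ = ∑ σ ∈ downs ρ, deg σ := by
      conv_lhs => rw [deg_eq_sum_mult ρ]
      simp_rw [fun σ => mult_of_le_sum (ih σ) ρ, ite_mul, one_mul, zero_mul]
      rw [← Finset.sum_filter]
      exact Finset.sum_congr (by ext; simp) fun _ _ => rfl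
    calc ((n + 1 : ℕ) + 1) * deg ρ = deg ρ + ∑ σ ∈ downs ρ, (n + 1) * deg σ := by
          rw [← Finset.mul_sum, ← h1]; push_cast; ring
      _ ≤ deg ρ + ∑ σ ∈ downs ρ, ∑ ρ' ∈ ups σ, deg ρ' := by
          gcongr with σ _
          exact ih σ
      _ = ∑ μ ∈ ups ρ, ∑ ρ' ∈ downs μ, deg ρ' := (sum_ups_downs deg ρ).symm
      _ ≤ _ := Finset.sum_le_sum fun μ _ => sum_downs_deg_le μ

open Classical in
/-- The branching rule. -/
theorem ip_res_specht {n : ℕ} (μ : Ptn (n + 1)) (ρ : Ptn n) :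
    ip (res (spechtChar (n + 1) μ.1)) (spechtChar n ρ.1) = if ρ.1 ≤ μ.1 then 1 else 0 :=
  mult_of_le_sum (le_sum_ups_deg n ρ) μ

open Classical in
theorem ip_ind_specht {n : ℕ} (ρ : Ptn n) (μ : Ptn (n + 1)) :
    ip (ind (spechtChar n ρ.1)) (spechtChar (n + 1) μ.1) = if ρ.1 ≤ μ.1 then 1 else 0 := by
  rw [ip_ind _ (specht_mem_classFun _ _), ip_comm, ip_res_specht]

/-! ### The class sum of transpositions -/

open Classical in
/-- The conjugacy class of a permutation. -/
def conjClass {n : ℕ} (g : Equiv.Perm (Fin n)) : Finset (Equiv.Perm (Fin n)) :=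
  Finset.univ.filter fun h => IsConj g h

theorem mem_conjClass {n : ℕ} {g h : Equiv.Perm (Fin n)} : h ∈ conjClass g ↔ IsConj g h := by
  simp [conjClass]

/-- The operator by which the sum of a conjugacy class acts. -/
def classSum {n : ℕ} (g : Equiv.Perm (Fin n)) :
    ((Fin n → ℕ) →₀ ℚ) →ₗ[ℚ] ((Fin n → ℕ) →₀ ℚ) :=
  ∑ h ∈ conjClass g, permRep n h

theorem classSum_apply {n : ℕ} (g : Equiv.Perm (Fin n)) (x : (Fin n → ℕ) →₀ ℚ) :
    classSum g x = ∑ h ∈ conjClass g, permRep n h x := by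
  rw [classSum, LinearMap.sum_apply]

theorem classSum_permRep {n : ℕ} (g c : Equiv.Perm (Fin n)) (x : (Fin n → ℕ) →₀ ℚ) :
    classSum g (permRep n c x) = permRep n c (classSum g x) := by
  rw [classSum_apply, classSum_apply, map_sum]
  refine Finset.sum_bij' (fun h _ => c⁻¹ * h * c) (fun h _ => c * h * c⁻¹) ?_ ?_ ?_ ?_ ?_
  · intro h hh
    rw [mem_conjClass] at hh ⊢
    exact hh.trans (isConj_iff.2 ⟨c⁻¹, by group⟩)
  · intro h hh
    rw [mem_conjClass] at hh ⊢
    exact hh.trans (isConj_iff.2 ⟨c, rfl⟩)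
  · intro h _; group
  · intro h _; group
  · intro h _
    rw [← Module.End.mul_apply, ← Module.End.mul_apply, ← map_mul, ← map_mul]
    congr 2
    group

theorem classSum_antisymm {n : ℕ} {μ : YoungDiagram} (t : Tableau μ n) (g : Equiv.Perm (Fin n))
    (x : (Fin n → ℕ) →₀ ℚ) : classSum g (antisymm t x) = antisymm t (classSum g x) := by
  rw [antisymm_apply, antisymm_apply, map_sum]
  refine Finset.sum_congr rfl fun σ _ => ?_
  rw [map_smul, classSum_permRep]

theorem permRep_apply {n : ℕ} (g : Equiv.Perm (Fin n)) (x : (Fin n → ℕ) →₀ ℚ) (F : Fin n → ℕ) :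
    permRep n g x F = x (F ∘ ⇑g) := by
  have h : F = (F ∘ ⇑g) ∘ ⇑g⁻¹ := by funext i; simp
  conv_lhs => rw [h]
  refine Finsupp.mapDomain_apply (f := fun f : Fin n → ℕ => f ∘ ⇑g⁻¹) ?_ x _
  exact (g⁻¹).surjective.injective_comp_right

/-- A class sum commutes with the antisymmetriser, hence preserves the line of `polytabloid t`. The
scalar is read off at the tabloid of `t`, where the polytabloid has coefficient `1`. -/
theorem classSum_polytabloid {n : ℕ} {μ : YoungDiagram} (t : Tableau μ n)
    (g : Equiv.Perm (Fin n)) :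
    classSum g (polytabloid t) =
      (∑ h ∈ conjClass g, polytabloid t (tabloid t ∘ ⇑h)) • polytabloid t := by
  have h1 : classSum g (polytabloid t) ∈ Submodule.span ℚ {polytabloid t} := by
    rw [← antisymm_tabloid, classSum_antisymm, antisymm_tabloid]
    apply antisymm_mem
    rw [classSum_apply]
    refine Submodule.sum_mem _ fun h _ => ?_
    rw [permRep_single]
    exact Submodule.subset_span ⟨_, (hasShape_tabloid t).comp _, rfl⟩
  obtain ⟨c, hc⟩ := Submodule.mem_span_singleton.1 h1
  have h2 := congrArg (fun x : (Fin n → ℕ) →₀ ℚ => x (tabloid t)) hc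
  simp only [Finsupp.smul_apply, polytabloid_apply_tabloid, smul_eq_mul, mul_one,
    classSum_apply, Finsupp.finsetSum_apply, permRep_apply] at h2
  rw [← h2, hc]

theorem polytabloid_swap_row {n : ℕ} {μ : YoungDiagram} (t : Tableau μ n) {i j : Fin n}
    (h : (t i).1.1 = (t j).1.1) : polytabloid t (tabloid t ∘ ⇑(Equiv.swap i j)) = 1 := by
  have : tabloid t ∘ ⇑(Equiv.swap i j) = tabloid t := by
    funext k
    rw [Function.comp_apply]
    by_cases h1 : k = i
    · subst h1; rw [Equiv.swap_apply_left]; exact h.symm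
    · by_cases h2 : k = j
      · subst h2; rw [Equiv.swap_apply_right]; exact h
      · rw [Equiv.swap_apply_of_ne_of_ne h1 h2]
  rw [this, polytabloid_apply_tabloid]

theorem polytabloid_swap_col {n : ℕ} {μ : YoungDiagram} (t : Tableau μ n) {i j : Fin n}
    (hij : i ≠ j) (h : (t i).1.2 = (t j).1.2) :
    polytabloid t (tabloid t ∘ ⇑(Equiv.swap i j)) = -1 := by
  rw [← permRep_apply, ← antisymm_tabloid, permRep_antisymm t (swap_mem_colStab h),
    antisymm_tabloid, Finsupp.smul_apply, polytabloid_apply_tabloid, Equiv.Perm.sign_swap hij]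
  simp

/-- A column permutation producing the swapped tabloid would fix every entry other than `i` and `j`,
and it cannot exchange these since they lie in different columns. Then `i` is fixed too, and the
rows of `i` and `j` would agree. -/
theorem polytabloid_swap_other {n : ℕ} {μ : YoungDiagram} (t : Tableau μ n) {i j : Fin n}
    (hr : (t i).1.1 ≠ (t j).1.1) (hc : (t i).1.2 ≠ (t j).1.2) :
    polytabloid t (tabloid t ∘ ⇑(Equiv.swap i j)) = 0 := by
  rw [polytabloid, Finsupp.finsetSum_apply]
  refine Finset.sum_eq_zero fun σ hσ => ?_
  rw [Finsupp.single_apply, if_neg]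
  intro h
  have hcol := mem_colStab.1 (inv_mem_colStab hσ)
  have hfix : ∀ x, x ≠ i → x ≠ j → σ⁻¹ x = x := by
    intro x h1 h2
    apply t.injective
    apply Subtype.ext
    refine Prod.ext ?_ (hcol x)
    have := congrFun h x
    rw [Function.comp_apply, Equiv.swap_apply_of_ne_of_ne h1 h2] at this
    exact this
  have hi : tabloid t (σ⁻¹ i) = tabloid t j := by
    have := congrFun h i
    rw [Function.comp_apply, Equiv.swap_apply_left] at this
    exact this
  by_cases h1 : σ⁻¹ i = i
  · rw [h1] at hi; exact hr hi
  · by_cases h2 : σ⁻¹ i = j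
    · have := hcol i
      rw [h2] at this
      exact hc this.symm
    · exact h1 (σ⁻¹.injective (hfix _ h1 h2))

theorem isConj_swap_iff {n : ℕ} {i j : Fin n} (hij : i ≠ j) {h : Equiv.Perm (Fin n)} :
    IsConj (Equiv.swap i j) h ↔ ∃ x y, x ≠ y ∧ h = Equiv.swap x y := by
  constructor
  · intro hc
    obtain ⟨c, rfl⟩ := isConj_iff.1 hc
    exact ⟨c i, c j, c.injective.ne hij, (Equiv.swap_apply_apply c i j).symm⟩
  · rintro ⟨x, y, hxy, rfl⟩
    exact Equiv.Perm.isConj_swap hij hxy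

theorem swap_eq_swap {n : ℕ} {x y x' y' : Fin n} (hxy : x ≠ y)
    (h : Equiv.swap x y = Equiv.swap x' y') : (x = x' ∧ y = y') ∨ (x = y' ∧ y = x') := by
  have h1 : Equiv.swap x' y' x = y := by rw [← h, Equiv.swap_apply_left]
  by_cases hx : x = x'
  · left
    refine ⟨hx, ?_⟩
    rw [hx, Equiv.swap_apply_left] at h1
    exact h1.symm
  · by_cases hx' : x = y'
    · right
      refine ⟨hx', ?_⟩
      rw [hx', Equiv.swap_apply_right] at h1
      exact h1.symm
    · rw [Equiv.swap_apply_of_ne_of_ne hx hx'] at h1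
      exact absurd h1 hxy

theorem sum_tableau {n : ℕ} {μ : YoungDiagram} (t : Tableau μ n) (v : ℕ × ℕ → ℕ) :
    ∑ x, v (t x).1 = ∑ c ∈ μ.cells, v c := by
  rw [← Finset.sum_coe_sort μ.cells]
  exact Equiv.sum_comp t fun c => v c.1

theorem card_row_pairs {n : ℕ} {μ : YoungDiagram} (t : Tableau μ n) :
    (Finset.univ.filter fun p : Fin n × Fin n =>
      (t p.1).1.1 = (t p.2).1.1 ∧ (t p.2).1.2 < (t p.1).1.2).card = ∑ c ∈ μ.cells, c.2 := by
  rw [← sum_tableau t fun c => c.2, Finset.card_filter, Fintype.sum_prod_type]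
  refine Finset.sum_congr rfl fun x _ => ?_
  rw [← Finset.card_filter]
  refine (card_filter_cells t fun c => (t x).1.1 = c.1 ∧ c.2 < (t x).1.2).trans ?_
  conv_rhs => rw [← Finset.card_range (t x).1.2]
  refine Finset.card_bij (fun c _ => c.2) ?_ ?_ ?_
  · intro c hc
    simpa using (Finset.mem_filter.1 hc).2.2
  · intro c hc c' hc' h
    exact Prod.ext ((Finset.mem_filter.1 hc).2.1.symm.trans (Finset.mem_filter.1 hc').2.1) h
  · intro k hk
    rw [Finset.mem_range] at hk
    exact ⟨((t x).1.1, k), Finset.mem_filter.2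
      ⟨μ.up_left_mem le_rfl hk.le (t x).2, rfl, hk⟩, rfl⟩

theorem card_col_pairs {n : ℕ} {μ : YoungDiagram} (t : Tableau μ n) :
    (Finset.univ.filter fun p : Fin n × Fin n =>
      (t p.1).1.2 = (t p.2).1.2 ∧ (t p.2).1.1 < (t p.1).1.1).card = ∑ c ∈ μ.cells, c.1 := by
  rw [← sum_tableau t fun c => c.1, Finset.card_filter, Fintype.sum_prod_type]
  refine Finset.sum_congr rfl fun x _ => ?_
  rw [← Finset.card_filter]
  refine (card_filter_cells t fun c => (t x).1.2 = c.2 ∧ c.1 < (t x).1.1).trans ?_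
  conv_rhs => rw [← Finset.card_range (t x).1.1]
  refine Finset.card_bij (fun c _ => c.1) ?_ ?_ ?_
  · intro c hc
    simpa using (Finset.mem_filter.1 hc).2.2
  · intro c hc c' hc' h
    exact Prod.ext h ((Finset.mem_filter.1 hc).2.1.symm.trans (Finset.mem_filter.1 hc').2.1)
  · intro k hk
    rw [Finset.mem_range] at hk
    exact ⟨(k, (t x).1.2), Finset.mem_filter.2
      ⟨μ.up_left_mem hk.le le_rfl (t x).2, rfl, hk⟩, rfl⟩

/-- Transpositions within a row contribute `1`, within a column `-1`, and all others `0`. Orienting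
each pair so that its first entry is farther right, or farther down, counts it once: a node has as
many partners as there are nodes to its left, or above it. -/
theorem sum_conjClass_swap {n : ℕ} {μ : YoungDiagram} (t : Tableau μ n) {i j : Fin n}
    (hij : i ≠ j) :
    ∑ h ∈ conjClass (Equiv.swap i j), polytabloid t (tabloid t ∘ ⇑h) =
      ((∑ c ∈ μ.cells, c.2 : ℕ) : ℚ) - ((∑ c ∈ μ.cells, c.1 : ℕ) : ℚ) := by
  classical
  set R := Finset.univ.filter fun p : Fin n × Fin n =>
      (t p.1).1.1 = (t p.2).1.1 ∧ (t p.2).1.2 < (t p.1).1.2 with hR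
  set C := Finset.univ.filter fun p : Fin n × Fin n =>
      (t p.1).1.2 = (t p.2).1.2 ∧ (t p.2).1.1 < (t p.1).1.1 with hC
  have hmR : ∀ p, p ∈ R ↔ (t p.1).1.1 = (t p.2).1.1 ∧ (t p.2).1.2 < (t p.1).1.2 := by
    intro p; simp [hR]
  have hmC : ∀ p, p ∈ C ↔ (t p.1).1.2 = (t p.2).1.2 ∧ (t p.2).1.1 < (t p.1).1.1 := by
    intro p; simp [hC]
  have hRC : Disjoint R C := by
    rw [Finset.disjoint_left]
    intro p h1 h2
    rw [hmR] at h1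
    rw [hmC] at h2
    omega
  have hne : ∀ p ∈ R ∪ C, p.1 ≠ p.2 := by
    intro p hp h
    rw [Finset.mem_union, hmR, hmC, h] at hp
    omega
  have h1 : ∑ p ∈ R ∪ C, polytabloid t (tabloid t ∘ ⇑(Equiv.swap p.1 p.2)) =
      ∑ h ∈ conjClass (Equiv.swap i j), polytabloid t (tabloid t ∘ ⇑h) := by
    refine Finset.sum_of_injOn (fun p => Equiv.swap p.1 p.2) ?_ ?_ ?_ fun _ _ => rfl
    · intro p hp q hq h
      have hp' := hp
      have hq' := hq
      rw [Finset.mem_coe, Finset.mem_union, hmR, hmC] at hp' hq'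
      rcases swap_eq_swap (hne p hp) h with ⟨h1, h2⟩ | ⟨h1, h2⟩
      · exact Prod.ext h1 h2
      · rw [h1, h2] at hp'
        omega
    · intro p hp
      exact mem_conjClass.2 (Equiv.Perm.isConj_swap hij (hne p hp))
    · intro h hh hn
      obtain ⟨x, y, hxy, rfl⟩ := (isConj_swap_iff hij).1 (mem_conjClass.1 hh)
      have hmem : ∀ a b, (a, b) ∈ R ∪ C → Equiv.swap x y ≠ Equiv.swap a b := by
        intro a b hab he
        exact hn ⟨(a, b), hab, he.symm⟩
      have h1 : ¬ ((t x).1.1 = (t y).1.1 ∧ (t y).1.2 < (t x).1.2) := fun h =>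
        hmem x y (Finset.mem_union_left _ ((hmR (x, y)).2 h)) rfl
      have h2 : ¬ ((t x).1.2 = (t y).1.2 ∧ (t y).1.1 < (t x).1.1) := fun h =>
        hmem x y (Finset.mem_union_right _ ((hmC (x, y)).2 h)) rfl
      have h3 : ¬ ((t y).1.1 = (t x).1.1 ∧ (t x).1.2 < (t y).1.2) := fun h =>
        hmem y x (Finset.mem_union_left _ ((hmR (y, x)).2 h)) (Equiv.swap_comm x y)
      have h4 : ¬ ((t y).1.2 = (t x).1.2 ∧ (t x).1.1 < (t y).1.1) := fun h =>
        hmem y x (Finset.mem_union_right _ ((hmC (y, x)).2 h)) (Equiv.swap_comm x y)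
      have h5 : ¬ ((t x).1.1 = (t y).1.1 ∧ (t x).1.2 = (t y).1.2) := fun h =>
        hxy (t.injective (Subtype.ext (Prod.ext h.1 h.2)))
      exact polytabloid_swap_other t (by omega) (by omega)
  rw [← h1, Finset.sum_union hRC]
  have h2 : ∀ p ∈ R, polytabloid t (tabloid t ∘ ⇑(Equiv.swap p.1 p.2)) = 1 := fun p hp =>
    polytabloid_swap_row t ((hmR p).1 hp).1
  have h3 : ∀ p ∈ C, polytabloid t (tabloid t ∘ ⇑(Equiv.swap p.1 p.2)) = -1 := fun p hp =>
    polytabloid_swap_col t (hne p (Finset.mem_union_right _ hp)) ((hmC p).1 hp).1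
  rw [Finset.sum_congr rfl h2, Finset.sum_congr rfl h3, Finset.sum_const, Finset.sum_const,
    ← card_row_pairs t, ← card_col_pairs t, ← hR, ← hC]
  simp [sub_eq_add_neg]

/-- The class sum of the transpositions acts on the Specht module as a scalar, the sum of the
contents; comparing traces gives the central character. -/
theorem centralChar_swap {n : ℕ} (μ : Ptn n) {i j : Fin n} (hij : i ≠ j) :
    centralChar (spechtChar n μ.1) (Equiv.swap i j) =
      ((∑ c ∈ μ.1.cells, c.2 : ℕ) : ℚ) - ((∑ c ∈ μ.1.cells, c.1 : ℕ) : ℚ) := by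
  set a := ((∑ c ∈ μ.1.cells, c.2 : ℕ) : ℚ) - ((∑ c ∈ μ.1.cells, c.1 : ℕ) : ℚ) with ha
  set g := Equiv.swap i j with hg
  have h1 : ∑ h ∈ conjClass g, spechtRep n μ.1 h = a • LinearMap.id := by
    apply LinearMap.ext_on_range (span_polyt μ.1 n)
    intro t
    apply Subtype.ext
    rw [LinearMap.sum_apply, Submodule.coe_sum]
    have h2 := classSum_polytabloid t g
    rw [sum_conjClass_swap t hij, ← ha, classSum_apply] at h2
    exact h2
  have h3 := congrArg (LinearMap.trace ℚ (spechtModule n μ.1).toSubmodule) h1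
  rw [map_sum, map_smul] at h3
  have h4 : ∀ h ∈ conjClass g, LinearMap.trace ℚ (spechtModule n μ.1).toSubmodule
      (spechtRep n μ.1 h) = spechtChar n μ.1 g := fun h hh =>
    (specht_mem_classFun n μ.1 _ _ (mem_conjClass.1 hh)).symm
  rw [Finset.sum_congr rfl h4, Finset.sum_const, nsmul_eq_mul] at h3
  have h5 : LinearMap.trace ℚ (spechtModule n μ.1).toSubmodule LinearMap.id
      = spechtChar n μ.1 1 := by
    unfold spechtChar Representation.character
    rw [map_one]
    rfl
  have h6 : spechtChar n μ.1 1 ≠ 0 := (deg_pos μ).ne'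
  rw [h5, smul_eq_mul] at h3
  unfold centralChar
  rw [div_eq_iff h6]
  exact h3

/-! ### Blocks and contents -/

theorem sum_content (μ : YoungDiagram) : (content μ).sum =
    ((((∑ c ∈ μ.cells, c.2 : ℕ) : ℤ) - ((∑ c ∈ μ.cells, c.1 : ℕ) : ℤ) : ℤ) : ZMod 2) := by
  have : (content μ).sum = ∑ c ∈ μ.cells, residue c := rfl
  rw [this]
  unfold residue
  rw [Finset.sum_sub_distrib]
  push_cast
  rfl

/-- Only the congruence at transpositions is used. It is far weaker than equality of contents, but
it suffices for partitions differing in one node. -/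
theorem SameBlock.sum_content_eq {n : ℕ} {μ ν : Ptn n}
    (h : SameBlock (spechtChar n μ.1) (spechtChar n ν.1)) :
    (content μ.1).sum = (content ν.1).sum := by
  rcases Nat.lt_or_ge 1 n with hn | hn
  · have hij : (⟨0, by omega⟩ : Fin n) ≠ ⟨1, hn⟩ := by simp
    obtain ⟨k, hk⟩ := h (Equiv.swap ⟨0, by omega⟩ ⟨1, hn⟩)
    rw [centralChar_swap μ hij, centralChar_swap ν hij] at hk
    rw [sum_content, sum_content, ← sub_eq_zero, ← Int.cast_sub]
    have h2 : (((∑ c ∈ μ.1.cells, c.2 : ℕ) : ℤ) - ((∑ c ∈ μ.1.cells, c.1 : ℕ) : ℤ)) -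
        (((∑ c ∈ ν.1.cells, c.2 : ℕ) : ℤ) - ((∑ c ∈ ν.1.cells, c.1 : ℕ) : ℤ)) = 2 * k := by
      exact_mod_cast hk
    rw [h2, Int.cast_mul]
    have : ((2 : ℤ) : ZMod 2) = 0 := rfl
    rw [this, zero_mul]
  · have h0 : ∀ μ : Ptn n, (content μ.1).sum = 0 := by
      intro μ
      refine Finset.sum_eq_zero fun c hc => ?_
      have h1 := mem_lt_card μ.1 hc
      rw [μ.2] at h1
      have h2 : c.1 = 0 := by omega
      have h3 : c.2 = 0 := by omega
      simp [residue, h2, h3]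
    rw [h0, h0]

theorem SameBlock.refl {n : ℕ} (χ : Equiv.Perm (Fin n) → ℚ) : SameBlock χ χ := fun g =>
  ⟨0, by simp⟩

theorem AddsNode.content_eq {x y : YoungDiagram} {c : ℕ × ℕ} (h : AddsNode x y c) :
    content y = residue c ::ₘ content x := by
  unfold content
  rw [h.2, Finset.insert_val_of_notMem h.1, Multiset.map_cons]

theorem card_content (μ : YoungDiagram) : (content μ).card = μ.card := by
  unfold content
  rw [Multiset.card_map]
  rfl

/-- `y` is obtained from `x` by adding a node of residue `ε`. -/
def Covers (ε : ZMod 2) (x y : YoungDiagram) : Prop :=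
  x ≤ y ∧ content y = ε ::ₘ content x

theorem Covers.card {ε : ZMod 2} {x y : YoungDiagram} (h : Covers ε x y) :
    y.card = x.card + 1 := by
  rw [← card_content, h.2, Multiset.card_cons, card_content]

theorem covers_iff {ε : ZMod 2} {x y : YoungDiagram} :
    Covers ε x y ↔ ∃ c, AddsNode x y c ∧ residue c = ε := by
  constructor
  · intro h
    obtain ⟨c, hc⟩ := exists_addsNode h.1 h.card
    refine ⟨c, hc, ?_⟩
    have := h.2
    rw [hc.content_eq] at this
    exact (Multiset.cons_inj_left _).1 this
  · rintro ⟨c, hc, rfl⟩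
    exact ⟨hc.le, hc.content_eq⟩

theorem inBlock_down {n : ℕ} {ε : ZMod 2} {μ : Ptn (n + 1)} {ρ : Ptn n} (hle : ρ.1 ≤ μ.1)
    (hε : ε ∈ content μ.1) :
    InBlock n ((content μ.1).erase ε) ρ.1 ↔ Covers ε ρ.1 μ.1 := by
  constructor
  · rintro ⟨ν, hν, hs⟩
    obtain ⟨i, j, hc⟩ := exists_addsNode_ptn hle
    have h1 := hs.sum_content_eq
    rw [hν] at h1
    have h2 : (content μ.1).sum = residue (i, j) + (content ρ.1).sum := by
      rw [hc.content_eq, Multiset.sum_cons]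
    have h3 : (content μ.1).sum = ε + ((content μ.1).erase ε).sum := by
      rw [← Multiset.sum_cons, Multiset.cons_erase hε]
    rw [h1] at h2
    exact covers_iff.2 ⟨_, hc, add_right_cancel (h2.symm.trans h3)⟩
  · intro h
    refine ⟨ρ, ?_, SameBlock.refl _⟩
    rw [h.2, Multiset.erase_cons_head]

theorem inBlock_up {n : ℕ} {ε : ZMod 2} {ρ : Ptn n} {μ : Ptn (n + 1)} (hle : ρ.1 ≤ μ.1) :
    InBlock (n + 1) (ε ::ₘ content ρ.1) μ.1 ↔ Covers ε ρ.1 μ.1 := by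
  constructor
  · rintro ⟨ν, hν, hs⟩
    obtain ⟨i, j, hc⟩ := exists_addsNode_ptn hle
    have h1 := hs.sum_content_eq
    rw [hν, hc.content_eq, Multiset.sum_cons, Multiset.sum_cons] at h1
    exact covers_iff.2 ⟨_, hc, add_right_cancel h1⟩
  · exact fun h => ⟨μ, h.2, SameBlock.refl _⟩

/-! ### The functions `e_ε` and `f_ε` on Specht characters -/

open Classical in
/-- The diagrams with `m` nodes. -/
def diagrams (m : ℕ) : Finset YoungDiagram :=
  (Finset.univ : Finset (Ptn m)).image fun μ => μ.1

theorem mem_diagrams {m : ℕ} {x : YoungDiagram} : x ∈ diagrams m ↔ x.card = m := by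
  classical
  unfold diagrams
  rw [Finset.mem_image]
  constructor
  · rintro ⟨μ, -, rfl⟩; exact μ.2
  · intro h; exact ⟨⟨x, h⟩, Finset.mem_univ _, rfl⟩

open Classical in
theorem sum_diagrams {M : Type*} [AddCommMonoid M] (m : ℕ) (v : YoungDiagram → M) :
    ∑ x ∈ diagrams m, v x = ∑ μ : Ptn m, v μ.1 := by
  unfold diagrams
  exact Finset.sum_image fun μ _ ν _ h => Ptn.ext h

open Classical in
/-- The diagrams obtained by removing a node of residue `ε`. -/
def lower (ε : ZMod 2) (y : YoungDiagram) : Finset YoungDiagram :=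
  (diagrams (y.card - 1)).filter fun x => Covers ε x y

open Classical in
/-- The diagrams obtained by adding a node of residue `ε`. -/
def upper (ε : ZMod 2) (x : YoungDiagram) : Finset YoungDiagram :=
  (diagrams (x.card + 1)).filter fun y => Covers ε x y

theorem mem_lower {ε : ZMod 2} {x y : YoungDiagram} : x ∈ lower ε y ↔ Covers ε x y := by
  classical
  unfold lower
  rw [Finset.mem_filter, mem_diagrams, and_iff_right_iff_imp]
  intro h
  rw [h.card, Nat.add_sub_cancel]

theorem mem_upper {ε : ZMod 2} {x y : YoungDiagram} : y ∈ upper ε x ↔ Covers ε x y := by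
  classical
  unfold upper
  rw [Finset.mem_filter, mem_diagrams, and_iff_right_iff_imp]
  exact fun h => h.card

theorem specht_eq {μ : YoungDiagram} {m : ℕ} (h : μ.card = m) :
    specht μ = DirectSum.lof ℚ ℕ (fun n => Equiv.Perm (Fin n) → ℚ) m (spechtChar m μ) := by
  subst h; rfl

theorem sum_ip_smulRight {n : ℕ} {M : Type*} [AddCommMonoid M] [Module ℚ M] (μ : Ptn n)
    (v : Ptn n → M) :
    (∑ ν : Ptn n, (ipLin (spechtChar n ν.1)).smulRight (v ν)) (spechtChar n μ.1) = v μ := by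
  classical
  rw [LinearMap.sum_apply]
  simp only [LinearMap.smulRight_apply]
  have h : ∀ ν : Ptn n, ipLin (spechtChar n ν.1) (spechtChar n μ.1) = if μ = ν then 1 else 0 :=
    fun ν => ip_specht μ ν
  simp [h]

theorem e_specht (ε : ZMod 2) (y : YoungDiagram) :
    e ε (specht y) = ∑ x ∈ lower ε y, specht x := by
  classical
  obtain ⟨m, hm⟩ : ∃ m, y.card = m := ⟨_, rfl⟩
  rw [specht_eq hm, e, DirectSum.toModule_lof]
  cases m with
  | zero =>
    have : lower ε y = ∅ := by
      refine Finset.eq_empty_of_forall_notMem fun x hx => ?_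
      have := (mem_lower.1 hx).card
      omega
    rw [this, Finset.sum_empty]
    rfl
  | succ n =>
    obtain ⟨μ, rfl⟩ : ∃ μ : Ptn (n + 1), μ.1 = y := ⟨⟨y, hm⟩, rfl⟩
    unfold eDeg
    rw [LinearMap.comp_apply, sum_ip_smulRight]
    have hl : lower ε μ.1 = (diagrams n).filter fun x => Covers ε x μ.1 := by
      unfold lower
      rw [hm, Nat.add_sub_cancel]
    rw [hl, Finset.sum_filter, sum_diagrams]
    have hr : ∀ ρ : Ptn n, (if Covers ε ρ.1 μ.1 then specht ρ.1 else 0) =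
        DirectSum.lof ℚ ℕ (fun n => Equiv.Perm (Fin n) → ℚ) n
          (if Covers ε ρ.1 μ.1 then spechtChar n ρ.1 else 0) := by
      intro ρ
      split_ifs
      · exact specht_eq ρ.2
      · rw [map_zero]
    rw [Finset.sum_congr rfl fun ρ _ => hr ρ, ← map_sum]
    congr 1
    unfold eIrr
    split_ifs with hε
    · unfold blockComponent
      refine Finset.sum_congr rfl fun ρ _ => ?_
      rw [ip_res_specht]
      by_cases hle : ρ.1 ≤ μ.1
      · simp only [inBlock_down hle hε, if_pos hle, one_smul]
      · rw [if_neg hle, if_neg (fun h : Covers ε ρ.1 μ.1 => hle h.1), zero_smul, ite_self]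
    · symm
      refine Finset.sum_eq_zero fun ρ _ => if_neg fun h => hε ?_
      rw [h.2]
      exact Multiset.mem_cons_self _ _

theorem f_specht (ε : ZMod 2) (x : YoungDiagram) :
    f ε (specht x) = ∑ y ∈ upper ε x, specht y := by
  classical
  obtain ⟨n, hn⟩ : ∃ m, x.card = m := ⟨_, rfl⟩
  obtain ⟨ρ, rfl⟩ : ∃ ρ : Ptn n, ρ.1 = x := ⟨⟨x, hn⟩, rfl⟩
  rw [specht_eq hn, f, DirectSum.toModule_lof]
  unfold fDeg
  rw [LinearMap.comp_apply, sum_ip_smulRight]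
  unfold upper
  rw [hn, Finset.sum_filter, sum_diagrams]
  have hr : ∀ μ : Ptn (n + 1), (if Covers ε ρ.1 μ.1 then specht μ.1 else 0) =
      DirectSum.lof ℚ ℕ (fun n => Equiv.Perm (Fin n) → ℚ) (n + 1)
        (if Covers ε ρ.1 μ.1 then spechtChar (n + 1) μ.1 else 0) := by
    intro μ
    split_ifs
    · exact specht_eq μ.2
    · rw [map_zero]
  rw [Finset.sum_congr rfl fun μ _ => hr μ, ← map_sum]
  congr 1
  unfold fIrr blockComponent
  refine Finset.sum_congr rfl fun μ _ => ?_
  rw [ip_ind_specht]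
  by_cases hle : ρ.1 ≤ μ.1
  · simp only [inBlock_up hle, if_pos hle, one_smul]
  · rw [if_neg hle, if_neg (fun h : Covers ε ρ.1 μ.1 => hle h.1), zero_smul, ite_self]

/-! ### Maya diagrams -/

/-- The Maya diagram of a partition: the positions `μ_i - i` for `i ≥ 1`. -/
def maya (μ : YoungDiagram) : Set ℤ := Set.range fun i : ℕ => (μ.rowLen i : ℤ) - i - 1

theorem strictAnti_rows (μ : YoungDiagram) :
    StrictAnti fun i : ℕ => (μ.rowLen i : ℤ) - i - 1 := by
  apply strictAnti_nat_of_succ_lt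
  intro i
  have := μ.rowLen_anti i (i + 1) (by omega)
  push_cast
  omega

theorem strictAnti_range_inj {u v : ℕ → ℤ} (hu : StrictAnti u) (hv : StrictAnti v)
    (h : Set.range u = Set.range v) : u = v := by
  have hu' : StrictMono fun i => OrderDual.toDual (u i) := fun i j hij => hu hij
  have hv' : StrictMono fun i => OrderDual.toDual (v i) := fun i j hij => hv hij
  exact (StrictMono.range_inj hu' hv').1 h

theorem maya_injective : Function.Injective maya := by
  intro μ ν h
  have := strictAnti_range_inj (strictAnti_rows μ) (strictAnti_rows ν) h
  apply ext_rowLen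
  intro i
  have := congrFun this i
  omega

theorem mem_maya {μ : YoungDiagram} {z : ℤ} : z ∈ maya μ ↔ ∃ i : ℕ, (μ.rowLen i : ℤ) - i - 1 = z :=
  Iff.rfl

/-- Move the beads of `S` down by one position. -/
def shift (M : Set ℤ) (S : Finset ℤ) : Set ℤ := {z | (z ∈ M ∧ z ∉ S) ∨ z + 1 ∈ S}

/-- The content of the last node of row `i` is the position of the `i`-th bead, so removing a node
of content `c` moves the bead at `c` to `c - 1`. -/
theorem AddsNode.maya {x y : YoungDiagram} {i j : ℕ} (h : AddsNode x y (i, j)) :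
    (j : ℤ) - i ∈ maya y ∧ (j : ℤ) - i - 1 ∉ maya y ∧ maya x = shift (maya y) {(j : ℤ) - i} := by
  obtain ⟨h1, h2, h3⟩ := h.rowLen
  have hx := strictAnti_rows x
  have hy := strictAnti_rows y
  have hi : (j : ℤ) - i ∈ SymChar.maya y := ⟨i, by simp only [h2]; push_cast; ring⟩
  have hn : (j : ℤ) - i - 1 ∉ SymChar.maya y := by
    rintro ⟨k, hk⟩
    simp only at hk
    by_cases hki : k = i
    · subst hki; omega
    · rw [h3 k hki] at hk
      exact hki (hx.injective (by omega))
  refine ⟨hi, hn, ?_⟩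
  ext z
  simp only [shift, Finset.mem_singleton, Set.mem_ofPred_eq]
  constructor
  · rintro ⟨k, rfl⟩
    by_cases hki : k = i
    · right; subst hki; simp only; omega
    · left
      refine ⟨⟨k, by simp only [h3 k hki]⟩, fun he => hki (hy.injective ?_)⟩
      simp only [h3 k hki] at he ⊢
      omega
  · rintro (⟨⟨k, rfl⟩, hk⟩ | hz)
    · refine ⟨k, ?_⟩
      have hki : k ≠ i := by
        rintro rfl
        simp only at hk
        omega
      simp only [h3 k hki]
    · exact ⟨i, by simp only; omega⟩

theorem exists_addsNode_of_maya {y : YoungDiagram} {c : ℤ} (h1 : c ∈ maya y)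
    (h2 : c - 1 ∉ maya y) : ∃ x, ∃ i j : ℕ, AddsNode x y (i, j) ∧ (j : ℤ) - i = c := by
  obtain ⟨i, hi⟩ := h1
  simp only at hi
  have hlt : y.rowLen (i + 1) < y.rowLen i := by
    have := y.rowLen_anti i (i + 1) (by omega)
    by_contra hge
    apply h2
    refine ⟨i + 1, ?_⟩
    have : y.rowLen (i + 1) = y.rowLen i := by omega
    simp only [this]
    push_cast
    omega
  obtain ⟨x, hx⟩ := exists_remove_row y i hlt
  exact ⟨x, i, _, hx, by omega⟩

/-- The beads of parity `p` which can be moved down by one position. -/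
def removable (p : ℤ) (y : YoungDiagram) : Set ℤ :=
  {c | c ∈ maya y ∧ c - 1 ∉ maya y ∧ c % 2 = p % 2}

theorem removable_finite (p : ℤ) (y : YoungDiagram) : (removable p y).Finite := by
  refine ((Finset.range y.card).finite_toSet.image
    fun i : ℕ => (y.rowLen i : ℤ) - i - 1).subset ?_
  rintro c ⟨h1, h2, -⟩
  obtain ⟨x, i, j, hx, rfl⟩ := exists_addsNode_of_maya h1 h2
  refine ⟨i, Finset.mem_coe.2 (Finset.mem_range.2 hx.lt_card), ?_⟩
  simp only [hx.rowLen.2.1]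
  push_cast
  ring

/-- The removable beads as a finite set. -/
def removables (p : ℤ) (y : YoungDiagram) : Finset ℤ := (removable_finite p y).toFinset

theorem mem_removables {p : ℤ} {y : YoungDiagram} {c : ℤ} :
    c ∈ removables p y ↔ c ∈ maya y ∧ c - 1 ∉ maya y ∧ c % 2 = p % 2 := by
  rw [removables, Set.Finite.mem_toFinset]
  rfl

open Classical in
/-- The diagram whose Maya diagram is obtained by moving down the beads of `S`. -/
def remove (y : YoungDiagram) (S : Finset ℤ) : YoungDiagram :=
  if h : ∃ x, maya x = shift (maya y) S then h.choose else y

theorem maya_remove {y : YoungDiagram} {S : Finset ℤ} (h : ∃ x, maya x = shift (maya y) S) :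
    maya (remove y S) = shift (maya y) S := by
  rw [remove, dif_pos h]
  exact h.choose_spec

theorem remove_eq {x y : YoungDiagram} {S : Finset ℤ} (h : maya x = shift (maya y) S) :
    remove y S = x := maya_injective ((maya_remove ⟨x, h⟩).trans h.symm)

theorem shift_empty (M : Set ℤ) : shift M ∅ = M := by
  ext z; simp [shift]

/-- Beads of one parity land on positions of the other parity, so successive moves do not interfere
and amount to a simultaneous one. -/
theorem shift_insert {M : Set ℤ} {S : Finset ℤ} {c p : ℤ} (hc : c % 2 = p % 2)
    (hS : ∀ z ∈ S, z % 2 = p % 2) : shift (shift M {c}) S = shift M (insert c S) := by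
  ext z
  have h1 : z + 1 = c → z ∉ S := fun h hz => by have := hS z hz; omega
  simp only [shift, Finset.mem_insert, Finset.mem_singleton, Set.mem_ofPred_eq]
  tauto

theorem removables_of_shift {x y : YoungDiagram} {p c : ℤ} (hc : c ∈ removables p y)
    (h : maya x = shift (maya y) {c}) : removables p x = (removables p y).erase c := by
  have hc' := mem_removables.1 hc
  ext z
  simp only [Finset.mem_erase, mem_removables, h, shift, Finset.mem_singleton, Set.mem_ofPred_eq]
  have h1 : z + 1 = c → z % 2 ≠ p % 2 := fun h => by omega
  have h2 : z - 1 = c → z % 2 ≠ p % 2 := fun h => by omega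
  have h3 : z - 1 + 1 = c ↔ z = c := by omega
  rw [h3]
  tauto

theorem remove_spec {p : ℤ} {y : YoungDiagram} {S : Finset ℤ} (hS : S ⊆ removables p y) :
    maya (remove y S) = shift (maya y) S ∧
      content y = Multiset.replicate S.card (p : ZMod 2) + content (remove y S) := by
  induction S using Finset.induction_on generalizing y with
  | empty =>
    have h : remove y ∅ = y := remove_eq (shift_empty _).symm
    rw [h, shift_empty]
    simp
  | insert c S hcS ih =>
    have hc := hS (Finset.mem_insert_self c S)
    obtain ⟨hc1, hc2, hc3⟩ := mem_removables.1 hc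
    obtain ⟨x, i, j, hx, hij⟩ := exists_addsNode_of_maya hc1 hc2
    have hm := hx.maya.2.2
    rw [hij] at hm
    have hSx : S ⊆ removables p x := by
      rw [removables_of_shift hc hm]
      intro z hz
      exact Finset.mem_erase.2 ⟨fun h => hcS (h ▸ hz), hS (Finset.mem_insert_of_mem hz)⟩
    obtain ⟨h1, h2⟩ := ih hSx
    have h3 : shift (maya x) S = shift (maya y) (insert c S) := by
      rw [hm]
      exact shift_insert hc3 fun z hz => (mem_removables.1 (hSx hz)).2.2
    have h4 : remove y (insert c S) = remove x S := remove_eq (h1.trans h3)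
    refine ⟨by rw [h4, h1, h3], ?_⟩
    rw [h4, hx.content_eq, h2, Finset.card_insert_of_notMem hcS, Multiset.replicate_succ,
      Multiset.cons_add]
    congr 1
    have : ((j : ℤ) - i : ℤ) % 2 = p % 2 := by rw [hij]; exact hc3
    have h5 := (ZMod.intCast_eq_intCast_iff' ((j : ℤ) - i) p 2).2 this
    rw [← h5]
    simp [residue]

theorem remove_remove {p : ℤ} {y : YoungDiagram} {S : Finset ℤ} {c : ℤ}
    (hc : c ∈ removables p y) (hS : S ⊆ (removables p y).erase c) :
    remove (remove y {c}) S = remove y (insert c S) := by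
  have h1 := (remove_spec (Finset.singleton_subset_iff.2 hc)).1
  have hS' : S ⊆ removables p (remove y {c}) := by
    rw [removables_of_shift hc h1]; exact hS
  symm
  apply remove_eq
  rw [(remove_spec hS').1, h1]
  exact shift_insert (mem_removables.1 hc).2.2 fun z hz => (mem_removables.1 (hS' hz)).2.2

theorem sum_lower {M : Type*} [AddCommMonoid M] (p : ℤ) (y : YoungDiagram)
    (v : YoungDiagram → M) :
    ∑ x ∈ lower (p : ZMod 2) y, v x = ∑ c ∈ removables p y, v (remove y {c}) := by
  symm
  refine Finset.sum_bij (fun c _ => remove y {c}) ?_ ?_ ?_ fun _ _ => rfl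
  · intro c hc
    obtain ⟨hc1, hc2, hc3⟩ := mem_removables.1 hc
    obtain ⟨x, i, j, hx, hij⟩ := exists_addsNode_of_maya hc1 hc2
    have hm := hx.maya.2.2
    rw [hij] at hm
    rw [remove_eq hm, mem_lower, covers_iff]
    refine ⟨_, hx, ?_⟩
    rw [← hij] at hc3
    rw [← (ZMod.intCast_eq_intCast_iff' ((j : ℤ) - i) p 2).2 hc3]
    simp [residue]
  · intro c hc c' hc' h
    have h1 := congrArg maya h
    rw [(remove_spec (Finset.singleton_subset_iff.2 hc)).1,
      (remove_spec (Finset.singleton_subset_iff.2 hc')).1] at h1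
    by_contra hne
    have h2 : c' ∈ shift (maya y) {c} := by
      left
      exact ⟨(mem_removables.1 hc').1, by simpa using fun h => hne h.symm⟩
    rw [h1] at h2
    rcases h2 with ⟨-, h2⟩ | h2
    · simp at h2
    · simp at h2
  · intro x hx
    obtain ⟨⟨i, j⟩, hc, hr⟩ := covers_iff.1 (mem_lower.1 hx)
    refine ⟨(j : ℤ) - i, mem_removables.2 ⟨hc.maya.1, hc.maya.2.1, ?_⟩, remove_eq hc.maya.2.2⟩
    apply (ZMod.intCast_eq_intCast_iff' ((j : ℤ) - i) p 2).1
    rw [← hr]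
    simp [residue]

/-! ### The operators on formal sums of diagrams -/

/-- Formal sums of partitions. -/
abbrev Fock : Type := YoungDiagram →₀ ℚ

/-- `e_ε` on formal sums of partitions. -/
def eF (ε : ZMod 2) : Module.End ℚ Fock :=
  Finsupp.linearCombination ℚ fun y => ∑ x ∈ lower ε y, Finsupp.single x 1

/-- `f_ε` on formal sums of partitions. -/
def fF (ε : ZMod 2) : Module.End ℚ Fock :=
  Finsupp.linearCombination ℚ fun x => ∑ y ∈ upper ε x, Finsupp.single y 1

theorem eF_single (ε : ZMod 2) (y : YoungDiagram) :
    eF ε (Finsupp.single y 1) = ∑ x ∈ lower ε y, Finsupp.single x 1 := by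
  rw [eF, Finsupp.linearCombination_single, one_smul]

theorem fF_single (ε : ZMod 2) (x : YoungDiagram) :
    fF ε (Finsupp.single x 1) = ∑ y ∈ upper ε x, Finsupp.single y 1 := by
  rw [fF, Finsupp.linearCombination_single, one_smul]

/-- The Specht characters as a linear map on formal sums of partitions. -/
def spechtLin : Fock →ₗ[ℚ] Gr := Finsupp.linearCombination ℚ specht

theorem spechtLin_single (y : YoungDiagram) : spechtLin (Finsupp.single y 1) = specht y := by
  rw [spechtLin, Finsupp.linearCombination_single, one_smul]

theorem e_spechtLin (ε : ZMod 2) (v : Fock) : e ε (spechtLin v) = spechtLin (eF ε v) := by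
  have h : e ε ∘ₗ spechtLin = spechtLin ∘ₗ eF ε := by
    refine Finsupp.lhom_ext' fun y => LinearMap.ext_ring ?_
    simp only [LinearMap.comp_apply, Finsupp.lsingle_apply]
    rw [spechtLin_single, e_specht, eF_single, map_sum]
    exact Finset.sum_congr rfl fun x _ => (spechtLin_single x).symm
  exact LinearMap.congr_fun h v

theorem f_spechtLin (ε : ZMod 2) (v : Fock) : f ε (spechtLin v) = spechtLin (fF ε v) := by
  have h : f ε ∘ₗ spechtLin = spechtLin ∘ₗ fF ε := by
    refine Finsupp.lhom_ext' fun y => LinearMap.ext_ring ?_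
    simp only [LinearMap.comp_apply, Finsupp.lsingle_apply]
    rw [spechtLin_single, f_specht, fF_single, map_sum]
    exact Finset.sum_congr rfl fun x _ => (spechtLin_single x).symm
  exact LinearMap.congr_fun h v

/-- Divided powers of operators on formal sums of partitions. -/
def divPowF (T : Module.End ℚ Fock) (k : ℕ) : Module.End ℚ Fock := (k ! : ℚ)⁻¹ • T ^ k

theorem divPow_spechtLin {T : Module.End ℚ Gr} {T' : Module.End ℚ Fock}
    (h : ∀ v, T (spechtLin v) = spechtLin (T' v)) (k : ℕ) (v : Fock) :
    divPow T k (spechtLin v) = spechtLin (divPowF T' k v) := by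
  have hp : ∀ v, (T ^ k) (spechtLin v) = spechtLin ((T' ^ k) v) := by
    induction k with
    | zero => intro v; rfl
    | succ k ih => intro v; rw [pow_succ, pow_succ, Module.End.mul_apply, Module.End.mul_apply,
        h, ih]
  rw [divPow, divPowF, LinearMap.smul_apply, LinearMap.smul_apply, map_smul, hp]

theorem dot_fF (ε : ZMod 2) (v u : Fock) : dot v (fF ε u) = dot (eF ε v) u := by
  classical
  have h : ∀ x y : YoungDiagram, dot (Finsupp.single y 1) (fF ε (Finsupp.single x 1)) =
      dot (eF ε (Finsupp.single y 1)) (Finsupp.single x 1) := by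
    intro x y
    rw [fF_single, eF_single, dot_comm, dot_single, dot_single, Finsupp.finsetSum_apply,
      Finsupp.finsetSum_apply]
    simp only [Finsupp.single_apply, Finset.sum_ite_eq', mem_upper, mem_lower]
  induction u using Finsupp.induction_linear with
  | zero => simp
  | add u u' hu hu' => rw [map_add, map_add, map_add, hu, hu']
  | single x a =>
    rw [← mul_one a, ← smul_eq_mul, ← Finsupp.smul_single, map_smul, map_smul, map_smul]
    congr 1
    rw [dot_comm, dot_comm _ (Finsupp.single x 1)]
    induction v using Finsupp.induction_linear with
    | zero => simp
    | add v v' hv hv' => rw [map_add, map_add, map_add, hv, hv']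
    | single y b =>
      rw [← mul_one b, ← smul_eq_mul, ← Finsupp.smul_single, map_smul, map_smul, map_smul]
      congr 1
      rw [dot_comm, dot_comm (Finsupp.single x 1), h]

theorem dot_divPowF_fF (ε : ZMod 2) (k : ℕ) (v u : Fock) :
    dot v (divPowF (fF ε) k u) = dot (divPowF (eF ε) k v) u := by
  have hp : ∀ v u, dot v ((fF ε ^ k) u) = dot ((eF ε ^ k) v) u := by
    induction k with
    | zero => intro v u; rfl
    | succ k ih =>
      intro v u
      rw [pow_succ', pow_succ, Module.End.mul_apply, Module.End.mul_apply, dot_fF, ih]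
  rw [divPowF, divPowF, LinearMap.smul_apply, LinearMap.smul_apply, map_smul, hp,
    dot_comm ((_ : ℚ) • _), map_smul, dot_comm u]

/-- Each set of size `k + 1` arises once for each choice of a distinguished element. -/
theorem sum_insert_powersetCard {M : Type*} [AddCommMonoid M] (R : Finset ℤ) (k : ℕ)
    (g : Finset ℤ → M) :
    ∑ c ∈ R, ∑ S ∈ (R.erase c).powersetCard k, g (insert c S) =
      (k + 1) • ∑ S ∈ R.powersetCard (k + 1), g S := by
  have h : (k + 1) • ∑ S ∈ R.powersetCard (k + 1), g S =
      ∑ S ∈ R.powersetCard (k + 1), ∑ _c ∈ S, g S := by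
    rw [Finset.smul_sum]
    refine Finset.sum_congr rfl fun S hS => ?_
    rw [Finset.sum_const, (Finset.mem_powersetCard.1 hS).2]
  rw [h, Finset.sum_sigma', Finset.sum_sigma']
  refine Finset.sum_bij' (fun q _ => ⟨insert q.1 q.2, q.1⟩) (fun q _ => ⟨q.2, q.1.erase q.2⟩)
    ?_ ?_ ?_ ?_ ?_
  · rintro ⟨c, S⟩ hq
    obtain ⟨hc, hS⟩ := Finset.mem_sigma.1 hq
    obtain ⟨h1, h2⟩ := Finset.mem_powersetCard.1 hS
    have hcS : c ∉ S := fun h => (Finset.mem_erase.1 (h1 h)).1 rfl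
    refine Finset.mem_sigma.2 ⟨Finset.mem_powersetCard.2 ⟨?_, ?_⟩, Finset.mem_insert_self _ _⟩
    · exact Finset.insert_subset hc (h1.trans (Finset.erase_subset _ _))
    · rw [Finset.card_insert_of_notMem hcS]
      exact congrArg (· + 1) h2
  · rintro ⟨S, c⟩ hq
    obtain ⟨hS, hc⟩ := Finset.mem_sigma.1 hq
    obtain ⟨h1, h2⟩ := Finset.mem_powersetCard.1 hS
    refine Finset.mem_sigma.2 ⟨h1 hc, Finset.mem_powersetCard.2 ⟨?_, ?_⟩⟩
    · exact Finset.erase_subset_erase _ h1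
    · rw [Finset.card_erase_of_mem hc]
      change S.card = k + 1 at h2
      change S.card - 1 = k
      omega
  · rintro ⟨c, S⟩ hq
    obtain ⟨hc, hS⟩ := Finset.mem_sigma.1 hq
    obtain ⟨h1, h2⟩ := Finset.mem_powersetCard.1 hS
    have hcS : c ∉ S := fun h => (Finset.mem_erase.1 (h1 h)).1 rfl
    simp [Finset.erase_insert hcS]
  · rintro ⟨S, c⟩ hq
    obtain ⟨hS, hc⟩ := Finset.mem_sigma.1 hq
    simp [Finset.insert_erase hc]
  · rintro ⟨c, S⟩ _
    rfl

/-- The beads of a set of size `k` can be moved in `k !` orders, all with the same result; the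
divided power removes this factor. -/
theorem eF_pow_single (p : ℤ) (k : ℕ) (y : YoungDiagram) :
    (eF (p : ZMod 2) ^ k) (Finsupp.single y 1) =
      (k ! : ℚ) • ∑ S ∈ (removables p y).powersetCard k, Finsupp.single (remove y S) 1 := by
  induction k generalizing y with
  | zero =>
    rw [Finset.powersetCard_zero, Finset.sum_singleton, remove_eq (shift_empty _).symm]
    simp
  | succ k ih =>
    rw [pow_succ, Module.End.mul_apply, eF_single, sum_lower, map_sum]
    simp_rw [ih]
    rw [← Finset.smul_sum]
    have h : ∀ c ∈ removables p y,
        ∑ S ∈ (removables p (remove y {c})).powersetCard k,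
          (Finsupp.single (remove (remove y {c}) S) 1 : Fock) =
        ∑ S ∈ ((removables p y).erase c).powersetCard k,
          Finsupp.single (remove y (insert c S)) 1 := by
      intro c hc
      rw [removables_of_shift hc (remove_spec (Finset.singleton_subset_iff.2 hc)).1]
      refine Finset.sum_congr rfl fun S hS => ?_
      rw [remove_remove hc (Finset.mem_powersetCard.1 hS).1]
    rw [Finset.sum_congr rfl h,
      sum_insert_powersetCard _ _ fun S => (Finsupp.single (remove y S) 1 : Fock),
      ← Nat.cast_smul_eq_nsmul ℚ, smul_smul, Nat.factorial_succ]
    congr 1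
    push_cast
    ring

theorem divPowF_eF_single (p : ℤ) (k : ℕ) (y : YoungDiagram) :
    divPowF (eF (p : ZMod 2)) k (Finsupp.single y 1) =
      ∑ S ∈ (removables p y).powersetCard k, Finsupp.single (remove y S) 1 := by
  rw [divPowF, LinearMap.smul_apply, eF_pow_single, smul_smul,
    inv_mul_cancel₀ (Nat.cast_ne_zero.2 (Nat.factorial_ne_zero k)), one_smul]

/-! ### Simultaneous moves on one runner -/

/-- `X` is obtained from `Y` by moving the beads of `S` down by one position, each into an empty
position or into one vacated by another bead. -/
def DownBy (Y X : Set ℤ) (S : Finset ℤ) : Prop :=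
  (∀ k ∈ S, k ∈ Y ∧ (k - 1 ∉ Y ∨ k - 1 ∈ S)) ∧ X = shift Y S

/-- The comparison runs from the top down. Suppose `z` lies in `S` but not in `S'`, and the sets
agree at `z + 1`. Then `z` is still occupied in `X`, so under `S` it was refilled from `z + 1`.
Hence `z + 1` lies in `S'` as well, although under `S'` its target `z` is neither empty nor vacated.
-/
theorem DownBy.unique {Y X : Set ℤ} {S S' : Finset ℤ} (h : DownBy Y X S) (h' : DownBy Y X S') :
    S = S' := by
  have aux : ∀ {S S' : Finset ℤ}, DownBy Y X S → DownBy Y X S' → ∀ z, (z + 1 ∈ S → z + 1 ∈ S') →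
      z ∈ S → z ∈ S' := by
    intro S S' h h' z hz hS
    by_contra hS'
    have h1 : z ∈ shift Y S' := Or.inl ⟨(h.1 z hS).1, hS'⟩
    rw [← h'.2, h.2] at h1
    rcases h1 with h1 | h1
    · exact h1.2 hS
    · have h2 := (h'.1 _ (hz h1)).2
      rw [add_sub_cancel_right] at h2
      rcases h2 with h2 | h2
      · exact h2 (h.1 z hS).1
      · exact hS' h2
  obtain ⟨N, hN⟩ := (S ∪ S').bddAbove
  have key : ∀ n : ℕ, ∀ z, N - n < z → (z ∈ S ↔ z ∈ S') := by
    intro n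
    induction n with
    | zero =>
      intro z hz
      have h1 : z ∉ S := fun hz' => by
        have : z ≤ N := hN (Finset.mem_coe.2 (Finset.mem_union_left _ hz'))
        push_cast at hz; omega
      have h2 : z ∉ S' := fun hz' => by
        have : z ≤ N := hN (Finset.mem_coe.2 (Finset.mem_union_right _ hz'))
        push_cast at hz; omega
      exact iff_of_false h1 h2
    | succ n ih =>
      intro z hz
      have h1 := ih (z + 1) (by push_cast at hz; omega)
      exact ⟨aux h h' z h1.1, aux h' h z h1.2⟩
  ext z
  exact key (N - z + 1).toNat z (by omega)

theorem lt_of_descending {S : Finset ℤ} {m : ℤ} (h : ∀ z ∈ S, z ≤ m → z - 1 ∈ S) :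
    ∀ z ∈ S, m < z := by
  intro z hz
  by_contra hm
  have hne : (S.filter (· ≤ m)).Nonempty := ⟨z, Finset.mem_filter.2 ⟨hz, not_lt.1 hm⟩⟩
  obtain ⟨h1, h2⟩ := Finset.mem_filter.1 (Finset.min'_mem _ hne)
  have h3 := Finset.min'_le (S.filter (· ≤ m)) _ (Finset.mem_filter.2 ⟨h _ h1 h2, by omega⟩)
  omega

/-- In the fully occupied region a bead can move only if the one just below moves too, and so on
without end, which a finite set does not allow. -/
theorem DownBy.lt {Y X : Set ℤ} {S : Finset ℤ} {m : ℤ} (h : DownBy Y X S)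
    (hY : ∀ z < m, z ∈ Y) : ∀ z ∈ S, m < z := by
  refine lt_of_descending fun z hz hm => ?_
  rcases (h.1 z hz).2 with h1 | h1
  · exact absurd (hY _ (by omega)) h1
  · exact h1

/-! ### The two runners of a RoCK diagram -/

/-- The beads in the positions of the parity of `a + 1`. -/
def runnerP (a : ℤ) (M : Set ℤ) : Set ℤ := {z | 2 * z + 1 + a ∈ M}

/-- The gaps in the positions of the parity of `a`, read downwards. -/
def runnerQ (a : ℤ) (M : Set ℤ) : Set ℤ := {z | -(2 * z + 2 + a) ∉ M}

/-- Every bead of the parity of `a` lies below every gap of the parity of `a + 1`. -/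
def RockAt (a m : ℤ) (M : Set ℤ) : Prop :=
  (∀ z < m, z ∈ runnerP a M) ∧ ∀ z < -1 - m - a, z ∈ runnerQ a M

theorem ext_runners {a : ℤ} {M M' : Set ℤ} (hP : runnerP a M = runnerP a M')
    (hQ : runnerQ a M = runnerQ a M') : M = M' := by
  ext c
  rcases Int.even_or_odd (c - a) with ⟨k, hk⟩ | ⟨k, hk⟩
  · have h := Set.ext_iff.1 hQ (-(k + 1 + a))
    simp only [runnerQ, Set.mem_ofPred_eq, not_iff_not] at h
    have : -(2 * -(k + 1 + a) + 2 + a) = c := by omega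
    rwa [this] at h
  · have h := Set.ext_iff.1 hP k
    simp only [runnerP, Set.mem_ofPred_eq] at h
    have : 2 * k + 1 + a = c := by omega
    rwa [this] at h

/-- The beads moved in the first step. -/
def firstMoves (a : ℤ) (Sp Sq : Finset ℤ) : Finset ℤ :=
  Sp.image (fun z => 2 * z + 1 + a) ∪ Sq.image fun z => -(2 * z + 1 + a)

/-- The beads moved in the second step. -/
def secondMoves (a : ℤ) (Sp Sq : Finset ℤ) : Finset ℤ :=
  Sp.image (fun z => 2 * z + a) ∪ Sq.image fun z => -(2 * z + a)

theorem mem_firstMoves {a c : ℤ} {Sp Sq : Finset ℤ} : c ∈ firstMoves a Sp Sq ↔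
    (∃ z ∈ Sp, 2 * z + 1 + a = c) ∨ ∃ z ∈ Sq, -(2 * z + 1 + a) = c := by
  simp [firstMoves]

theorem mem_secondMoves {a c : ℤ} {Sp Sq : Finset ℤ} : c ∈ secondMoves a Sp Sq ↔
    (∃ z ∈ Sp, 2 * z + a = c) ∨ ∃ z ∈ Sq, -(2 * z + a) = c := by
  simp [secondMoves]

theorem firstMoves_odd {a z : ℤ} {Sp Sq : Finset ℤ} :
    2 * z + 1 + a ∈ firstMoves a Sp Sq ↔ z ∈ Sp ∨ -(z + 1 + a) ∈ Sq := by
  rw [mem_firstMoves]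
  refine or_congr ⟨?_, fun h => ⟨z, h, rfl⟩⟩ ⟨?_, fun h => ⟨_, h, by ring⟩⟩
  · rintro ⟨w, hw, h⟩
    rwa [show z = w by omega]
  · rintro ⟨w, hw, h⟩
    rwa [show -(z + 1 + a) = w by omega]

theorem firstMoves_even {a c : ℤ} {Sp Sq : Finset ℤ} (hc : c % 2 = a % 2) :
    c ∉ firstMoves a Sp Sq := by
  rw [mem_firstMoves]
  rintro (⟨w, hw, h⟩ | ⟨w, hw, h⟩) <;> omega

theorem secondMoves_even {a z : ℤ} {Sp Sq : Finset ℤ} :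
    2 * z + a ∈ secondMoves a Sp Sq ↔ z ∈ Sp ∨ -(z + a) ∈ Sq := by
  rw [mem_secondMoves]
  refine or_congr ⟨?_, fun h => ⟨z, h, rfl⟩⟩ ⟨?_, fun h => ⟨_, h, by ring⟩⟩
  · rintro ⟨w, hw, h⟩
    rwa [show z = w by omega]
  · rintro ⟨w, hw, h⟩
    rwa [show -(z + a) = w by omega]

theorem secondMoves_odd {a c : ℤ} {Sp Sq : Finset ℤ} (hc : c % 2 = (a + 1) % 2) :
    c ∉ secondMoves a Sp Sq := by
  rw [mem_secondMoves]
  rintro (⟨w, hw, h⟩ | ⟨w, hw, h⟩) <;> omega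

/-- The moves coming from `Sp` and those coming from `Sq` lie on opposite sides of the threshold
between the two runners, so the images are disjoint. -/
theorem card_moves {a m : ℤ} {Sp Sq : Finset ℤ} (hp : ∀ z ∈ Sp, m < z)
    (hq : ∀ z ∈ Sq, -1 - m - a < z) : (firstMoves a Sp Sq).card = Sp.card + Sq.card ∧
      (secondMoves a Sp Sq).card = Sp.card + Sq.card := by
  constructor
  · rw [firstMoves, Finset.card_union_of_disjoint, Finset.card_image_of_injective,
      Finset.card_image_of_injective]
    · intro z w h; simp only at h; omega
    · intro z w h; simp only at h; omega
    · rw [Finset.disjoint_left]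
      intro c h1 h2
      obtain ⟨z, hz, rfl⟩ := Finset.mem_image.1 h1
      obtain ⟨w, hw, h⟩ := Finset.mem_image.1 h2
      have := hp z hz
      have := hq w hw
      omega
  · rw [secondMoves, Finset.card_union_of_disjoint, Finset.card_image_of_injective,
      Finset.card_image_of_injective]
    · intro z w h; simp only at h; omega
    · intro z w h; simp only at h; omega
    · rw [Finset.disjoint_left]
      intro c h1 h2
      obtain ⟨z, hz, rfl⟩ := Finset.mem_image.1 h1
      obtain ⟨w, hw, h⟩ := Finset.mem_image.1 h2
      have := hp z hz
      have := hq w hw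
      omega

/-- A bead indexed by `Sp` drops twice, passing through an empty position of the other parity. For
`z` in `Sq` the gap at `-(2 * z + 2 + a)` is filled by the bead just above it, whose place is then
taken by the bead above that one. So the gap rises by two positions, and `z` decreases by one. -/
theorem moves_spec {a m : ℤ} {M X X' : Set ℤ} {Sp Sq : Finset ℤ} (hM : RockAt a m M)
    (hp : DownBy (runnerP a M) X Sp) (hq : DownBy (runnerQ a M) X' Sq) :
    (∀ c ∈ firstMoves a Sp Sq, c ∈ M ∧ c - 1 ∉ M ∧ c % 2 = (a + 1) % 2) ∧
    (∀ c ∈ secondMoves a Sp Sq, c ∈ shift M (firstMoves a Sp Sq) ∧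
      c - 1 ∉ shift M (firstMoves a Sp Sq) ∧ c % 2 = a % 2) ∧
    runnerP a (shift (shift M (firstMoves a Sp Sq)) (secondMoves a Sp Sq)) = X ∧
    runnerQ a (shift (shift M (firstMoves a Sp Sq)) (secondMoves a Sp Sq)) = X' := by
  have hp' := hp.lt hM.1
  have hq' := hq.lt hM.2
  -- The facts `memP` and `memQ` express that near a move on one runner the other runner is in its
  -- ground state and is left untouched.
  have memP : ∀ z, -(z + 1 + a) ∈ Sq → z ∈ runnerP a M ∧ z ∉ Sp ∧ z + 1 ∉ Sp := fun z hz => by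
    have := hq' _ hz
    exact ⟨hM.1 _ (by omega), fun h => by have := hp' _ h; omega,
      fun h => by have := hp' _ h; omega⟩
  have memQ : ∀ z, -(z + 1 + a) ∈ Sp → z ∈ runnerQ a M ∧ z ∉ Sq ∧ z + 1 ∉ Sq := fun z hz => by
    have := hp' _ hz
    exact ⟨hM.2 _ (by omega), fun h => by have := hq' _ h; omega,
      fun h => by have := hq' _ h; omega⟩
  refine ⟨?_, ?_, ?_, ?_⟩
  · intro c hc
    rcases mem_firstMoves.1 hc with ⟨z, hz, rfl⟩ | ⟨z, hz, rfl⟩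
    · refine ⟨(hp.1 z hz).1, ?_, by omega⟩
      have h := (memQ (-(z + 1 + a)) (by rwa [show -(-(z + 1 + a) + 1 + a) = z by ring])).1
      have e : -(2 * -(z + 1 + a) + 2 + a) = 2 * z + 1 + a - 1 := by ring
      simpa only [runnerQ, Set.mem_ofPred_eq, e] using h
    · refine ⟨?_, ?_, by omega⟩
      · have h := (memP (-(z + 1 + a)) (by rwa [show -(-(z + 1 + a) + 1 + a) = z by ring])).1
        have e : 2 * -(z + 1 + a) + 1 + a = -(2 * z + 1 + a) := by ring
        simpa only [runnerP, Set.mem_ofPred_eq, e] using h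
      · have h := (hq.1 z hz).1
        have e : -(2 * z + 2 + a) = -(2 * z + 1 + a) - 1 := by ring
        simpa only [runnerQ, Set.mem_ofPred_eq, e] using h
  · intro c hc
    rcases mem_secondMoves.1 hc with ⟨z, hz, rfl⟩ | ⟨z, hz, rfl⟩
    · refine ⟨Or.inr (mem_firstMoves.2 (Or.inl ⟨z, hz, by ring⟩)), ?_, by omega⟩
      have e : 2 * z + a - 1 = 2 * (z - 1) + 1 + a := by ring
      rintro (⟨h1, h2⟩ | h)
      · rw [e] at h1 h2
        rw [firstMoves_odd] at h2
        rcases (hp.1 z hz).2 with h | h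
        · exact h h1
        · exact h2 (Or.inl h)
      · exact firstMoves_even (by omega) h
    · refine ⟨?_, ?_, by omega⟩
      · rcases (hq.1 z hz).2 with h | h
        · refine Or.inl ⟨?_, firstMoves_even (by omega)⟩
          have e : -(2 * (z - 1) + 2 + a) = -(2 * z + a) := by ring
          simpa only [runnerQ, Set.mem_ofPred_eq, not_not, e] using h
        · exact Or.inr (mem_firstMoves.2 (Or.inr ⟨z - 1, h, by ring⟩))
      · rintro (⟨h1, h2⟩ | h)
        · exact h2 (mem_firstMoves.2 (Or.inr ⟨z, hz, by ring⟩))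
        · exact firstMoves_even (by omega) h
  · rw [hp.2]
    ext z
    have e1 : 2 * z + 1 + a + 1 ∉ firstMoves a Sp Sq := firstMoves_even (by omega)
    have e2 : 2 * z + 1 + a ∉ secondMoves a Sp Sq := secondMoves_odd (by omega)
    have e3 : 2 * z + 1 + a + 1 = 2 * (z + 1) + a := by ring
    have h := memP z
    simp only [runnerP, shift, Set.mem_ofPred_eq, e1, e2, or_false, not_false_eq_true, and_true,
      firstMoves_odd] at h ⊢
    rw [e3, secondMoves_even]
    tauto
  · rw [hq.2]
    ext z
    have e1 : -(2 * z + 2 + a) ∉ firstMoves a Sp Sq := firstMoves_even (by omega)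
    have e2 : -(2 * z + 2 + a) + 1 ∉ secondMoves a Sp Sq := secondMoves_odd (by omega)
    have e3 : -(2 * z + 2 + a) + 1 = 2 * -(z + 1 + a) + 1 + a := by ring
    have e4 : -(2 * z + 2 + a) = 2 * -(z + 1 + a) + a := by ring
    have e5 : -(-(z + 1 + a) + 1 + a) = z := by ring
    have e6 : -(-(z + 1 + a) + a) = z + 1 := by ring
    have h := memQ z
    simp only [runnerQ, shift, Set.mem_ofPred_eq, e1, e2, or_false, not_false_eq_true, and_true]
      at h ⊢
    rw [e3, firstMoves_odd, e4, secondMoves_even, e5, e6]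
    rw [e4] at h
    tauto

/-- Below the threshold a bead of the parity of `a` has an occupied position beneath it, so it can
move only after the first step has vacated that position. Above the threshold the only such beads
are those which have just arrived. This sends `T` injectively to `S`, and equality of the
cardinalities makes every first move the beginning of a completed double move. -/
theorem exists_moves {a m : ℤ} {M : Set ℤ} {S T : Finset ℤ} (hM : RockAt a m M)
    (hS : ∀ c ∈ S, c ∈ M ∧ c - 1 ∉ M ∧ c % 2 = (a + 1) % 2)
    (hT : ∀ c ∈ T, c ∈ shift M S ∧ c - 1 ∉ shift M S ∧ c % 2 = a % 2) (hc : S.card = T.card) :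
    ∃ Sp Sq : Finset ℤ, (∀ k ∈ Sp, k ∈ runnerP a M ∧ (k - 1 ∉ runnerP a M ∨ k - 1 ∈ Sp)) ∧
      (∀ k ∈ Sq, k ∈ runnerQ a M ∧ (k - 1 ∉ runnerQ a M ∨ k - 1 ∈ Sq)) ∧
      S = firstMoves a Sp Sq ∧ T = secondMoves a Sp Sq := by
  -- The threshold: positions of the parity of `a + 1` below `2 * m + 1 + a` are full, and positions
  -- of the parity of `a` above `2 * m + a` are empty.
  have hlow : ∀ c, c % 2 = (a + 1) % 2 → c < 2 * m + 1 + a → c ∈ M := fun c h1 h2 => by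
    have h := hM.1 ((c - 1 - a) / 2) (by omega)
    simp only [runnerP, Set.mem_ofPred_eq] at h
    rwa [show 2 * ((c - 1 - a) / 2) + 1 + a = c by omega] at h
  have hhigh : ∀ c, c % 2 = a % 2 → 2 * m + a < c → c ∉ M := fun c h1 h2 => by
    have h := hM.2 (-((c + 2 + a) / 2)) (by omega)
    simp only [runnerQ, Set.mem_ofPred_eq] at h
    rwa [show -(2 * -((c + 2 + a) / 2) + 2 + a) = c by omega] at h
  have hT1 : ∀ t ∈ T, t ≤ 2 * m + a → t - 1 ∈ S := fun t ht hle => by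
    obtain ⟨-, h2, h3⟩ := hT t ht
    by_contra h
    exact h2 (Or.inl ⟨hlow _ (by omega) (by omega), h⟩)
  have hT2 : ∀ t ∈ T, 2 * m + a < t → t + 1 ∈ S := fun t ht hlt => by
    obtain ⟨h1, -, h3⟩ := hT t ht
    rcases h1 with h | h
    · exact absurd h.1 (hhigh _ h3 hlt)
    · exact h
  have hsurj : ∀ c ∈ S, (c ≤ 2 * m + a ∧ c + 1 ∈ T) ∨ (2 * m + a + 1 < c ∧ c - 1 ∈ T) := by
    have himg : T.image (fun t => if t ≤ 2 * m + a then t - 1 else t + 1) = S := by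
      refine Finset.eq_of_subset_of_card_le ?_ ?_
      · intro c hc
        obtain ⟨t, ht, rfl⟩ := Finset.mem_image.1 hc
        split_ifs with h
        · exact hT1 t ht h
        · exact hT2 t ht (not_le.1 h)
      · rw [Finset.card_image_of_injOn, hc]
        intro t ht t' ht' h
        simp only at h
        split_ifs at h <;> omega
    intro c hc
    rw [← himg] at hc
    obtain ⟨t, ht, rfl⟩ := Finset.mem_image.1 hc
    have h3 := (hT t ht).2.2
    split_ifs with h
    · exact Or.inl ⟨by omega, by rwa [sub_add_cancel]⟩
    · exact Or.inr ⟨by omega, by rwa [add_sub_cancel_right]⟩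
  have hval : ∀ c ∈ S, c % 2 = (a + 1) % 2 := fun c hc => (hS c hc).2.2
  let Sp := (S.filter (2 * m + a < ·)).image fun c => (c - 1 - a) / 2
  let Sq := (S.filter (· ≤ 2 * m + a)).image fun c => (-c - 1 - a) / 2
  have mp : ∀ z, z ∈ Sp ↔ 2 * z + 1 + a ∈ S ∧ 2 * m + a < 2 * z + 1 + a := by
    intro z
    simp only [Sp, Finset.mem_image, Finset.mem_filter]
    constructor
    · rintro ⟨c, ⟨h1, h2⟩, rfl⟩
      have := hval c h1
      have e : 2 * ((c - 1 - a) / 2) + 1 + a = c := by omega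
      rw [e]
      exact ⟨h1, h2⟩
    · intro h
      exact ⟨_, h, by omega⟩
  have mq : ∀ z, z ∈ Sq ↔ -(2 * z + 1 + a) ∈ S ∧ -(2 * z + 1 + a) ≤ 2 * m + a := by
    intro z
    simp only [Sq, Finset.mem_image, Finset.mem_filter]
    constructor
    · rintro ⟨c, ⟨h1, h2⟩, rfl⟩
      have := hval c h1
      have e : -(2 * ((-c - 1 - a) / 2) + 1 + a) = c := by omega
      rw [e]
      exact ⟨h1, h2⟩
    · intro h
      exact ⟨_, h, by omega⟩
  refine ⟨Sp, Sq, ?_, ?_, ?_, ?_⟩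
  · intro z hz
    obtain ⟨h1, h2⟩ := (mp z).1 hz
    refine ⟨(hS _ h1).1, ?_⟩
    rcases hsurj _ h1 with h3 | h3
    · omega
    · have h4 := (hT _ h3.2).2.1
      by_contra! h5
      apply h4
      left
      rw [show 2 * z + 1 + a - 1 - 1 = 2 * (z - 1) + 1 + a by ring]
      refine ⟨h5.1, fun h6 => h5.2 ((mp _).2 ⟨h6, ?_⟩)⟩
      omega
  · intro z hz
    obtain ⟨h1, h2⟩ := (mq z).1 hz
    have h7 := (hS _ h1).2.1
    rw [show -(2 * z + 1 + a) - 1 = -(2 * z + 2 + a) by ring] at h7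
    refine ⟨h7, ?_⟩
    rcases hsurj _ h1 with h3 | h3
    · rcases (hT _ h3.2).1 with h4 | h4
      · left
        simp only [runnerQ, Set.mem_ofPred_eq, not_not]
        rw [show -(2 * (z - 1) + 2 + a) = -(2 * z + 1 + a) + 1 by ring]
        exact h4.1
      · right
        rw [mq]
        rw [show -(2 * (z - 1) + 1 + a) = -(2 * z + 1 + a) + 1 + 1 by ring]
        refine ⟨h4, ?_⟩
        rcases hsurj _ h4 with h5 | h5 <;> omega
    · omega
  · ext c
    rw [mem_firstMoves]
    constructor
    · intro h
      have h1 := hval c h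
      rcases le_or_gt c (2 * m + a) with h2 | h2
      · right
        refine ⟨(-c - 1 - a) / 2, Finset.mem_image.2 ⟨c, Finset.mem_filter.2 ⟨h, h2⟩, rfl⟩, ?_⟩
        omega
      · left
        refine ⟨(c - 1 - a) / 2, Finset.mem_image.2 ⟨c, Finset.mem_filter.2 ⟨h, h2⟩, rfl⟩, ?_⟩
        omega
    · rintro (⟨z, hz, rfl⟩ | ⟨z, hz, rfl⟩)
      · exact ((mp z).1 hz).1
      · exact ((mq z).1 hz).1
  · ext c
    rw [mem_secondMoves]
    constructor
    · intro h
      have h1 := (hT c h).2.2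
      rcases le_or_gt c (2 * m + a) with h2 | h2
      · right
        refine ⟨(-c - a) / 2, (mq _).2 ?_, by omega⟩
        rw [show -(2 * ((-c - a) / 2) + 1 + a) = c - 1 by omega]
        exact ⟨hT1 c h h2, by omega⟩
      · left
        refine ⟨(c - a) / 2, (mp _).2 ?_, by omega⟩
        rw [show 2 * ((c - a) / 2) + 1 + a = c + 1 by omega]
        exact ⟨hT2 c h h2, by omega⟩
    · rintro (⟨z, hz, rfl⟩ | ⟨z, hz, rfl⟩)
      · obtain ⟨h1, h2⟩ := (mp z).1 hz
        rcases hsurj _ h1 with h3 | h3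
        · omega
        · rw [show 2 * z + 1 + a - 1 = 2 * z + a by ring] at h3
          exact h3.2
      · obtain ⟨h1, h2⟩ := (mq z).1 hz
        rcases hsurj _ h1 with h3 | h3
        · have := h3.2
          rwa [show -(2 * z + 1 + a) + 1 = -(2 * z + a) by ring] at this
        · omega

/-- `x` is obtained from `y` by moving `n` beads down on the two runners. -/
def Strip (a : ℤ) (y x : YoungDiagram) (n : ℕ) : Prop :=
  ∃ Sp Sq : Finset ℤ, DownBy (runnerP a (maya y)) (runnerP a (maya x)) Sp ∧
    DownBy (runnerQ a (maya y)) (runnerQ a (maya x)) Sq ∧ Sp.card + Sq.card = n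

/-- The composite `e_ā^{(n)} e_{ā+1}^{(n)}`. -/
def doubleE (a : ℤ) (n : ℕ) (v : Fock) : Fock :=
  divPowF (eF ((a : ℤ) : ZMod 2)) n (divPowF (eF ((a + 1 : ℤ) : ZMod 2)) n v)

theorem doubleE_single (a : ℤ) (n : ℕ) (y : YoungDiagram) :
    doubleE a n (Finsupp.single y 1) =
      ∑ S ∈ (removables (a + 1) y).powersetCard n,
        ∑ T ∈ (removables a (remove y S)).powersetCard n,
          Finsupp.single (remove (remove y S) T) 1 := by
  rw [doubleE, divPowF_eF_single, map_sum]
  exact Finset.sum_congr rfl fun S _ => divPowF_eF_single _ _ _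

theorem subset_removables {p : ℤ} {y : YoungDiagram} {S : Finset ℤ} : S ⊆ removables p y ↔
    ∀ c ∈ S, c ∈ maya y ∧ c - 1 ∉ maya y ∧ c % 2 = p % 2 :=
  ⟨fun h _ hc => mem_removables.1 (h hc), fun h c hc => mem_removables.2 (h c hc)⟩

theorem moves_remove {a m : ℤ} {y : YoungDiagram} {X X' : Set ℤ} {Sp Sq : Finset ℤ}
    (hM : RockAt a m (maya y))
    (hp : DownBy (runnerP a (maya y)) X Sp) (hq : DownBy (runnerQ a (maya y)) X' Sq) :
    firstMoves a Sp Sq ∈ (removables (a + 1) y).powersetCard (Sp.card + Sq.card) ∧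
    secondMoves a Sp Sq ∈
      (removables a (remove y (firstMoves a Sp Sq))).powersetCard (Sp.card + Sq.card) ∧
    runnerP a (maya (remove (remove y (firstMoves a Sp Sq)) (secondMoves a Sp Sq))) = X ∧
    runnerQ a (maya (remove (remove y (firstMoves a Sp Sq)) (secondMoves a Sp Sq))) = X' := by
  obtain ⟨h1, h2, h3, h4⟩ := moves_spec hM hp hq
  obtain ⟨c1, c2⟩ := card_moves (hp.lt hM.1) (hq.lt hM.2)
  have s1 := subset_removables.2 h1
  have r1 := (remove_spec s1).1
  rw [← r1] at h2 h3 h4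
  have s2 := subset_removables.2 h2
  rw [← (remove_spec s2).1] at h3 h4
  exact ⟨Finset.mem_powersetCard.2 ⟨s1, c1⟩, Finset.mem_powersetCard.2 ⟨s2, c2⟩, h3, h4⟩

theorem exists_moves_remove {a m : ℤ} {y : YoungDiagram} {S T : Finset ℤ} {n : ℕ}
    (hM : RockAt a m (maya y)) (hS : S ∈ (removables (a + 1) y).powersetCard n)
    (hT : T ∈ (removables a (remove y S)).powersetCard n) :
    ∃ Sp Sq : Finset ℤ,
      DownBy (runnerP a (maya y)) (runnerP a (maya (remove (remove y S) T))) Sp ∧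
      DownBy (runnerQ a (maya y)) (runnerQ a (maya (remove (remove y S) T))) Sq ∧
      S = firstMoves a Sp Sq ∧ T = secondMoves a Sp Sq ∧ Sp.card + Sq.card = n := by
  obtain ⟨hS1, hS2⟩ := Finset.mem_powersetCard.1 hS
  obtain ⟨hT1, hT2⟩ := Finset.mem_powersetCard.1 hT
  have hT1' := subset_removables.1 hT1
  rw [(remove_spec hS1).1] at hT1'
  obtain ⟨Sp, Sq, hp, hq, rfl, rfl⟩ :=
    exists_moves hM (subset_removables.1 hS1) hT1' (hS2.trans hT2.symm)
  obtain ⟨h1, h2, h3, h4⟩ := moves_remove hM ⟨hp, rfl⟩ ⟨hq, rfl⟩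
  refine ⟨Sp, Sq, ⟨hp, h3⟩, ⟨hq, h4⟩, rfl, rfl, ?_⟩
  rw [← hS2, (Finset.mem_powersetCard.1 h1).2]

open Classical in
-- The pair of bead sets moved is determined by the end result, by `DownBy.unique` on each runner,
-- so no coefficient exceeds `1`.
theorem doubleE_apply {a m : ℤ} {y : YoungDiagram} (hM : RockAt a m (maya y)) (n : ℕ)
    (x : YoungDiagram) :
    doubleE a n (Finsupp.single y 1) x = if Strip a y x n then 1 else 0 := by
  rw [doubleE_single, Finsupp.finsetSum_apply]
  simp_rw [Finsupp.finsetSum_apply, Finsupp.single_apply]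
  split_ifs with h
  · obtain ⟨Sp, Sq, hp, hq, rfl⟩ := h
    obtain ⟨h1, h2, h3, h4⟩ := moves_remove hM hp hq
    have hx : remove (remove y (firstMoves a Sp Sq)) (secondMoves a Sp Sq) = x :=
      maya_injective (ext_runners h3 h4)
    have key : ∀ S ∈ (removables (a + 1) y).powersetCard (Sp.card + Sq.card),
        ∀ T ∈ (removables a (remove y S)).powersetCard (Sp.card + Sq.card),
        remove (remove y S) T = x → S = firstMoves a Sp Sq ∧ T = secondMoves a Sp Sq := by
      rintro S hS T hT rfl
      obtain ⟨Sp', Sq', hp', hq', e1, e2, -⟩ := exists_moves_remove hM hS hT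
      rw [e1, e2, hp.unique hp', hq.unique hq']
      exact ⟨rfl, rfl⟩
    rw [Finset.sum_eq_single_of_mem _ h1, Finset.sum_eq_single_of_mem _ h2, if_pos hx]
    · intro T hT hne
      exact if_neg fun hx' => hne (key _ h1 T hT hx').2
    · intro S hS hne
      exact Finset.sum_eq_zero fun T hT => if_neg fun hx' => hne (key S hS T hT hx').1
  · refine Finset.sum_eq_zero fun S hS => Finset.sum_eq_zero fun T hT => if_neg ?_
    rintro rfl
    obtain ⟨Sp, Sq, hp, hq, -, -, hn⟩ := exists_moves_remove hM hS hT
    exact h ⟨Sp, Sq, hp, hq, hn⟩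

theorem Strip.content_eq {a m : ℤ} {y x : YoungDiagram} {n : ℕ} (hM : RockAt a m (maya y))
    (h : Strip a y x n) : content y = Multiset.replicate n ((a + 1 : ℤ) : ZMod 2) +
      (Multiset.replicate n ((a : ℤ) : ZMod 2) + content x) := by
  obtain ⟨Sp, Sq, hp, hq, rfl⟩ := h
  obtain ⟨h1, h2, h3, h4⟩ := moves_remove hM hp hq
  have hx : remove (remove y (firstMoves a Sp Sq)) (secondMoves a Sp Sq) = x :=
    maya_injective (ext_runners h3 h4)
  obtain ⟨h1, c1⟩ := Finset.mem_powersetCard.1 h1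
  obtain ⟨h2, c2⟩ := Finset.mem_powersetCard.1 h2
  rw [(remove_spec h1).2, (remove_spec h2).2, hx, c1, c2]

theorem exists_strip {a m : ℤ} {y : YoungDiagram} {X X' : Set ℤ} {Sp Sq : Finset ℤ}
    (hM : RockAt a m (maya y))
    (hp : DownBy (runnerP a (maya y)) X Sp) (hq : DownBy (runnerQ a (maya y)) X' Sq) :
    ∃ x, runnerP a (maya x) = X ∧ runnerQ a (maya x) = X' :=
  ⟨_, (moves_remove hM hp hq).2.2⟩

/-! ### Abacus displays -/

theorem rowLen_eq_zero_of_le {μ : YoungDiagram} {N i : ℕ} (hN : μ.rowLen N = 0) (hi : N ≤ i) :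
    μ.rowLen i = 0 := by
  have := μ.rowLen_anti N i hi
  omega

theorem rowLen_eq_zero_of_colLen_le {μ : YoungDiagram} {N : ℕ} (hN : μ.colLen 0 ≤ N) :
    μ.rowLen N = 0 := by
  by_contra h
  have h1 : (N, 0) ∈ μ := YoungDiagram.mem_iff_lt_rowLen.2 (Nat.pos_of_ne_zero h)
  have h2 := YoungDiagram.mem_iff_lt_colLen.1 h1
  omega

theorem mem_beads_iff {μ : YoungDiagram} {N : ℕ} (hN : μ.rowLen N = 0) (k : ℕ) :
    k ∈ beads μ N ↔ (k : ℤ) - N ∈ maya μ := by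
  simp only [beads, Finset.mem_image, Finset.mem_range, mem_maya]
  constructor
  · rintro ⟨i, hi, rfl⟩
    exact ⟨i, by omega⟩
  · rintro ⟨i, hi⟩
    have hiN : i < N := by
      by_contra h
      have := rowLen_eq_zero_of_le hN (not_lt.1 h)
      omega
    exact ⟨i, hiN, by omega⟩

theorem mem_maya_of_lt {μ : YoungDiagram} {N : ℕ} (hN : μ.rowLen N = 0) {z : ℤ}
    (hz : z < -N) : z ∈ maya μ := by
  refine mem_maya.2 ⟨(-z - 1).toNat, ?_⟩
  have h := rowLen_eq_zero_of_le hN (show N ≤ (-z - 1).toNat by omega)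
  omega

theorem injOn_beads (μ : YoungDiagram) (N : ℕ) :
    Set.InjOn (fun i => μ.rowLen i + (N - 1 - i)) (Finset.range N : Set ℕ) := by
  intro i hi j hj h
  have hi := Finset.mem_range.1 (Finset.mem_coe.1 hi)
  have hj := Finset.mem_range.1 (Finset.mem_coe.1 hj)
  simp only at h
  exact (strictAnti_rows μ).injective (by omega)

theorem card_beads (μ : YoungDiagram) (N : ℕ) : (beads μ N).card = N := by
  rw [beads, Finset.card_image_of_injOn (injOn_beads μ N), Finset.card_range]

theorem sum_beads (μ : YoungDiagram) (N : ℕ) (g : ℤ → ℤ) :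
    ∑ b ∈ beads μ N, g b = ∑ i ∈ Finset.range N, g ((μ.rowLen i : ℤ) - i - 1 + N) := by
  rw [beads, Finset.sum_image (injOn_beads μ N)]
  refine Finset.sum_congr rfl fun i hi => ?_
  have := Finset.mem_range.1 hi
  congr 1
  omega

/-- A bead position is the number of gaps below it, which is the displayed part, plus the number of
beads below it. Hence every bead occurs in the standard bead set, and the cardinalities agree. -/
theorem Displays.eq_beads {X : Finset ℕ} {q : YoungDiagram} (h : Displays X q) :
    X = beads q X.card := by
  refine Finset.eq_of_subset_of_card_le ?_ (card_beads _ _).le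
  intro b hb
  have h1 := h.1 b hb
  have h2 : (X.filter (b < ·)).card + (X.filter (· < b)).card + 1 = X.card := by
    rw [← Finset.card_filter_add_card_filter_not (s := X) (b < ·), add_assoc]
    congr 1
    have : X.filter (fun x => ¬ b < x) = insert b (X.filter (· < b)) := by
      ext x
      simp only [Finset.mem_filter, Finset.mem_insert]
      constructor
      · rintro ⟨hx, hbx⟩
        rcases eq_or_lt_of_le (not_lt.1 hbx) with h | h
        · exact Or.inl h
        · exact Or.inr ⟨hx, h⟩
      · rintro (rfl | ⟨hx, h⟩)
        · exact ⟨hb, lt_irrefl _⟩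
        · exact ⟨hx, by omega⟩
    rw [this, Finset.card_insert_of_notMem (by simp)]
  have h3 : ((Finset.range b).filter (· ∉ X)).card + (X.filter (· < b)).card = b := by
    have := Finset.card_filter_add_card_filter_not (s := Finset.range b) (· ∈ X)
    rw [Finset.card_range] at this
    have e : (Finset.range b).filter (· ∈ X) = X.filter (· < b) := by
      ext x
      simp only [Finset.mem_filter, Finset.mem_range]
      exact and_comm
    rw [e] at this
    omega
  refine Finset.mem_image.2 ⟨(X.filter (b < ·)).card, Finset.mem_range.2 (by omega), ?_⟩
  rw [h1]
  omega

theorem mem_runner {B : Finset ℕ} {ε k : ℕ} (hε : ε < 2) : k ∈ runner B ε ↔ 2 * k + ε ∈ B := by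
  simp only [runner, Finset.mem_image, Finset.mem_filter]
  constructor
  · rintro ⟨b, ⟨hb, h1⟩, rfl⟩
    rwa [show 2 * (b / 2) + ε = b by omega]
  · intro h
    exact ⟨_, ⟨h, by omega⟩, by omega⟩

theorem sum_runners (B : Finset ℕ) (g : ℕ → ℤ) :
    ∑ b ∈ B, g b = ∑ k ∈ runner B 0, g (2 * k) + ∑ k ∈ runner B 1, g (2 * k + 1) := by
  have h : ∀ ε < 2, ∑ b ∈ B.filter (· % 2 = ε), g b = ∑ k ∈ runner B ε, g (2 * k + ε) := by
    intro ε hε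
    rw [runner, Finset.sum_image]
    · refine Finset.sum_congr rfl fun b hb => ?_
      have := (Finset.mem_filter.1 hb).2
      congr 1
      omega
    · intro b hb c hc hbc
      have h1 := (Finset.mem_filter.1 hb).2
      have h2 := (Finset.mem_filter.1 hc).2
      simp only at hbc
      omega
  rw [← Finset.sum_filter_add_sum_filter_not B (· % 2 = 0), h 0 (by omega), ← h 1 (by omega)]
  congr 1
  refine Finset.sum_congr (Finset.filter_congr fun b _ => ?_) fun _ _ => rfl
  omega

theorem card_mul_le_sum (X : Finset ℕ) :
    (X.card : ℤ) * (X.card - 1) ≤ 2 * ∑ x ∈ X, (x : ℤ) := by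
  induction X using Finset.induction_on_max with
  | empty => simp
  | insert a s hs ih =>
    have ha : a ∉ s := fun h => lt_irrefl _ (hs a h)
    have hc : s.card ≤ a := by
      have := Finset.card_le_card (fun x hx => Finset.mem_range.2 (hs x hx) : s ⊆ Finset.range a)
      rwa [Finset.card_range] at this
    rw [Finset.card_insert_of_notMem ha, Finset.sum_insert ha]
    push_cast
    have : (s.card : ℤ) ≤ a := by exact_mod_cast hc
    nlinarith

/-- The sum of positions is least when the beads on both runners are pushed down as far as possible,
that is, for a 2-core. -/
theorem runners_le_sum (B : Finset ℕ) :
    ((runner B 0).card : ℤ) * ((runner B 0).card - 1) + ((runner B 1).card : ℤ) ^ 2 ≤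
      ∑ b ∈ B, (b : ℤ) := by
  rw [sum_runners B fun b => (b : ℤ)]
  push_cast
  rw [Finset.sum_add_distrib, ← Finset.mul_sum, ← Finset.mul_sum, Finset.sum_const, nsmul_eq_mul]
  have h0 := card_mul_le_sum (runner B 0)
  have h1 := card_mul_le_sum (runner B 1)
  nlinarith

/-! ### The defect: nodes of residue `0` minus nodes of residue `1` -/

/-- The sign of a position. -/
def posSign (c : ℤ) : ℤ := if c % 2 = 0 then 1 else -1

theorem posSign_add (c d : ℤ) : posSign (c + d) = posSign c * posSign d := by
  unfold posSign
  split_ifs <;> omega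

theorem posSign_of_even {c : ℤ} (h : c % 2 = 0) : posSign c = 1 := if_pos h

theorem posSign_of_odd {c : ℤ} (h : c % 2 = 1) : posSign c = -1 := if_neg (by omega)

/-- The sign of a residue. -/
def resSign (x : ZMod 2) : ℤ := if x = 0 then 1 else -1

theorem resSign_intCast (c : ℤ) : resSign (c : ZMod 2) = posSign c := by
  have : (c : ZMod 2) = 0 ↔ c % 2 = 0 := by
    rw [ZMod.intCast_zmod_eq_zero_iff_dvd]
    push_cast
    omega
  simp only [resSign, posSign, this]

/-- The number of nodes of residue `0` minus the number of nodes of residue `1`. -/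
def defect (μ : YoungDiagram) : ℤ := ((content μ).map resSign).sum

theorem defect_eq (μ : YoungDiagram) : defect μ = ∑ c ∈ μ.cells, posSign ((c.2 : ℤ) - c.1) := by
  rw [defect, content, Multiset.map_map]
  refine Finset.sum_congr rfl fun c _ => ?_
  rw [← resSign_intCast]
  simp [residue]

theorem sum_cells {μ : YoungDiagram} {N : ℕ} (hN : μ.rowLen N = 0) (g : ℕ × ℕ → ℤ) :
    ∑ c ∈ μ.cells, g c = ∑ i ∈ Finset.range N, ∑ j ∈ Finset.range (μ.rowLen i), g (i, j) := by
  rw [Finset.sum_sigma']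
  symm
  refine Finset.sum_bij (fun q _ => (q.1, q.2)) ?_ ?_ ?_ fun _ _ => rfl
  · rintro ⟨i, j⟩ h
    exact YoungDiagram.mem_iff_lt_rowLen.2 (Finset.mem_range.1 (Finset.mem_sigma.1 h).2)
  · rintro ⟨i, j⟩ _ ⟨i', j'⟩ _ h
    simpa using h
  · rintro ⟨i, j⟩ h
    have hj := YoungDiagram.mem_iff_lt_rowLen.1 ((YoungDiagram.mem_cells _).1 h)
    refine ⟨⟨i, j⟩, Finset.mem_sigma.2 ⟨Finset.mem_range.2 ?_, Finset.mem_range.2 hj⟩, rfl⟩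
    by_contra hi
    have := rowLen_eq_zero_of_le hN (show N ≤ i from not_lt.1 hi)
    omega

theorem two_mul_sum_posSign (i l : ℕ) :
    2 * ∑ j ∈ Finset.range l, posSign ((j : ℤ) - i) =
      posSign ((l : ℤ) - i - 1) - posSign (-(i : ℤ) - 1) := by
  induction l with
  | zero => simp
  | succ l ih =>
    rw [Finset.sum_range_succ, mul_add, ih]
    unfold posSign
    push_cast
    split_ifs <;> omega

theorem sum_posSign_neg (N : ℕ) :
    ∑ i ∈ Finset.range N, posSign (-(i : ℤ) - 1) = -((N % 2 : ℕ) : ℤ) := by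
  induction N with
  | zero => simp
  | succ N ih =>
    rw [Finset.sum_range_succ, ih]
    unfold posSign
    push_cast
    split_ifs <;> omega

/-- Signs alternate along a row, so each row sum telescopes to its two ends. The defect therefore
depends only on the parities of the beads; the term `N % 2` corrects for the starting points of the
rows. -/
theorem two_mul_defect {μ : YoungDiagram} {N : ℕ} (hN : μ.rowLen N = 0) :
    2 * defect μ =
      ∑ i ∈ Finset.range N, posSign ((μ.rowLen i : ℤ) - i - 1) + ((N % 2 : ℕ) : ℤ) := by
  rw [defect_eq, sum_cells hN, Finset.mul_sum]
  simp only [two_mul_sum_posSign]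
  rw [Finset.sum_sub_distrib, sum_posSign_neg]
  ring

theorem rowLen_staircase (a i : ℕ) : (staircase a).rowLen i = a - i := by
  refine eq_of_forall_lt_iff fun j => ?_
  rw [← YoungDiagram.mem_iff_lt_rowLen, ← YoungDiagram.mem_cells]
  simp only [staircase, Finset.mem_filter, Finset.mem_product, Finset.mem_range]
  omega

theorem two_mul_defect_staircase (a : ℕ) :
    2 * defect (staircase a) = if a % 2 = 0 then -(a : ℤ) else a + 1 := by
  rw [two_mul_defect (N := a) (by rw [rowLen_staircase]; omega)]
  have : ∀ i ∈ Finset.range a, posSign (((staircase a).rowLen i : ℤ) - i - 1) =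
      posSign ((a : ℤ) - 1) := by
    intro i hi
    have := Finset.mem_range.1 hi
    rw [rowLen_staircase]
    unfold posSign
    split_ifs <;> omega
  rw [Finset.sum_congr rfl this, Finset.sum_const, Finset.card_range, nsmul_eq_mul]
  split_ifs with h
  · rw [posSign_of_odd (by omega), h]; ring
  · rw [posSign_of_even (by omega), show a % 2 = 1 by omega]; push_cast; ring

theorem RemovesDomino.defect_eq {ν μ : YoungDiagram} (h : RemovesDomino ν μ) :
    defect ν = defect μ := by
  obtain ⟨i, j, c, hc, h1, h2, h3⟩ := h
  have hne : (i, j) ∉ insert c μ.cells := by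
    rw [Finset.mem_insert]
    rintro (h | h)
    · rcases hc with rfl | rfl <;> simp at h
    · exact h1 h
  rw [SymChar.defect_eq, SymChar.defect_eq, h3, Finset.sum_insert hne, Finset.sum_insert h2]
  have : posSign ((j : ℤ) - i) + posSign ((c.2 : ℤ) - c.1) = 0 := by
    unfold posSign
    rcases hc with rfl | rfl <;> simp only <;> push_cast <;> split_ifs <;> omega
  linarith

theorem defect_eq_of_core {ν κ : YoungDiagram} (h : IsTwoCore ν κ) : defect ν = defect κ := by
  obtain ⟨h, -⟩ := h
  induction h with
  | refl => rfl
  | tail _ h2 ih => rw [ih, h2.defect_eq]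

theorem runner_card_sub {μ : YoungDiagram} {N : ℕ} (hN : μ.rowLen N = 0) :
    ((runner (beads μ N) 0).card : ℤ) - (runner (beads μ N) 1).card =
      (2 * defect μ - ((N % 2 : ℕ) : ℤ)) * posSign N := by
  have h1 := sum_runners (beads μ N) fun b => posSign b
  have h2 := sum_beads μ N posSign
  simp only [posSign_add _ (N : ℤ)] at h2
  rw [← Finset.sum_mul] at h2
  have e0 : ∀ k ∈ runner (beads μ N) 0, posSign ((2 * k : ℕ) : ℤ) = 1 := fun k _ =>
    posSign_of_even (by omega)
  have e1 : ∀ k ∈ runner (beads μ N) 1, posSign ((2 * k + 1 : ℕ) : ℤ) = -1 := fun k _ =>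
    posSign_of_odd (by omega)
  rw [Finset.sum_congr rfl e0, Finset.sum_congr rfl e1] at h1
  simp only [Finset.sum_const, nsmul_eq_mul] at h1
  rw [two_mul_defect hN, add_sub_cancel_right, ← h2, h1]
  ring

theorem runner_card_add (μ : YoungDiagram) (N : ℕ) :
    (runner (beads μ N) 0).card + (runner (beads μ N) 1).card = N := by
  have h := sum_runners (beads μ N) fun _ => 1
  simp only [Finset.sum_const, nsmul_eq_mul, mul_one, card_beads] at h
  exact_mod_cast h.symm

theorem two_mul_sum_beads {μ : YoungDiagram} {N : ℕ} (hN : μ.rowLen N = 0) :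
    2 * ∑ b ∈ beads μ N, (b : ℤ) = 2 * μ.card + N * (N - 1) := by
  rw [sum_beads μ N fun b => b, card_eq_sum_rowLen μ hN]
  push_cast
  have h : ∀ n : ℕ, 2 * ∑ i ∈ Finset.range n, ((i : ℤ) + 1) = n * (n + 1) := by
    intro n
    induction n with
    | zero => simp
    | succ n ih => rw [Finset.sum_range_succ, mul_add, ih]; push_cast; ring
  have e : ∀ i ∈ Finset.range N, (μ.rowLen i : ℤ) - i - 1 + N = μ.rowLen i - (i + 1) + N :=
    fun i _ => by ring
  rw [Finset.sum_congr rfl e, Finset.sum_add_distrib, Finset.sum_sub_distrib, Finset.sum_const,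
    Finset.card_range, nsmul_eq_mul, mul_add, mul_sub, h]
  ring

/-! ### Reading off the quotient -/

theorem HasCoreQuotient.spec {ν q₀ q₁ : YoungDiagram} {a : ℕ}
    (h : HasCoreQuotient ν (staircase a) q₀ q₁) :
    (∀ z, 2 * z + 1 + (a : ℤ) ∈ maya ν ↔ z ∈ maya q₁) ∧
    (∀ z, 2 * z - (a : ℤ) ∈ maya ν ↔ z ∈ maya q₀) ∧
    2 * ν.card = a * (a + 1) + 4 * (q₀.card + q₁.card) := by
  obtain ⟨hc, N, hN, hle, h0, h1⟩ := h
  have hN := rowLen_eq_zero_of_colLen_le hN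
  have hsub := runner_card_sub hN
  have hadd := runner_card_add ν N
  rw [defect_eq_of_core hc, two_mul_defect_staircase] at hsub
  have z0 := h0.2
  have z1 := h1.2
  have b0 := h0.eq_beads
  have b1 := h1.eq_beads
  have hs := two_mul_sum_beads hN
  rw [sum_runners (beads ν N) fun b => (b : ℤ)] at hs
  have s0 := two_mul_sum_beads z0
  have s1 := two_mul_sum_beads z1
  rw [← b0] at s0
  rw [← b1] at s1
  have m0 : ∀ k, k ∈ runner (beads ν N) 0 ↔ 2 * k + 0 ∈ beads ν N := fun k =>
    mem_runner (by omega)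
  have m1 : ∀ k, k ∈ runner (beads ν N) 1 ↔ 2 * k + 1 ∈ beads ν N := fun k =>
    mem_runner (by omega)
  rw [b0] at m0
  rw [b1] at m1
  push_cast at hs
  rw [Finset.sum_add_distrib, ← Finset.mul_sum, ← Finset.mul_sum, Finset.sum_const,
    nsmul_eq_mul] at hs
  generalize ∑ k ∈ runner (beads ν N) 0, (k : ℤ) = S0 at hs s0
  generalize ∑ k ∈ runner (beads ν N) 1, (k : ℤ) = S1 at hs s1
  generalize (runner (beads ν N) 0).card = n0 at *
  generalize (runner (beads ν N) 1).card = n1 at *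
  -- The defect leaves `a` or `-(a + 1)` for `n1 - n0`, according to the parity of `N`. The
  -- convention that runner `1` has at least as many beads excludes the second case, so `N` has the
  -- parity of `a`.
  have hn : n1 = n0 + a := by
    unfold posSign at hsub
    split_ifs at hsub <;> omega
  subst hn
  have hNn : N = 2 * n0 + a := by omega
  subst hNn
  refine ⟨?_, ?_, ?_⟩
  · intro z
    rcases lt_or_ge z (-((n0 + a : ℕ) : ℤ)) with hz | hz
    · exact iff_of_true (mem_maya_of_lt hN (by push_cast at hz ⊢; omega)) (mem_maya_of_lt z1 hz)
    · have h := m1 (z + (n0 + a : ℕ)).toNat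
      rw [mem_beads_iff z1, mem_beads_iff hN] at h
      push_cast at hz h
      rw [Int.toNat_of_nonneg (by omega)] at h
      rw [show 2 * z + 1 + (a : ℤ) = 2 * (z + (n0 + a)) + 1 - (2 * n0 + a) by ring, ← h,
        show z + ((n0 : ℤ) + a) - (n0 + a) = z by ring]
  · intro z
    rcases lt_or_ge z (-(n0 : ℤ)) with hz | hz
    · exact iff_of_true (mem_maya_of_lt hN (by push_cast at hz ⊢; omega)) (mem_maya_of_lt z0 hz)
    · have h := m0 (z + n0).toNat
      rw [mem_beads_iff z0, mem_beads_iff hN] at h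
      push_cast at hz h
      rw [Int.toNat_of_nonneg (by omega)] at h
      rw [show 2 * z - (a : ℤ) = 2 * (z + n0) + 0 - (2 * n0 + a) by ring, ← h,
        show z + (n0 : ℤ) - n0 = z by ring]
  · push_cast at hs s0 s1
    zify
    linarith

/-! ### The RoCK condition from a bound on the size -/

/-- If a bead of the parity of `a` lay above a gap of the parity of `a + 1`, moving it into that gap
would shrink the partition by at least one node. The surplus of beads on the second runner would
become `a + 2`, so what remains would have at least the size of the staircase of `a + 2`; this
contradicts the bound. -/
theorem exists_rockAt {a : ℕ} {y : YoungDiagram} (hd : defect y = defect (staircase a))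
    (hy : 2 * y.card < 2 + (a + 2) * (a + 3)) : ∃ m, RockAt a m (maya y) := by
  -- This `N` is large enough for all rows, has the parity of `a`, so that even abacus positions
  -- have the parity of `a`, and gives runner `0` exactly `y.card` beads.
  obtain ⟨N, hNa, hN⟩ : ∃ N : ℕ, N = 2 * y.card + a ∧ y.rowLen N = 0 :=
    ⟨_, rfl, rowLen_card_eq_zero y (by omega)⟩
  have hsub := runner_card_sub hN
  have hadd := runner_card_add y N
  rw [hd, two_mul_defect_staircase] at hsub
  have key : ∀ c c' : ℤ, c % 2 = a % 2 → c' % 2 = (a + 1) % 2 → c ∈ maya y → c' ∉ maya y →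
      c < c' := by
    intro c c' hc hc' hcy hcy'
    by_contra hlt
    have h1 : -(N : ℤ) ≤ c' := by
      by_contra h
      exact hcy' (mem_maya_of_lt hN (not_le.1 h))
    obtain ⟨i, hi⟩ : ∃ i : ℕ, 2 * (i : ℤ) = c + N := ⟨((c + N) / 2).toNat, by omega⟩
    obtain ⟨j, hj⟩ : ∃ j : ℕ, 2 * (j : ℤ) + 1 = c' + N := ⟨((c' + N) / 2).toNat, by omega⟩
    have hiB : 2 * i ∈ beads y N := by
      rw [mem_beads_iff hN, show ((2 * i : ℕ) : ℤ) - N = c by push_cast; omega]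
      exact hcy
    have hjB : 2 * j + 1 ∉ beads y N := by
      rw [mem_beads_iff hN, show ((2 * j + 1 : ℕ) : ℤ) - N = c' by push_cast; omega]
      exact hcy'
    have hjB' : 2 * j + 1 ∉ (beads y N).erase (2 * i) := fun h => hjB (Finset.mem_of_mem_erase h)
    have hle := runners_le_sum (insert (2 * j + 1) ((beads y N).erase (2 * i)))
    have r0 : runner (insert (2 * j + 1) ((beads y N).erase (2 * i))) 0 =
        (runner (beads y N) 0).erase i := by
      ext k
      rw [mem_runner (by omega), Finset.mem_erase, mem_runner (by omega), Finset.mem_insert,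
        Finset.mem_erase]
      have : ¬ 2 * k + 0 = 2 * j + 1 := by omega
      have h2 : 2 * k + 0 ≠ 2 * i ↔ k ≠ i := by omega
      rw [h2]
      tauto
    have r1 : runner (insert (2 * j + 1) ((beads y N).erase (2 * i))) 1 =
        insert j (runner (beads y N) 1) := by
      ext k
      rw [mem_runner (by omega), Finset.mem_insert, Finset.mem_insert, mem_runner (by omega),
        Finset.mem_erase]
      have : 2 * k + 1 ≠ 2 * i := by omega
      have h2 : 2 * k + 1 = 2 * j + 1 ↔ k = j := by omega
      rw [h2]
      tauto
    have c0 : (((runner (beads y N) 0).erase i).card : ℤ) = (runner (beads y N) 0).card - 1 := by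
      have h := Finset.card_erase_add_one ((mem_runner (by omega)).2 hiB : i ∈ runner (beads y N) 0)
      omega
    have c1 : ((insert j (runner (beads y N) 1)).card : ℤ) = (runner (beads y N) 1).card + 1 := by
      rw [Finset.card_insert_of_notMem fun h => hjB ((mem_runner (by omega)).1 h)]
      push_cast
      ring
    have hsum := two_mul_sum_beads hN
    rw [r0, r1, c0, c1, Finset.sum_insert hjB'] at hle
    have herase := Finset.sum_erase_add (beads y N) (fun b : ℕ => (b : ℤ)) hiB
    push_cast at hle herase
    have hn : (runner (beads y N) 1).card = (runner (beads y N) 0).card + a := by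
      unfold posSign at hsub
      split_ifs at hsub <;> omega
    have hn0 : (runner (beads y N) 0).card = y.card := by omega
    rw [hn, hn0] at hle
    have hNa' : (N : ℤ) = 2 * y.card + a := by exact_mod_cast hNa
    rw [hNa'] at hsum
    push_cast at hle
    zify at hy
    have hij : (j : ℤ) + 1 ≤ i := by omega
    generalize ∑ b ∈ (beads y N).erase (2 * i), (b : ℤ) = E at hle herase
    linarith
  -- The threshold `m` is the lowest gap on the runner of the parity of `a + 1`.
  obtain ⟨m, hm1, hm2⟩ := Int.exists_least_of_bdd (P := fun z => 2 * z + 1 + (a : ℤ) ∉ maya y)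
    ⟨-(N : ℤ) - a, fun z hz => by
      by_contra h
      exact hz (mem_maya_of_lt hN (by omega))⟩
    ⟨y.card, fun h => by
      obtain ⟨i, hi⟩ := mem_maya.1 h
      have h1 := y.rowLen_anti 0 i (by omega)
      have h2 : y.rowLen 0 ≤ y.card := by
        by_contra h
        have := mem_lt_card y (c := (0, y.card)) ((YoungDiagram.mem_cells _).2
          (YoungDiagram.mem_iff_lt_rowLen.2 (not_le.1 h)))
        simp at this
      omega⟩
  refine ⟨m, fun z hz => ?_, fun z hz h => ?_⟩
  · by_contra h
    have := hm2 z h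
    omega
  · have := key _ _ (by omega) (by omega) h hm1
    omega

/-! ### Moves on one runner in terms of decreasing enumerations -/

/-- If the position below a moved bead is occupied by a bead that stays, two terms of `x` coincide;
strict decrease thus enforces the condition in `DownBy`. -/
theorem DownBy.of_enum {y x : ℕ → ℤ} (hy : StrictAnti y) (hx : StrictAnti x) {J : Finset ℕ}
    (h : ∀ i, y i = x i + if i ∈ J then 1 else 0) :
    DownBy (Set.range y) (Set.range x) (J.image y) := by
  have h1 : ∀ i ∈ J, y i = x i + 1 := fun i hi => by rw [h, if_pos hi]
  have h0 : ∀ i, i ∉ J → y i = x i := fun i hi => by rw [h, if_neg hi, add_zero]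
  refine ⟨fun k hk => ?_, ?_⟩
  · obtain ⟨i, hi, rfl⟩ := Finset.mem_image.1 hk
    refine ⟨⟨i, rfl⟩, ?_⟩
    by_cases hY : y i - 1 ∈ Set.range y
    · right
      obtain ⟨j, hj⟩ := hY
      refine Finset.mem_image.2 ⟨j, ?_, hj⟩
      by_contra hjJ
      have h2 := h0 j hjJ
      have h3 := h1 i hi
      have h4 : j = i := hx.injective (by omega)
      exact hjJ (h4 ▸ hi)
    · exact Or.inl hY
  · ext z
    simp only [shift, Set.mem_ofPred_eq, Finset.mem_image, Set.mem_range]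
    constructor
    · rintro ⟨i, rfl⟩
      by_cases hi : i ∈ J
      · exact Or.inr ⟨i, hi, h1 i hi⟩
      · refine Or.inl ⟨⟨i, h0 i hi⟩, ?_⟩
        rintro ⟨j, hj, hji⟩
        rw [← h0 i hi] at hji
        exact hi (hy.injective hji ▸ hj)
    · rintro (⟨⟨i, rfl⟩, hi⟩ | ⟨i, hi, hz⟩)
      · refine ⟨i, (h0 i fun hiJ => hi ⟨i, hiJ, rfl⟩).symm⟩
      · exact ⟨i, by have := h1 i hi; omega⟩

theorem DownBy.enum_top {x : ℕ → ℤ} (hx : StrictAnti x) {Y : Set ℤ} {S : Finset ℤ}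
    (h : DownBy Y (Set.range x) S) : ∃ (y : ℕ → ℤ) (J : Finset ℕ), StrictAnti y ∧
      Y = Set.range y ∧ S = J.image y ∧ ∀ i, y i = x i + if i ∈ J then 1 else 0 := by
  have hinj : Function.Injective fun i => x i + 1 := fun i j hij =>
    hx.injective (by simp only at hij; omega)
  let J := S.preimage (fun i => x i + 1) hinj.injOn
  have hJ : ∀ i, i ∈ J ↔ x i + 1 ∈ S := fun i => Finset.mem_preimage
  have hX : ∀ i, x i ∈ shift Y S := fun i => h.2 ▸ ⟨i, rfl⟩
  have hY1 : ∀ z ∈ S, ∃ i, x i + 1 = z := fun z hz => by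
    have : z - 1 ∈ Set.range x := by
      rw [h.2]
      exact Or.inr (by rwa [sub_add_cancel])
    obtain ⟨i, hi⟩ := this
    exact ⟨i, by omega⟩
  refine ⟨fun i => x i + if i ∈ J then 1 else 0, J, ?_, ?_, ?_, fun _ => rfl⟩
  · intro i j hij
    have hlt := hx hij
    by_cases hj : j ∈ J
    · by_cases hi : i ∈ J
      · simp only [if_pos hi, if_pos hj]; omega
      · simp only [if_neg hi, if_pos hj]
        -- The only danger is that a raised bead meets one which is not raised. Their common
        -- position would be both moved from and, being occupied in the lower configuration without
        -- a refill, not moved from.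
        rcases eq_or_ne (x j + 1) (x i) with he | he
        · rw [hJ] at hi hj
          rcases hX i with h1 | h1
          · exact absurd (he ▸ hj) h1.2
          · exact absurd h1 hi
        · omega
    · simp only [if_neg hj]
      split_ifs <;> omega
  · ext z
    constructor
    · intro hz
      by_cases hzS : z ∈ S
      · obtain ⟨i, rfl⟩ := hY1 z hzS
        exact ⟨i, by simp only [if_pos ((hJ i).2 hzS)]⟩
      · have : z ∈ Set.range x := by
          rw [h.2]
          exact Or.inl ⟨hz, hzS⟩
        obtain ⟨i, rfl⟩ := this
        refine ⟨i, ?_⟩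
        have hi : i ∉ J := fun hi => by
          have h1 := (h.1 _ ((hJ i).1 hi)).2
          rw [add_sub_cancel_right] at h1
          tauto
        simp only [if_neg hi, add_zero]
    · rintro ⟨i, rfl⟩
      simp only
      split_ifs with hi
      · exact (h.1 _ ((hJ i).1 hi)).1
      · rw [add_zero]
        rcases hX i with h1 | h1
        · exact h1.1
        · exact absurd ((hJ i).2 h1) hi
  · ext z
    rw [Finset.mem_image]
    constructor
    · intro hz
      obtain ⟨i, rfl⟩ := hY1 z hz
      have hi := (hJ i).2 hz
      exact ⟨i, hi, by simp only [if_pos hi]⟩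
    · rintro ⟨i, hi, rfl⟩
      simp only [if_pos hi]
      exact (hJ i).1 hi

theorem DownBy.enum_bot {y : ℕ → ℤ} (hy : StrictAnti y) {X : Set ℤ} {S : Finset ℤ}
    (h : DownBy (Set.range y) X S) : ∃ J : Finset ℕ, S = J.image y ∧
      X = Set.range fun i => y i - if i ∈ J then 1 else 0 := by
  let J := S.preimage y hy.injective.injOn
  have hJ : ∀ i, i ∈ J ↔ y i ∈ S := fun i => Finset.mem_preimage
  have hS : ∀ z ∈ S, ∃ i, y i = z := fun z hz => (h.1 z hz).1
  refine ⟨J, ?_, ?_⟩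
  · ext z
    rw [Finset.mem_image]
    constructor
    · intro hz
      obtain ⟨i, rfl⟩ := hS z hz
      exact ⟨i, (hJ i).2 hz, rfl⟩
    · rintro ⟨i, hi, rfl⟩
      exact (hJ i).1 hi
  · rw [h.2]
    ext z
    constructor
    · rintro (⟨⟨i, rfl⟩, hi⟩ | hz)
      · exact ⟨i, by simp only [if_neg fun h => hi ((hJ i).1 h), sub_zero]⟩
      · obtain ⟨i, hi⟩ := hS _ hz
        refine ⟨i, ?_⟩
        rw [← hi] at hz
        simp only [if_pos ((hJ i).2 hz)]
        omega
    · rintro ⟨i, rfl⟩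
      by_cases hi : i ∈ J
      · right
        simp only [if_pos hi, sub_add_cancel]
        exact (hJ i).1 hi
      · left
        simp only [if_neg hi, sub_zero]
        exact ⟨⟨i, rfl⟩, fun h => hi ((hJ i).2 h)⟩

/-! ### The Maya diagram of a staircase -/

/-- The beads of the staircase, in decreasing order. -/
def stairSeq (s i : ℕ) : ℤ := if i < s then (s : ℤ) - 1 - 2 * i else -i - 1

theorem stairSeq_of_lt {s i : ℕ} (h : i < s) : stairSeq s i = (s : ℤ) - 1 - 2 * i := if_pos h

theorem stairSeq_of_le {s i : ℕ} (h : s ≤ i) : stairSeq s i = -i - 1 := if_neg (not_lt.2 h)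

theorem maya_staircase (s : ℕ) : maya (staircase s) = Set.range (stairSeq s) := by
  unfold maya
  congr 1
  funext i
  rw [rowLen_staircase, stairSeq]
  split_ifs <;> omega

theorem mem_maya_staircase {s : ℕ} {z : ℤ} :
    z ∈ maya (staircase s) ↔ z < -s ∨ (z < s ∧ (z - s) % 2 = 1) := by
  rw [maya_staircase]
  constructor
  · rintro ⟨i, rfl⟩
    unfold stairSeq
    split_ifs <;> omega
  · intro h
    rcases lt_or_ge z (-s) with hz | hz
    · exact ⟨(-z - 1).toNat, by rw [stairSeq_of_le (by omega)]; omega⟩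
    · exact ⟨((s - 1 - z) / 2).toNat, by rw [stairSeq_of_lt (by omega)]; omega⟩

/-- The staircase with the beads of `C` moved down by one position. -/
def lowSeq (s : ℕ) (C : Finset ℕ) (i : ℕ) : ℤ := stairSeq s i - if i ∈ C then 1 else 0

theorem strictAnti_stairSeq (s : ℕ) : StrictAnti (stairSeq s) := by
  refine strictAnti_nat_of_succ_lt fun i => ?_
  unfold stairSeq
  split_ifs <;> omega

theorem strictAnti_lowSeq {s : ℕ} {C : Finset ℕ} (hC : C ⊆ Finset.range s) :
    StrictAnti (lowSeq s C) := by
  refine strictAnti_nat_of_succ_lt fun i => ?_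
  have h1 : i ∈ C → i < s := fun h => Finset.mem_range.1 (hC h)
  have h2 : i + 1 ∈ C → i + 1 < s := fun h => Finset.mem_range.1 (hC h)
  unfold lowSeq stairSeq
  push_cast
  by_cases hi : i ∈ C
  · have := h1 hi
    simp only [if_pos hi]
    split_ifs <;> omega
  · simp only [if_neg hi]
    split_ifs <;> omega

theorem stairSeq_eq_lowSeq_add (s : ℕ) (C : Finset ℕ) (i : ℕ) :
    stairSeq s i = lowSeq s C i + if i ∈ C then 1 else 0 := by
  rw [lowSeq, sub_add_cancel]

theorem downBy_lowSeq {s : ℕ} {C : Finset ℕ} (hC : C ⊆ Finset.range s) :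
    DownBy (Set.range (stairSeq s)) (Set.range (lowSeq s C)) (C.image (stairSeq s)) :=
  DownBy.of_enum (strictAnti_stairSeq s) (strictAnti_lowSeq hC) (stairSeq_eq_lowSeq_add s C)

theorem lowSeq_inj {s : ℕ} {C C' : Finset ℕ} (hC : C ⊆ Finset.range s) (hC' : C' ⊆ Finset.range s)
    (h : Set.range (lowSeq s C) = Set.range (lowSeq s C')) : C = C' := by
  have h1 := strictAnti_range_inj (strictAnti_lowSeq hC) (strictAnti_lowSeq hC') h
  ext i
  have h2 := congrFun h1 i
  unfold lowSeq at h2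
  split_ifs at h2 with h3 h4 h4
  · exact iff_of_true h3 h4
  · omega
  · omega
  · exact iff_of_false h3 h4

theorem exists_lowSeq {s : ℕ} {X : Set ℤ} {S : Finset ℤ}
    (h : DownBy (Set.range (stairSeq s)) X S) :
    ∃ C ⊆ Finset.range s, X = Set.range (lowSeq s C) ∧ S.card = C.card := by
  obtain ⟨C, rfl, hX⟩ := h.enum_bot (strictAnti_stairSeq s)
  refine ⟨C, fun i hi => ?_, hX,
    Finset.card_image_of_injective _ (strictAnti_stairSeq s).injective⟩
  have h1 := h.lt (m := -s) (fun z hz => by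
    rw [← maya_staircase, mem_maya_staircase]; exact Or.inl hz) _ (Finset.mem_image_of_mem _ hi)
  rw [Finset.mem_range]
  by_contra hs
  rw [stairSeq_of_le (not_lt.1 hs)] at h1
  omega

/-! ### The signed sum over one runner -/

open Classical in
/-- The signed number of ways to reach `Y` from a staircase by moving some beads down and then
some beads up. -/
def runnerSum (s : ℕ) (Y : Set ℤ) : ℚ :=
  ∑ C ∈ (Finset.range s).powerset,
    if ∃ S, DownBy Y (Set.range (lowSeq s C)) S then (-1) ^ C.card else 0

theorem exists_downBy_iff {s N : ℕ} {y : ℕ → ℤ} (hy : StrictAnti y)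
    (hN : ∀ i, N ≤ i → y i = stairSeq s i) {C : Finset ℕ} (hC : C ⊆ Finset.range s) :
    (∃ S, DownBy (Set.range y) (Set.range (lowSeq s C)) S) ↔
      ∀ i, y i = lowSeq s C i ∨ y i = lowSeq s C i + 1 := by
  constructor
  · rintro ⟨S, h⟩ i
    obtain ⟨y', J, hy', hr, -, h'⟩ := h.enum_top (strictAnti_lowSeq hC)
    have := strictAnti_range_inj hy hy' hr
    rw [this, h']
    split_ifs
    · exact Or.inr rfl
    · exact Or.inl (add_zero _)
  · intro h
    refine ⟨_, DownBy.of_enum hy (strictAnti_lowSeq hC)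
      -- Beyond `N + s` both sequences agree with the staircase, so the cut-off only makes the set
      -- of raised beads finite.
      (J := (Finset.range (N + s)).filter fun i => y i ≠ lowSeq s C i) fun i => ?_⟩
    split_ifs with hi
    · exact (h i).resolve_left (Finset.mem_filter.1 hi).2
    · rw [Finset.mem_filter, Finset.mem_range, not_and, not_not] at hi
      rw [add_zero]
      by_cases hiN : i < N + s
      · exact hi hiN
      · have hiC : i ∉ C := fun h => by have := Finset.mem_range.1 (hC h); omega
        rw [hN i (by omega), lowSeq, if_neg hiC, sub_zero]

/-- Toggling `i` in `C` is a sign-reversing involution: from the original position of bead `i`, both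
lowering it and raising it back, and leaving it alone, are possible. -/
theorem runnerSum_eq_zero {s N : ℕ} {y : ℕ → ℤ} (hy : StrictAnti y)
    (hN : ∀ i, N ≤ i → y i = stairSeq s i) {i : ℕ} (hi : i < s) (h : y i = stairSeq s i) :
    runnerSum s (Set.range y) = 0 := by
  classical
  have hi' := Finset.mem_range.2 hi
  have key : ∀ C ⊆ Finset.range s, ((∀ j, y j = lowSeq s (insert i C) j ∨
      y j = lowSeq s (insert i C) j + 1) ↔ ∀ j, y j = lowSeq s C j ∨ y j = lowSeq s C j + 1) := by
    intro C _
    refine forall_congr' fun j => ?_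
    unfold lowSeq
    rcases eq_or_ne j i with rfl | hj
    · rw [if_pos (Finset.mem_insert_self _ _), h]
      split_ifs <;> omega
    · simp only [Finset.mem_insert, hj, false_or]
  rw [runnerSum, ← Finset.insert_erase hi', Finset.sum_powerset_insert (Finset.notMem_erase _ _),
    ← Finset.sum_add_distrib]
  refine Finset.sum_eq_zero fun C hC => ?_
  rw [Finset.mem_powerset] at hC
  have hC' := hC.trans (Finset.erase_subset _ _)
  have hiC : i ∉ C := fun h => Finset.notMem_erase _ _ (hC h)
  rw [exists_downBy_iff hy hN hC', exists_downBy_iff hy hN (Finset.insert_subset hi' hC'),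
    key C hC', Finset.card_insert_of_notMem hiC]
  split_ifs <;> ring

/-- When no bead `i < s` is at its original position, whether `i` lies in `C` is decided by the
direction in which that bead has moved, so one term remains. -/
theorem runnerSum_eq {s N : ℕ} {y : ℕ → ℤ} (hy : StrictAnti y)
    (hN : ∀ i, N ≤ i → y i = stairSeq s i) (h : ∀ i < s, y i ≠ stairSeq s i) {C : Finset ℕ}
    (hC : C ⊆ Finset.range s) (hyC : ∀ i, y i = lowSeq s C i ∨ y i = lowSeq s C i + 1) :
    runnerSum s (Set.range y) = (-1) ^ C.card := by
  classical
  rw [runnerSum, Finset.sum_eq_single_of_mem C (Finset.mem_powerset.2 hC),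
    if_pos ((exists_downBy_iff hy hN hC).2 hyC)]
  intro C' hC' hne
  rw [Finset.mem_powerset] at hC'
  refine if_neg fun h' => hne ?_
  rw [exists_downBy_iff hy hN hC'] at h'
  ext i
  by_cases hi : i < s
  · have h1 := h i hi
    have h2 := hyC i
    have h3 := h' i
    unfold lowSeq at h2 h3
    split_ifs at h2 h3 with h4 h5 h5
    · exact iff_of_true h5 h4
    · omega
    · omega
    · exact iff_of_false h5 h4
  · exact iff_of_false (fun h => hi (Finset.mem_range.1 (hC' h)))
      fun h => hi (Finset.mem_range.1 (hC h))

/-- By the cancellation, among the first `s` beads exactly those outside `C` are raised in the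
second stage, which gives the count of moves. The set `J` records the raised beads of the densely
packed tail. -/
theorem exists_of_runnerSum_ne_zero {s : ℕ} {Y : Set ℤ} (h : runnerSum s Y ≠ 0) :
    ∃ (y : ℕ → ℤ) (C J : Finset ℕ) (S : Finset ℤ), Y = Set.range y ∧ C ⊆ Finset.range s ∧
      DownBy Y (Set.range (lowSeq s C)) S ∧
      (∀ i < s, y i = stairSeq s i + if i ∈ C then -1 else 1) ∧
      (∀ i, s ≤ i → y i = stairSeq s i + if i ∈ J then 1 else 0) ∧
      S.card + C.card = s + J.card ∧ (J.Nonempty → C = ∅ ∧ s ∈ J) := by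
  classical
  obtain ⟨C, hC, hCne⟩ := Finset.exists_ne_zero_of_sum_ne_zero h
  rw [Finset.mem_powerset] at hC
  obtain ⟨S, hS⟩ : ∃ S, DownBy Y (Set.range (lowSeq s C)) S := by
    by_contra hn
    exact hCne (if_neg hn)
  obtain ⟨y, K, hy, rfl, hSK, hyK⟩ := hS.enum_top (strictAnti_lowSeq hC)
  obtain ⟨N, hN⟩ : ∃ N, ∀ i, N ≤ i → y i = stairSeq s i := by
    obtain ⟨N, hN⟩ := K.bddAbove
    refine ⟨N + 1 + s, fun i hi => ?_⟩
    have h1 : i ∉ K := fun h => by have : i ≤ N := hN h; omega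
    have h2 : i ∉ C := fun h => by have := Finset.mem_range.1 (hC h); omega
    rw [hyK, lowSeq, if_neg h1, if_neg h2, add_zero, sub_zero]
  have hne : ∀ i < s, y i ≠ stairSeq s i := fun i hi he => h (runnerSum_eq_zero hy hN hi he)
  have hK : ∀ i < s, (i ∈ K ↔ i ∉ C) := by
    intro i hi
    have h1 := hne i hi
    have h2 := hyK i
    unfold lowSeq at h2
    split_ifs at h2 with h3 h4 h4
    · omega
    · exact iff_of_false h4 (not_not.2 h3)
    · exact iff_of_true h4 h3
    · omega
  have hlow : ∀ i < s, y i = stairSeq s i + if i ∈ C then -1 else 1 := by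
    intro i hi
    rw [hyK, lowSeq]
    by_cases hiC : i ∈ C
    · rw [if_pos hiC, if_pos hiC, if_neg fun h => (hK i hi).1 h hiC]; ring
    · rw [if_neg hiC, if_neg hiC, if_pos ((hK i hi).2 hiC)]; ring
  have hhigh : ∀ i, s ≤ i → y i = stairSeq s i + if i ∈ K.filter (s ≤ ·) then 1 else 0 := by
    intro i hi
    have h2 : i ∉ C := fun h => by have := Finset.mem_range.1 (hC h); omega
    simp only [Finset.mem_filter, hi, and_true]
    rw [hyK, lowSeq, if_neg h2, sub_zero]
  refine ⟨y, C, K.filter (s ≤ ·), S, rfl, hC, hS, hlow, hhigh, ?_, ?_⟩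
  · rw [hSK, Finset.card_image_of_injective _ hy.injective,
      ← Finset.card_filter_add_card_filter_not (s := K) (s ≤ ·)]
    have : K.filter (fun i => ¬ s ≤ i) = Finset.range s \ C := by
      ext i
      simp only [Finset.mem_filter, Finset.mem_sdiff, Finset.mem_range, not_le]
      have := hK i
      tauto
    have h2 := Finset.card_sdiff_add_card_eq_card hC
    rw [Finset.card_range] at h2
    rw [this]
    omega
  · rintro ⟨j, hj⟩
    obtain ⟨-, hsj⟩ := Finset.mem_filter.1 hj
    -- Beads in the tail are adjacent, so one can rise only if its upper neighbour does.
    have hdown : ∀ k, s + k ∈ K.filter (s ≤ ·) → s ∈ K.filter (s ≤ ·) := by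
      intro k
      induction k with
      | zero => exact id
      | succ k ih =>
        intro hk
        apply ih
        by_contra hn
        have h1 := hhigh (s + k + 1) (by omega)
        have h2 := hhigh (s + k) (by omega)
        rw [if_pos (by simpa [add_assoc] using hk), stairSeq_of_le (by omega)] at h1
        rw [if_neg hn, stairSeq_of_le (by omega)] at h2
        have h3 := hy (show s + k < s + k + 1 by omega)
        push_cast at h1 h2
        omega
    have hs := hdown (j - s) (by rwa [Nat.add_sub_cancel' hsj])
    refine ⟨?_, hs⟩
    -- Bead `s`, once raised, occupies the place into which bead `s - 1` would drop, so bead `s - 1`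
    -- must rise. It then blocks bead `s - 2` in the same way, and so on up to bead `0`.
    have hup : ∀ k, k < s → s - 1 - k ∉ C := by
      intro k
      induction k with
      | zero =>
        intro hk hC'
        have h1 := hhigh s le_rfl
        have h2 := hlow (s - 1 - 0) (by omega)
        rw [if_pos hs, stairSeq_of_le le_rfl] at h1
        rw [if_pos hC', stairSeq_of_lt (by omega)] at h2
        have h3 := hy (show s - 1 - 0 < s by omega)
        omega
      | succ k ih =>
        intro hk hC'
        have h1 := hlow (s - 1 - k) (by omega)
        have h2 := hlow (s - 1 - (k + 1)) (by omega)
        rw [if_neg (ih (by omega)), stairSeq_of_lt (by omega)] at h1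
        rw [if_pos hC', stairSeq_of_lt (by omega)] at h2
        have h3 := hy (show s - 1 - (k + 1) < s - 1 - k by omega)
        omega
    refine Finset.eq_empty_of_forall_notMem fun i hi => ?_
    have := Finset.mem_range.1 (hC hi)
    exact hup (s - 1 - i) (by omega) (by rwa [show s - 1 - (s - 1 - i) = i by omega])

/-! ### The two-runner expansion -/

theorem card_staircase (s : ℕ) : 2 * (staircase s).card = s * (s + 1) := by
  rw [card_eq_sum_rowLen (N := s) _ (by rw [rowLen_staircase]; omega)]
  simp only [rowLen_staircase]
  induction s with
  | zero => simp
  | succ s ih =>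
    rw [Finset.sum_range_succ']
    simp only [Nat.add_sub_add_right]
    rw [mul_add, ih]
    simp only [tsub_zero]
    ring

/-- Reading gaps downwards amounts to conjugating the quotient component, and a staircase equals its
conjugate. -/
theorem runners_of_spec {ν : YoungDiagram} {a s r : ℕ}
    (h : HasCoreQuotient ν (staircase a) (staircase r) (staircase s)) :
    runnerP a (maya ν) = Set.range (stairSeq s) ∧ runnerQ a (maya ν) = Set.range (stairSeq r) := by
  obtain ⟨h1, h2, -⟩ := h.spec
  rw [← maya_staircase, ← maya_staircase]
  refine ⟨Set.ext h1, Set.ext fun z => ?_⟩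
  have h3 := h2 (-1 - z)
  rw [show 2 * (-1 - z) - (a : ℤ) = -(2 * z + 2 + a) by ring] at h3
  simp only [runnerQ, Set.mem_ofPred_eq, h3, mem_maya_staircase]
  omega

theorem content_of_doubleE_ne_zero {a : ℤ} {n : ℕ} {x y : YoungDiagram}
    (h : doubleE a n (Finsupp.single y 1) x ≠ 0) :
    content y = Multiset.replicate n ((a + 1 : ℤ) : ZMod 2) +
      (Multiset.replicate n ((a : ℤ) : ZMod 2) + content x) := by
  classical
  rw [doubleE_single, Finsupp.finsetSum_apply] at h
  obtain ⟨S, hS, h⟩ := Finset.exists_ne_zero_of_sum_ne_zero h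
  rw [Finsupp.finsetSum_apply] at h
  obtain ⟨T, hT, h⟩ := Finset.exists_ne_zero_of_sum_ne_zero h
  obtain ⟨hS, cS⟩ := Finset.mem_powersetCard.1 hS
  obtain ⟨hT, cT⟩ := Finset.mem_powersetCard.1 hT
  have hx : remove (remove y S) T = x := by
    by_contra hne
    exact h (Finsupp.single_eq_of_ne' hne)
  rw [(remove_spec hS).2, (remove_spec hT).2, hx, cS, cT]

theorem card_of_content {a : ℤ} {n : ℕ} {x y : YoungDiagram}
    (h : content y = Multiset.replicate n ((a + 1 : ℤ) : ZMod 2) +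
      (Multiset.replicate n ((a : ℤ) : ZMod 2) + content x)) : y.card = 2 * n + x.card := by
  have h := congrArg Multiset.card h
  rw [Multiset.card_add, Multiset.card_add, Multiset.card_replicate, Multiset.card_replicate,
    card_content, card_content] at h
  omega

theorem defect_of_content {a : ℤ} {n : ℕ} {x y : YoungDiagram}
    (h : content y = Multiset.replicate n ((a + 1 : ℤ) : ZMod 2) +
      (Multiset.replicate n ((a : ℤ) : ZMod 2) + content x)) : defect y = defect x := by
  rw [defect, h, Multiset.map_add, Multiset.map_add, Multiset.sum_add, Multiset.sum_add,
    Multiset.map_replicate, Multiset.map_replicate, Multiset.sum_replicate,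
    Multiset.sum_replicate, resSign_intCast, resSign_intCast, defect, ← add_assoc, ← smul_add,
    posSign_add]
  rw [show posSign 1 = -1 from posSign_of_odd rfl]
  simp

/-- The pairs of sets of beads which can be moved down, with `n` beads in total. -/
def movePairs (s r n : ℕ) : Finset (Finset ℕ × Finset ℕ) :=
  ((Finset.range s).powerset ×ˢ (Finset.range r).powerset).filter
    fun C => C.1.card + C.2.card = n

theorem mem_movePairs {s r n : ℕ} {C : Finset ℕ × Finset ℕ} : C ∈ movePairs s r n ↔
    (C.1 ⊆ Finset.range s ∧ C.2 ⊆ Finset.range r) ∧ C.1.card + C.2.card = n := by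
  rw [movePairs, Finset.mem_filter, Finset.mem_product, Finset.mem_powerset, Finset.mem_powerset]

/-- The diagram with the runners described by the sets `C.1` and `C.2`. -/
def IsLowered (a : ℤ) (s r : ℕ) (C : Finset ℕ × Finset ℕ) (x : YoungDiagram) : Prop :=
  runnerP a (maya x) = Set.range (lowSeq s C.1) ∧ runnerQ a (maya x) = Set.range (lowSeq r C.2)

section

variable {a m : ℤ} {s r : ℕ} {lam : YoungDiagram}

theorem strip_of_isLowered (hP : runnerP a (maya lam) = Set.range (stairSeq s))
    (hQ : runnerQ a (maya lam) = Set.range (stairSeq r)) {n : ℕ} {C : Finset ℕ × Finset ℕ}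
    (hC : C ∈ movePairs s r n) {x : YoungDiagram} (hx : IsLowered a s r C x) :
    Strip a lam x n := by
  obtain ⟨⟨h1, h2⟩, h3⟩ := mem_movePairs.1 hC
  refine ⟨_, _, hP ▸ hx.1 ▸ downBy_lowSeq h1, hQ ▸ hx.2 ▸ downBy_lowSeq h2, ?_⟩
  rw [Finset.card_image_of_injective _ (strictAnti_stairSeq s).injective,
    Finset.card_image_of_injective _ (strictAnti_stairSeq r).injective, h3]

theorem exists_isLowered (hM : RockAt a m (maya lam))
    (hP : runnerP a (maya lam) = Set.range (stairSeq s))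
    (hQ : runnerQ a (maya lam) = Set.range (stairSeq r)) {C : Finset ℕ × Finset ℕ}
    (h1 : C.1 ⊆ Finset.range s) (h2 : C.2 ⊆ Finset.range r) : ∃ x, IsLowered a s r C x :=
  exists_strip hM (hP ▸ downBy_lowSeq h1) (hQ ▸ downBy_lowSeq h2)

theorem doubleE_lam (hM : RockAt a m (maya lam))
    (hP : runnerP a (maya lam) = Set.range (stairSeq s))
    (hQ : runnerQ a (maya lam) = Set.range (stairSeq r))
    {xC : Finset ℕ × Finset ℕ → YoungDiagram}
    (hx : ∀ C : Finset ℕ × Finset ℕ, C.1 ⊆ Finset.range s → C.2 ⊆ Finset.range r →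
      IsLowered a s r C (xC C)) (n : ℕ) :
    doubleE a n (Finsupp.single lam 1) = ∑ C ∈ movePairs s r n, Finsupp.single (xC C) 1 := by
  classical
  ext x
  rw [doubleE_apply hM, Finsupp.finsetSum_apply]
  simp_rw [Finsupp.single_apply]
  split_ifs with h
  · obtain ⟨Sp, Sq, hp, hq, hn⟩ := h
    rw [hP] at hp
    rw [hQ] at hq
    obtain ⟨C1, hC1, e1, c1⟩ := exists_lowSeq hp
    obtain ⟨C2, hC2, e2, c2⟩ := exists_lowSeq hq
    have hmem : (C1, C2) ∈ movePairs s r n := mem_movePairs.2 ⟨⟨hC1, hC2⟩, by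
      change C1.card + C2.card = n
      omega⟩
    obtain ⟨x1, x2⟩ := hx (C1, C2) hC1 hC2
    rw [Finset.sum_eq_single_of_mem _ hmem,
      if_pos (maya_injective (ext_runners (x1.trans e1.symm) (x2.trans e2.symm)))]
    rintro ⟨D1, D2⟩ hD hne
    obtain ⟨⟨hD1, hD2⟩, -⟩ := mem_movePairs.1 hD
    refine if_neg fun hxD => hne ?_
    obtain ⟨y1, y2⟩ := hx (D1, D2) hD1 hD2
    rw [hxD] at y1 y2
    exact Prod.ext (lowSeq_inj hD1 hC1 (y1.symm.trans e1)) (lowSeq_inj hD2 hC2 (y2.symm.trans e2))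
  · symm
    refine Finset.sum_eq_zero fun C hC => if_neg ?_
    rintro rfl
    obtain ⟨⟨hC1, hC2⟩, -⟩ := mem_movePairs.1 hC
    exact h (strip_of_isLowered hP hQ hC (hx C hC1 hC2))

/-- The formal sum of diagrams which corresponds to the value of `R_ε^{(d)}` on `lam`. -/
def redist (a d : ℤ) (lam : YoungDiagram) : Fock :=
  ∑ n ∈ Finset.range (lam.card + 1),
    if 0 ≤ (n : ℤ) + d then
      (-1 : ℚ) ^ ((n : ℤ) + d).toNat •
        divPowF (fF ((a + 1 : ℤ) : ZMod 2)) ((n : ℤ) + d).toNat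
          (divPowF (fF ((a : ℤ) : ZMod 2)) ((n : ℤ) + d).toNat
            (doubleE a n (Finsupp.single lam 1)))
    else 0

/-- Adjointness turns the two powers of `f` into powers of `e` applied to `y`; their order is
reversed, which gives `doubleE` again. -/
theorem redist_apply (d : ℤ) (y : YoungDiagram) :
    redist a d lam y = ∑ n ∈ Finset.range (lam.card + 1),
      if 0 ≤ (n : ℤ) + d then
        (-1 : ℚ) ^ ((n : ℤ) + d).toNat *
          dot (doubleE a ((n : ℤ) + d).toNat (Finsupp.single y 1))
            (doubleE a n (Finsupp.single lam 1))
      else 0 := by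
  have hv : ∀ v : Fock, v y = dot (Finsupp.single y 1) v := fun v => by
    rw [dot_comm, dot_single, one_mul]
  rw [redist, Finsupp.finsetSum_apply]
  refine Finset.sum_congr rfl fun n _ => ?_
  split_ifs with h
  · rw [Finsupp.smul_apply, smul_eq_mul]
    congr 1
    rw [hv, dot_divPowF_fF, dot_divPowF_fF]
    rfl
  · rfl

theorem doubleE_eq_zero {n : ℕ} (h : lam.card < n) : doubleE a n (Finsupp.single lam 1) = 0 := by
  ext x
  by_contra hne
  have := card_of_content (content_of_doubleE_ne_zero hne)
  omega

theorem quotRed_specht (d : ℤ) :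
    quotRed ((a : ZMod 2) + 1) d (specht lam) = spechtLin (redist a d lam) := by
  have e1 : (1 : ZMod 2) - ((a : ZMod 2) + 1) = (a : ZMod 2) := by
    generalize (a : ZMod 2) = t
    revert t
    decide
  have e2 : (a : ZMod 2) + 1 = ((a + 1 : ℤ) : ZMod 2) := by push_cast; rfl
  rw [quotRed, e1, e2, ← spechtLin_single]
  simp_rw [divPow_spechtLin (e_spechtLin _), divPow_spechtLin (f_spechtLin _)]
  change ∑ᶠ (n : ℕ) (_ : 0 ≤ (n : ℤ) + d), (-1 : ℚ) ^ ((n : ℤ) + d).toNat •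
      spechtLin (divPowF (fF ((a + 1 : ℤ) : ZMod 2)) ((n : ℤ) + d).toNat
        (divPowF (fF ((a : ℤ) : ZMod 2)) ((n : ℤ) + d).toNat
          (doubleE a n (Finsupp.single lam 1)))) = _
  simp_rw [finsum_eq_if]
  rw [finsum_eq_finsetSum_of_support_subset (s := Finset.range (lam.card + 1)), redist, map_sum]
  · refine Finset.sum_congr rfl fun n _ => ?_
    split_ifs
    · rw [map_smul]
    · rw [map_zero]
  · intro n hn
    rw [Finset.coe_range, Set.mem_Iio]
    by_contra hlt
    apply hn
    -- Each application of `doubleE a n` removes `2 * n` nodes, so all terms with `n` beyond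
    -- `lam.card` vanish.
    beta_reduce
    rw [doubleE_eq_zero (show lam.card < n by omega)]
    simp

theorem redist_apply_eq_sum (hM : RockAt a m (maya lam))
    (hP : runnerP a (maya lam) = Set.range (stairSeq s))
    (hQ : runnerQ a (maya lam) = Set.range (stairSeq r))
    {xC : Finset ℕ × Finset ℕ → YoungDiagram}
    (hx : ∀ C : Finset ℕ × Finset ℕ, C.1 ⊆ Finset.range s → C.2 ⊆ Finset.range r →
      IsLowered a s r C (xC C)) (d : ℤ) (y : YoungDiagram) :
    redist a d lam y = ∑ n ∈ Finset.range (lam.card + 1), ∑ C ∈ movePairs s r n,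
      if 0 ≤ (n : ℤ) + d then
        (-1 : ℚ) ^ ((n : ℤ) + d).toNat *
          doubleE a ((n : ℤ) + d).toNat (Finsupp.single y 1) (xC C)
      else 0 := by
  rw [redist_apply]
  refine Finset.sum_congr rfl fun n _ => ?_
  split_ifs with h
  · rw [doubleE_lam hM hP hQ hx, map_sum, Finset.mul_sum]
    refine Finset.sum_congr rfl fun C _ => ?_
    rw [dot_single, one_mul]
  · rw [Finset.sum_const_zero]

/-- A pair `C` occurs only for `n = C.1.card + C.2.card`, and the size of `y` forces the return to
use exactly `n + d` moves. The constraints on the numbers of moves thus disappear, leaving an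
unrestricted sum over pairs of subsets, with a sign that is multiplicative over the runners. -/
theorem redist_apply_eq_mul (hM : RockAt a m (maya lam))
    (hP : runnerP a (maya lam) = Set.range (stairSeq s))
    (hQ : runnerQ a (maya lam) = Set.range (stairSeq r)) {d m' : ℤ} {y : YoungDiagram}
    (hy : RockAt a m' (maya y)) (hc : (y.card : ℤ) = lam.card + 2 * d) :
    redist a d lam y = (-1) ^ d.natAbs *
      (runnerSum s (runnerP a (maya y)) * runnerSum r (runnerQ a (maya y))) := by
  classical
  have hex : ∀ C : Finset ℕ × Finset ℕ, ∃ x, C.1 ⊆ Finset.range s → C.2 ⊆ Finset.range r →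
      IsLowered a s r C x := by
    intro C
    by_cases h : C.1 ⊆ Finset.range s ∧ C.2 ⊆ Finset.range r
    · obtain ⟨x, hx⟩ := exists_isLowered hM hP hQ h.1 h.2
      exact ⟨x, fun _ _ => hx⟩
    · exact ⟨lam, fun h1 h2 => absurd ⟨h1, h2⟩ h⟩
  choose xC hx using hex
  have hsize : ∀ {n : ℕ} {C : Finset ℕ × Finset ℕ}, C ∈ movePairs s r n →
      lam.card = 2 * n + (xC C).card := fun hC =>
    card_of_content ((strip_of_isLowered hP hQ hC
      (hx _ (mem_movePairs.1 hC).1.1 (mem_movePairs.1 hC).1.2)).content_eq hM)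
  let g : Finset ℕ × Finset ℕ → ℚ := fun C => (-1) ^ d.natAbs *
    ((if ∃ S, DownBy (runnerP a (maya y)) (Set.range (lowSeq s C.1)) S then (-1) ^ C.1.card else 0) *
     (if ∃ S, DownBy (runnerQ a (maya y)) (Set.range (lowSeq r C.2)) S then (-1) ^ C.2.card else 0))
  have hg : ∀ n, ∀ C ∈ movePairs s r n, (if 0 ≤ (n : ℤ) + d then
        (-1 : ℚ) ^ ((n : ℤ) + d).toNat *
          doubleE a ((n : ℤ) + d).toNat (Finsupp.single y 1) (xC C)
      else 0) = g C := by
    intro n C hC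
    obtain ⟨⟨h1, h2⟩, h3⟩ := mem_movePairs.1 hC
    obtain ⟨x1, x2⟩ := hx C h1 h2
    have hs := hsize hC
    rw [doubleE_apply hy]
    by_cases hboth : (∃ S, DownBy (runnerP a (maya y)) (Set.range (lowSeq s C.1)) S) ∧
        ∃ S, DownBy (runnerQ a (maya y)) (Set.range (lowSeq r C.2)) S
    · simp only [g]
      rw [if_pos hboth.1, if_pos hboth.2]
      obtain ⟨⟨Sp, hp⟩, ⟨Sq, hq⟩⟩ := hboth
      rw [← x1] at hp
      rw [← x2] at hq
      have hstrip : Strip a y (xC C) (Sp.card + Sq.card) := ⟨Sp, Sq, hp, hq, rfl⟩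
      have hk := card_of_content (hstrip.content_eq hy)
      have hnd : ((n : ℤ) + d).toNat = Sp.card + Sq.card := by omega
      rw [if_pos (by omega), hnd, if_pos hstrip, mul_one, ← pow_add, ← pow_add]
      apply neg_one_pow_congr
      rw [Nat.even_iff, Nat.even_iff]
      omega
    · have hnot : ¬ Strip a y (xC C) ((n : ℤ) + d).toNat := by
        rintro ⟨Sp, Sq, hp, hq, -⟩
        rw [x1] at hp
        rw [x2] at hq
        exact hboth ⟨⟨_, hp⟩, ⟨_, hq⟩⟩
      rw [if_neg hnot, mul_zero, ite_self]
      simp only [g]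
      rcases not_and_or.1 hboth with h | h
      · rw [if_neg h, zero_mul, mul_zero]
      · rw [if_neg h, mul_zero, mul_zero]
  rw [redist_apply_eq_sum hM hP hQ hx,
    Finset.sum_congr rfl fun n _ => Finset.sum_congr rfl (hg n)]
  unfold movePairs
  rw [Finset.sum_fiberwise_of_maps_to (g := fun C : Finset ℕ × Finset ℕ => C.1.card + C.2.card),
    Finset.sum_product, runnerSum, runnerSum, Finset.sum_mul_sum, Finset.mul_sum]
  · refine Finset.sum_congr rfl fun C1 _ => ?_
    rw [Finset.mul_sum]
  · intro C hC
    rw [Finset.mem_product, Finset.mem_powerset, Finset.mem_powerset] at hC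
    have := hsize (mem_movePairs.2 ⟨hC, rfl⟩)
    rw [Finset.mem_range]
    omega

theorem content_of_redist_ne_zero {d : ℤ} {y : YoungDiagram}
    (h : redist a d lam y ≠ 0) :
    (y.card : ℤ) = lam.card + 2 * d ∧ defect y = defect lam := by
  rw [redist_apply] at h
  obtain ⟨n, -, h⟩ := Finset.exists_ne_zero_of_sum_ne_zero h
  split_ifs at h with hnd
  · obtain ⟨x, hy, hl⟩ : ∃ x, doubleE a ((n : ℤ) + d).toNat (Finsupp.single y 1) x ≠ 0 ∧
        doubleE a n (Finsupp.single lam 1) x ≠ 0 := by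
      by_contra! hne
      apply h
      rw [dot, Finsupp.linearCombination_apply, Finsupp.sum, Finset.sum_eq_zero, mul_zero]
      intro x _
      by_cases hx : doubleE a ((n : ℤ) + d).toNat (Finsupp.single y 1) x = 0
      · rw [hx, smul_zero]
      · rw [hne x hx, zero_smul]
    have cy := content_of_doubleE_ne_zero hy
    have cl := content_of_doubleE_ne_zero hl
    have := card_of_content cy
    have := card_of_content cl
    exact ⟨by omega, (defect_of_content cy).trans (defect_of_content cl).symm⟩
  · exact absurd rfl h

end

/-! ### Evaluation on staircases and uniqueness of the surviving partition -/

theorem runnerSum_pred {s : ℕ} (hs : 0 < s) :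
    runnerSum s (Set.range (stairSeq (s - 1))) = (-1) ^ s := by
  rw [runnerSum_eq (strictAnti_stairSeq _) (N := s) (C := Finset.range s) _ _ subset_rfl,
    Finset.card_range]
  · intro i
    left
    simp only [lowSeq, stairSeq, Finset.mem_range]
    split_ifs <;> omega
  · intro i hi
    unfold stairSeq
    split_ifs <;> omega
  · intro i hi
    unfold stairSeq
    split_ifs <;> omega

theorem runnerSum_succ (r : ℕ) : runnerSum r (Set.range (stairSeq (r + 1))) = 1 := by
  rw [runnerSum_eq (strictAnti_stairSeq _) (N := r + 1) (C := ∅) _ _ (Finset.empty_subset _),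
    Finset.card_empty, pow_zero]
  · intro i
    simp only [lowSeq, stairSeq, Finset.notMem_empty, if_false]
    push_cast
    split_ifs <;> omega
  · intro i hi
    unfold stairSeq
    push_cast
    split_ifs <;> omega
  · intro i hi
    unfold stairSeq
    push_cast
    split_ifs <;> omega

/-- Combining the counts of moves on both runners with the prescribed size of `y` gives `2 * s +
J1.card + J2.card = 1 + 2 * C1.card + 2 * C2.card`, where `C1.card ≤ s` and `C2.card ≤ r < s`. -/
theorem runners_eq_of_ne_zero {s r : ℕ} (hrs : r < s) {a m : ℤ} {lam y : YoungDiagram}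
    (hM : RockAt a m (maya lam))
    (hP : runnerP a (maya lam) = Set.range (stairSeq s))
    (hQ : runnerQ a (maya lam) = Set.range (stairSeq r)) {m' : ℤ}
    (hy : RockAt a m' (maya y)) (hc : (y.card : ℤ) = lam.card + 2 * (r + 1 - s))
    (h1 : runnerSum s (runnerP a (maya y)) ≠ 0) (h2 : runnerSum r (runnerQ a (maya y)) ≠ 0) :
    runnerP a (maya y) = Set.range (stairSeq (s - 1)) ∧
      runnerQ a (maya y) = Set.range (stairSeq (r + 1)) := by
  obtain ⟨y1, C1, J1, S1, e1, hC1, hS1, l1, g1, c1, j1⟩ := exists_of_runnerSum_ne_zero h1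
  obtain ⟨y2, C2, J2, S2, e2, hC2, hS2, l2, g2, c2, j2⟩ := exists_of_runnerSum_ne_zero h2
  have k1 := Finset.card_le_card hC1
  have k2 := Finset.card_le_card hC2
  rw [Finset.card_range] at k1 k2
  obtain ⟨x, hx⟩ := exists_isLowered hM hP hQ (C := (C1, C2)) hC1 hC2
  have sy : Strip a y x (S1.card + S2.card) := ⟨S1, S2, hx.1 ▸ hS1, hx.2 ▸ hS2, rfl⟩
  have sl : Strip a lam x (C1.card + C2.card) :=
    strip_of_isLowered hP hQ (mem_movePairs.2 ⟨⟨hC1, hC2⟩, rfl⟩) hx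
  have n1 := card_of_content (sy.content_eq hy)
  have n2 := card_of_content (sl.content_eq hM)
  -- If `J1` were nonempty, `C1` would be empty and the right side at most `1 + 2 * r`, less than `2
  -- * s`.
  have hJ1 : J1 = ∅ := by
    by_contra hne
    have h := (j1 (Finset.nonempty_iff_ne_empty.2 hne)).1
    rw [h, Finset.card_empty] at c1 n2
    omega
  rw [hJ1, Finset.card_empty] at c1
  -- With `J1` empty, parity makes `J2.card` odd. Then `C2` is empty, and the equation forces
  -- `J2.card = 1` and `C1.card = s`.
  have hJ2 : J2.Nonempty := by
    rw [Finset.nonempty_iff_ne_empty]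
    intro h
    rw [h, Finset.card_empty] at c2
    omega
  obtain ⟨hC2', hr⟩ := j2 hJ2
  rw [hC2', Finset.card_empty] at c2 n2
  have hpos := Finset.card_pos.2 hJ2
  have hJ2' : J2 = {r} := by
    obtain ⟨t, ht⟩ := Finset.card_eq_one.1 (show J2.card = 1 by omega)
    rw [ht, Finset.mem_singleton] at hr
    rw [ht, hr]
  have hC1' : C1 = Finset.range s :=
    Finset.eq_of_subset_of_card_le hC1 (by rw [Finset.card_range]; omega)
  constructor
  · rw [e1]
    congr 1
    funext i
    rcases lt_or_ge i s with hi | hi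
    · rw [l1 i hi, hC1', if_pos (Finset.mem_range.2 hi)]
      unfold stairSeq
      split_ifs <;> omega
    · rw [g1 i hi, hJ1, if_neg (Finset.notMem_empty _)]
      unfold stairSeq
      split_ifs <;> omega
  · rw [e2]
    congr 1
    funext i
    rcases lt_or_ge i r with hi | hi
    · rw [l2 i hi, hC2', if_neg (Finset.notMem_empty _)]
      unfold stairSeq
      push_cast
      split_ifs <;> omega
    · rw [g2 i hi, hJ2']
      simp only [stairSeq, Finset.mem_singleton]
      push_cast
      split_ifs <;> omega

theorem redist_eq {r s a : ℕ} (hrs : r < s) (ha : r * (r + 1) + s * (s + 1) ≤ 2 * a + 2)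
    {lam mu : YoungDiagram}
    (hlam : HasCoreQuotient lam (staircase a) (staircase r) (staircase s))
    (hmu : HasCoreQuotient mu (staircase a) (staircase (r + 1)) (staircase (s - 1))) {d : ℤ}
    (hd : d = r + 1 - s) :
    redist a d lam = ((-1 : ℚ) ^ (d.natAbs + s)) • Finsupp.single mu 1 := by
  obtain ⟨hP, hQ⟩ := runners_of_spec hlam
  obtain ⟨hP', hQ'⟩ := runners_of_spec hmu
  have sl := hlam.spec.2.2
  have sm := hmu.spec.2.2
  have kr := card_staircase r
  have ks := card_staircase s
  have kr' := card_staircase (r + 1)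
  have ks' := card_staircase (s - 1)
  obtain ⟨t, rfl⟩ : ∃ t, s = t + 1 := ⟨s - 1, by omega⟩
  rw [Nat.add_sub_cancel] at *
  have hcard : (mu.card : ℤ) = lam.card + 2 * d := by
    zify at sl sm kr ks kr' ks'
    push_cast at hd
    subst hd
    linarith
  -- Here `2 * lam.card = a * (a + 1) + 2 * (r * (r + 1) + s * (s + 1))`, at most `a ^ 2 + 5 * a +
  -- 4`, while the RoCK bound is `a ^ 2 + 5 * a + 8`. Since `d ≤ 0`, the partition `y` is no larger
  -- than `lam`.
  have bound : ∀ y : YoungDiagram, defect y = defect lam → (y.card : ℤ) = lam.card + 2 * d →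
      ∃ m, RockAt a m (maya y) := by
    intro y h1 h2
    refine exists_rockAt (h1.trans (defect_eq_of_core hlam.1)) ?_
    have : y.card ≤ lam.card := by push_cast at hd; omega
    nlinarith
  obtain ⟨m, hM⟩ : ∃ m, RockAt a m (maya lam) := by
    refine exists_rockAt (defect_eq_of_core hlam.1) ?_
    nlinarith
  obtain ⟨m', hM'⟩ := bound mu ((defect_eq_of_core hmu.1).trans (defect_eq_of_core hlam.1).symm)
    hcard
  ext y
  rw [Finsupp.smul_apply, smul_eq_mul]
  by_cases hy : y = mu
  · rw [hy, redist_apply_eq_mul hM hP hQ hM' hcard, hP', hQ', runnerSum_succ,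
      Finsupp.single_eq_same]
    have := runnerSum_pred (s := t + 1) (by omega)
    rw [Nat.add_sub_cancel] at this
    rw [this]
    ring
  · rw [Finsupp.single_eq_of_ne hy, mul_zero]
    by_contra hne
    obtain ⟨hc, hdef⟩ := content_of_redist_ne_zero hne
    obtain ⟨m'', hMy⟩ := bound y hdef hc
    rw [redist_apply_eq_mul hM hP hQ hMy hc] at hne
    have h12 := right_ne_zero_of_mul hne
    obtain ⟨h1, h2⟩ := runners_eq_of_ne_zero hrs hM hP hQ hMy (by rw [hc, hd])
      (left_ne_zero_of_mul h12) (right_ne_zero_of_mul h12)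
    rw [Nat.add_sub_cancel] at h1
    exact hy (maya_injective (ext_runners (h1.trans hP'.symm) (h2.trans hQ'.symm)))

end SymChar

end

/-! ### Transfer to Specht characters -/

open SymChar in
theorem proposition5 (r s a : ℕ) (hrs : r < s)
    (ha : (1 / 2 : ℚ) * ((r : ℚ) * (r + 1) + (s : ℚ) * (s + 1)) - 1 ≤ (a : ℚ))
    (lam mu : YoungDiagram)
    (hlam : HasCoreQuotient lam (staircase a) (staircase r) (staircase s))
    (hmu : HasCoreQuotient mu (staircase a) (staircase (r + 1)) (staircase (s - 1))) :
    quotRed ((a : ZMod 2) + 1) (-((s : ℤ) - (r : ℤ) - 1)) (specht lam) = specht mu ∨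
      quotRed ((a : ZMod 2) + 1) (-((s : ℤ) - (r : ℤ) - 1)) (specht lam) = - specht mu := by
  have h : quotRed ((a : ZMod 2) + 1) (-((s : ℤ) - (r : ℤ) - 1)) (specht lam) =
      (-1 : ℚ) ^ ((-((s : ℤ) - (r : ℤ) - 1)).natAbs + s) • specht mu := by
    have ha' : r * (r + 1) + s * (s + 1) ≤ 2 * a + 2 := by
      have : (r : ℚ) * (r + 1) + s * (s + 1) ≤ 2 * a + 2 := by linarith
      exact_mod_cast this
    have := quotRed_specht (a := (a : ℤ)) (lam := lam) (-((s : ℤ) - (r : ℤ) - 1))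
    rw [redist_eq hrs ha' hlam hmu (by ring), map_smul, spechtLin_single] at this
    rw [← this, Int.cast_natCast]
  rw [h]
  rcases neg_one_pow_eq_or ℚ ((-((s : ℤ) - (r : ℤ) - 1)).natAbs + s) with h1 | h1
  · exact Or.inl (by rw [h1, one_smul])
  · exact Or.inr (by rw [h1]; exact neg_one_smul ℚ (specht mu))
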